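/- Let $L$ be a non-empty finite set of even cardinality. Graphs on $L$ are finite multigraphs, loops allowed (a loop contributes two to the valence). Let $S_L$ be the quotient of the polynomial ring over $\mathbb{Z}$ in variables $X_{ab}$ ($a,b\in L$) by the relations $X_{aa}=0$, $X_{ab}=-X_{ba}$ and $X_{ab}X_{cd}=X_{ad}X_{cb}+X_{ac}X_{bd}$. For a directed graph $\Gamma$ on $L$ let $X_\Gamma\in S_L$ be the product of the $X_{ab}$ over its edges $a\to b$. Let $R_L\subset S_L$ be the subring spanned over $\mathbb{Z}$ by the $X_\Gamma$ with $\Gamma$ regular, let $R_L^{(d)}$ be the span of those with $\Gamma$ regular of degree $d$, and put $V_L=R_L^{(1)}$. Let $I_L$ be the kernel of the canonical map $\mathrm{Sym}_{\mathbb{Z}}(V_L)\to R_L$, let $I_L^{(k)}=I_L\cap \mathrm{Sym}^k(V_L)$, and let $Q_L$ be the ideal of $\mathrm{Sym}(V_L)$ generated by $I_L^{(2)}$, with $Q_L^{(3)}=Q_L\cap\mathrm{Sym}^3(V_L)$. Fix an orientation $\epsilon$ on $L$, i.e. a function from directed matchings on $L$ to $\{\pm1\}$ with $\epsilon(\sigma\Gamma)=\mathrm{sgn}(\sigma)\epsilon(\Gamma)$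 for all permutations $\sigma$ of $L$. A *generalized Segre datum* $\Sigma=(\Gamma,\{U_R,U_G,U_B\})$ consists of a partition of $L$ into three non-empty subsets of even cardinality and an undirected graph $\Gamma$ on $L$ with edges colored red, green or blue, such that every vertex has valence one in each color, and such that between any two parts there are either no edges or exactly two edges, in the latter case both having the color of the third part. It is *small* if one of the three parts has cardinality two. Choose directions on the edges of $\Gamma$; let $\Gamma_R,\Gamma_G,\Gamma_B$ be the resulting directed matchings of each color, let $\Gamma_{\mathrm{black}}$ consist of the red edges inside $U_R$, the green edges inside $U_G$ and the blue edges inside $U_B$ (it is a matching), let $\Gamma_{\mathrm{purple}}$ consist of all other edges (it is regular of degree two), and put $s=\epsilon(\Gamma_R)\epsilon(\Gamma_G)\epsilon(\Gamma_B)$. Set $$\mathrm{Rel}(\Sigma)=s\,X_{\Gamma_R}X_{\Gamma_G}X_{\Gamma_B}-s\,X_{\Gamma_{\mathrm{black}}}\,q\ \in\ \mathrm{Sym}^3(V_L)/Q_L^{(3)},$$ where $q\in\mathrm{Sym}^2(V_L)$ is any element mapping to $X_{\Gamma_{\mathrm{purple}}}\in R_L^{(2)}$. This does not depend on the directions or on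 $q$. A *small generalized Segre cubic relation* is an element of $\mathrm{Sym}^3(V_L)$ lifting $\mathrm{Rel}(\Sigma)$ for some small generalized Segre datum $\Sigma$. **Theorem.** The ideal $I_L$ of $\mathrm{Sym}(V_L)$ is generated (over $\mathbb{Z}$) by the quadratic relations $I_L^{(2)}$ together with the small generalized Segre cubic relations. -/

import Mathlib

noncomputable section

namespace PointsOnLine

universe u

/-- A directed multigraph on `L` (loops allowed): a finite multiset of directed edges.  Addition of
multisets is the semigroup operation on graphs (disjoint union of edge sets). -/
abbrev DirGraph (L : Type u) : Type u := Multiset (L × L)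

/-- An undirected multigraph on `L` (loops allowed). -/
abbrev UndirGraph (L : Type u) : Type u := Multiset (Sym2 L)

/-- The undirected graph underlying a directed graph. -/
def underlying {L : Type u} (Γ : DirGraph L) : UndirGraph L := Γ.map fun e => s(e.1, e.2)

/-- The valence of a vertex (a loop contributes two). -/
def valence {L : Type u} [DecidableEq L] (Γ : UndirGraph L) (v : L) : ℕ :=
  (Γ.bind Sym2.toMultiset).count v

/-- Regular of degree `d`: every vertex has valence `d`. -/
def IsRegularOfDeg {L : Type u} [DecidableEq L] (Γ : UndirGraph L) (d : ℕ) : Prop :=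
  ∀ v, valence Γ v = d

/-! ### The rings `S_L` and `R_L` -/

/-- The loop, sign and Plücker relations in the polynomial ring on the directed edges (which is the
semigroup algebra over `ℤ` of the directed graphs on `L`). -/
def graphRelations (L : Type u) : Set (MvPolynomial (L × L) ℤ) :=
  {p | ∃ a : L, p = MvPolynomial.X (a, a)} ∪
  {p | ∃ a b : L, p = MvPolynomial.X (a, b) + MvPolynomial.X (b, a)} ∪
  {p | ∃ a b c d : L, p = MvPolynomial.X (a, b) * MvPolynomial.X (c, d) -
    (MvPolynomial.X (a, d) * MvPolynomial.X (c, b) +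
      MvPolynomial.X (a, c) * MvPolynomial.X (b, d))}

/-- The ring `S_L`. -/
abbrev GraphRing (L : Type u) : Type u :=
  MvPolynomial (L × L) ℤ ⧸ Ideal.span (graphRelations L)

/-- The element `X_Γ` of `S_L`. -/
def graphElt {L : Type u} (Γ : DirGraph L) : GraphRing L :=
  (Γ.map fun e => Ideal.Quotient.mk (Ideal.span (graphRelations L)) (MvPolynomial.X e)).prod

/-- The degree `d` piece `R_L^{(d)}`: the subgroup of `S_L` spanned by the `X_Γ` with `Γ` regular of
degree `d`. -/
def degreePiece (L : Type u) [DecidableEq L] (d : ℕ) : Submodule ℤ (GraphRing L) :=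
  Submodule.span ℤ {x | ∃ Γ : DirGraph L, IsRegularOfDeg (underlying Γ) d ∧ x = graphElt Γ}

/-- The subgroup of `S_L` spanned by the `X_Γ` with `Γ` regular (of any degree). -/
def regularSpan (L : Type u) [DecidableEq L] : Submodule ℤ (GraphRing L) :=
  Submodule.span ℤ {x | ∃ (d : ℕ) (Γ : DirGraph L),
    IsRegularOfDeg (underlying Γ) d ∧ x = graphElt Γ}

lemma valence_add {L : Type u} [DecidableEq L] (Γ Δ : UndirGraph L) (v : L) :
    valence (Γ + Δ) v = valence Γ v + valence Δ v := by
  simp [valence, Multiset.add_bind]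

lemma underlying_add {L : Type u} (Γ Δ : DirGraph L) :
    underlying (Γ + Δ) = underlying Γ + underlying Δ := by
  simp [underlying]

lemma graphElt_add {L : Type u} (Γ Δ : DirGraph L) :
    graphElt (Γ + Δ) = graphElt Γ * graphElt Δ := by
  simp [graphElt]

lemma one_mem_regularSpan (L : Type u) [DecidableEq L] : (1 : GraphRing L) ∈ regularSpan L :=
  Submodule.subset_span ⟨0, 0, fun v => by simp [underlying, valence], by simp [graphElt]⟩

lemma mul_mem_regularSpan (L : Type u) [DecidableEq L] (x y : GraphRing L)
    (hx : x ∈ regularSpan L) (hy : y ∈ regularSpan L) : x * y ∈ regularSpan L := by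
  have h := Submodule.mul_mem_mul hx hy
  rw [regularSpan, Submodule.span_mul_span] at h
  refine Submodule.span_mono ?_ h
  rintro _ ⟨_, ⟨d, Γ, hΓ, rfl⟩, _, ⟨e, Δ, hΔ, rfl⟩, rfl⟩
  exact ⟨d + e, Γ + Δ, fun v => by rw [underlying_add, valence_add, hΓ, hΔ],
    (graphElt_add Γ Δ).symm⟩

/-- The ring `R_L`: the subring of `S_L` whose underlying group is spanned by the `X_Γ` with `Γ`
regular. -/
def invariantRing (L : Type u) [DecidableEq L] : Subalgebra ℤ (GraphRing L) :=
  (regularSpan L).toSubalgebra (one_mem_regularSpan L) (mul_mem_regularSpan L)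

lemma degreePiece_le (L : Type u) [DecidableEq L] (d : ℕ) :
    degreePiece L d ≤ Subalgebra.toSubmodule (invariantRing L) := by
  refine Submodule.span_mono ?_
  rintro _ ⟨Γ, hΓ, rfl⟩
  exact ⟨d, Γ, hΓ, rfl⟩

/-! ### The symmetric algebra on `V_L` and the ideals of relations -/

/-- `V_L = R_L^{(1)}`. -/
abbrev degreeOne (L : Type u) [DecidableEq L] : Submodule ℤ (GraphRing L) := degreePiece L 1

/-- `Sym(V_L)`, over `ℤ`. -/
abbrev SymV (L : Type u) [DecidableEq L] : Type u := SymmetricAlgebra ℤ (degreeOne L)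

/-- `Sym^k(V_L)` as a subgroup of `Sym(V_L)`. -/
def symPiece (L : Type u) [DecidableEq L] (k : ℕ) : Submodule ℤ (SymV L) :=
  LinearMap.range (SymmetricAlgebra.ι ℤ (degreeOne L)) ^ k

/-- The canonical map `Sym(V_L) → R_L`. -/
def symToRing (L : Type u) [DecidableEq L] : SymV L →ₐ[ℤ] invariantRing L :=
  SymmetricAlgebra.lift (Submodule.inclusion (degreePiece_le L 1))

/-- The ideal of relations `I_L`. -/
def relationIdeal (L : Type u) [DecidableEq L] : Ideal (SymV L) := RingHom.ker (symToRing L)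

/-- `I_L^{(k)}`, the relations of degree `k`. -/
def relationsOfDegree (L : Type u) [DecidableEq L] (k : ℕ) : Set (SymV L) :=
  {f | f ∈ relationIdeal L ∧ f ∈ symPiece L k}

/-- The ideal `Q_L` generated by the quadratic relations. -/
def quadraticIdeal (L : Type u) [DecidableEq L] : Ideal (SymV L) :=
  Ideal.span (relationsOfDegree L 2)

/-! ### Matchings and orientations -/

/-- Directed matchings on `L`. -/
def DirMatching (L : Type u) [DecidableEq L] : Type u :=
  {Γ : DirGraph L // IsRegularOfDeg (underlying Γ) 1}

/-- The generator of `Sym(V_L)` given by a directed matching. -/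
def matchingElt {L : Type u} [DecidableEq L] (Γ : DirMatching L) : SymV L :=
  SymmetricAlgebra.ι ℤ (degreeOne L)
    ⟨graphElt Γ.1, Submodule.subset_span ⟨Γ.1, Γ.2, rfl⟩⟩

/-- An orientation on `L`: a sign `ε(Γ)` for every directed matching `Γ`, such that
`ε(σ Γ) = sgn(σ) ε(Γ)` for every permutation `σ` of `L`. -/
structure Orientation (L : Type u) [Fintype L] [DecidableEq L] where
  /-- the sign of a directed matching -/
  sign : DirMatching L → ℤˣ
  equivariant : ∀ (σ : Equiv.Perm L) (Γ Δ : DirMatching L),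
    Δ.1 = Γ.1.map (fun e => (σ e.1, σ e.2)) → sign Δ = Equiv.Perm.sign σ * sign Γ

/-! ### Generalized Segre data -/

/-- The three colors, used both for edges and for the parts of `L`. -/
inductive Color : Type
  | red : Color
  | green : Color
  | blue : Color

/-- The edge `e` joins a vertex of `A` to a vertex of `B`. -/
abbrev Joins {L : Type u} (A B : Finset L) (e : Sym2 L) : Prop :=
  ∃ a ∈ A, ∃ b ∈ B, e = s(a, b)

/-- A generalized Segre datum on `L`: an undirected graph with edges colored red, green or blue, and
a partition of `L` into three (non-empty) even parts `U_red`, `U_green`, `U_blue`. -/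
structure SegreDatum (L : Type u) [Fintype L] [DecidableEq L] where
  /-- the edges of a given color -/
  graph : Color → UndirGraph L
  /-- the parts of the partition -/
  part : Color → Finset L
  part_nonempty : ∀ c, (part c).Nonempty
  part_even : ∀ c, Even (part c).card
  part_disjoint : ∀ c c', c ≠ c' → Disjoint (part c) (part c')
  part_cover : ∀ v : L, ∃ c, v ∈ part c
  /-- every vertex has valence one for each of the three colors -/
  regular : ∀ c, IsRegularOfDeg (graph c) 1
  /-- between two different parts there are no edges or exactly two edges, all colors together -/
  special_count : ∀ c c', c ≠ c' →
    (graph .red + graph .green + graph .blue).countP (Joins (part c) (part c')) = 0 ∨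
    (graph .red + graph .green + graph .blue).countP (Joins (part c) (part c')) = 2
  /-- an edge between two different parts has the color of the remaining part -/
  special_color : ∀ c c', c ≠ c' → ∀ d, ∀ e ∈ graph d, Joins (part c) (part c') e →
    d ≠ c ∧ d ≠ c'

/-- A datum is small if one of its parts has cardinality two. -/
def SegreDatum.IsSmall {L : Type u} [Fintype L] [DecidableEq L] (S : SegreDatum L) : Prop :=
  ∃ c, (S.part c).card = 2

/-- A directed colored graph whose underlying undirected colored graph is that of the datum `S`. -/
structure Directing {L : Type u} [Fintype L] [DecidableEq L] (S : SegreDatum L) where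
  /-- the directed edges of a given color -/
  edges : Color → DirGraph L
  underlying_edges : ∀ c, underlying (edges c) = S.graph c

lemma valence_eq_zero {L : Type u} [DecidableEq L] {Γ : DirGraph L} {v : L} (h : ∀ e ∈ Γ, e.1 ≠ v ∧ e.2 ≠ v) :
    valence (underlying Γ) v = 0 := by
  rw [valence, Multiset.count_eq_zero, Multiset.mem_bind]
  rintro ⟨e, he, hv⟩
  rw [underlying, Multiset.mem_map] at he
  obtain ⟨e, he, rfl⟩ := he
  rw [Sym2.mem_toMultiset, Sym2.mem_iff] at hv
  rcases hv with hv | hv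
  · exact (h e he).1 hv.symm
  · exact (h e he).2 hv.symm

section Recoloring

variable {L : Type u} [Fintype L] [DecidableEq L] {S : SegreDatum L}

/-- The directed matching formed by the edges of color `c`. -/
def Directing.matching (D : Directing S) (c : Color) : DirMatching L :=
  ⟨D.edges c, by rw [D.underlying_edges]; exact S.regular c⟩

/-- The edges of color `c` which lie inside the part `U_c`. -/
def Directing.inside (D : Directing S) (c : Color) : DirGraph L :=
  (D.edges c).filter fun e => e.1 ∈ S.part c ∧ e.2 ∈ S.part c

/-- The edges of color `c` which do not lie inside the part `U_c`. -/
def Directing.outside (D : Directing S) (c : Color) : DirGraph L :=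
  (D.edges c).filter fun e => ¬ (e.1 ∈ S.part c ∧ e.2 ∈ S.part c)

/-- The black graph: the red, green, blue edges lying inside `U_red`, `U_green`, `U_blue`. -/
def Directing.black (D : Directing S) : DirGraph L :=
  D.inside .red + D.inside .green + D.inside .blue

/-- The purple graph: all edges which are not black. -/
def Directing.purple (D : Directing S) : DirGraph L :=
  D.outside .red + D.outside .green + D.outside .blue

lemma Directing.valence_inside_ne (D : Directing S) {a c : Color} (h : c ≠ a) {v : L}
    (hv : v ∈ S.part a) : valence (underlying (D.inside c)) v = 0 := by
  refine valence_eq_zero fun e he => ?_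
  obtain ⟨-, h1, h2⟩ := Multiset.mem_filter.mp he
  have hd := Finset.disjoint_left.mp (S.part_disjoint c a h)
  exact ⟨fun h' => hd h1 (h' ▸ hv), fun h' => hd h2 (h' ▸ hv)⟩

lemma Directing.valence_inside_self (D : Directing S) {a : Color} {v : L}
    (hv : v ∈ S.part a) : valence (underlying (D.inside a)) v = 1 := by
  have h0 : valence (underlying (D.outside a)) v = 0 := by
    refine valence_eq_zero fun e he => ?_
    obtain ⟨he, hn⟩ := Multiset.mem_filter.mp he
    have hmem : s(e.1, e.2) ∈ S.graph a := by
      rw [← D.underlying_edges]; exact Multiset.mem_map_of_mem _ he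
    have key : ∀ x w : L, x ∈ S.part a → s(x, w) ∈ S.graph a → w ∈ S.part a := by
      intro x w hx hxw
      obtain ⟨c, hc⟩ := S.part_cover w
      by_cases hac : a = c
      · exact hac ▸ hc
      · exact absurd rfl (S.special_color a c hac a _ hxw ⟨x, hx, w, hc, rfl⟩).1
    constructor
    · intro h
      have h1 : e.1 ∈ S.part a := h ▸ hv
      exact hn ⟨h1, key _ _ h1 hmem⟩
    · intro h
      have h2 : e.2 ∈ S.part a := h ▸ hv
      exact hn ⟨key _ _ h2 (by rw [Sym2.eq_swap]; exact hmem), h2⟩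
  have h1 : D.inside a + D.outside a = D.edges a := Multiset.filter_add_not _ _
  have h2 := S.regular a v
  rw [← D.underlying_edges, ← h1, underlying_add, valence_add, h0] at h2
  exact h2

/-- The black graph is a directed matching. -/
def Directing.blackMatching (D : Directing S) : DirMatching L :=
  ⟨D.black, by
    intro v
    obtain ⟨a, ha⟩ := S.part_cover v
    rw [Directing.black, underlying_add, underlying_add, valence_add, valence_add]
    cases a
    · rw [D.valence_inside_self ha, D.valence_inside_ne (by simp) ha,
        D.valence_inside_ne (by simp) ha]
    · rw [D.valence_inside_self ha, D.valence_inside_ne (by simp) ha,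
        D.valence_inside_ne (by simp) ha]
    · rw [D.valence_inside_self ha, D.valence_inside_ne (by simp) ha,
        D.valence_inside_ne (by simp) ha]⟩

end Recoloring

/-- The sign `ε` of a directed colored graph: the product of the signs of its three matchings. -/
def Directing.sign {L : Type u} [Fintype L] [DecidableEq L] {S : SegreDatum L}
    (D : Directing S) (ε : Orientation L) : ℤˣ :=
  ε.sign (D.matching .red) * ε.sign (D.matching .green) * ε.sign (D.matching .blue)

/-- `f` is a lift to `Sym^3(V_L)` of `Rel(S) = Y_S - Y'_S ∈ Sym^3(V_L) / Q_L^{(3)}`.  Here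
`Y_S = ε(D) X_red X_green X_blue`, and `Y'_S = ε(D) X_black q` with `q ∈ Sym^2(V_L)` any expression
of the element `X_purple` of `R_L^{(2)}` in terms of degree one elements. -/
def IsSegreRelation {L : Type u} [Fintype L] [DecidableEq L] (ε : Orientation L)
    (S : SegreDatum L) (f : SymV L) : Prop :=
  f ∈ symPiece L 3 ∧
  ∃ (D : Directing S) (q : SymV L), q ∈ symPiece L 2 ∧
    (symToRing L q : GraphRing L) = graphElt D.purple ∧
    f - (((D.sign ε : ℤˣ) : ℤ) • (matchingElt (D.matching .red) *
            matchingElt (D.matching .green) * matchingElt (D.matching .blue)) -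
          ((D.sign ε : ℤˣ) : ℤ) • (matchingElt D.blackMatching * q)) ∈ quadraticIdeal L

/-- The small generalized Segre cubic relations. -/
def smallSegreRelations {L : Type u} [Fintype L] [DecidableEq L] (ε : Orientation L) :
    Set (SymV L) :=
  {f | ∃ S : SegreDatum L, S.IsSmall ∧ IsSegreRelation ε S f}

end PointsOnLine

end

/-! ### Weightings of the caterpillar tree: splicing, exchange of tails, balanced decomposition. -/

noncomputable section

namespace PointsOnLine

/-! The proof is a toric degeneration carried out over `ℤ`. Number the vertices, group them into `m`
consecutive pairs, and send `X_{ab}` to a difference of coordinates, the two points of the `i`-th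
pair having coordinates `r_i` and `r_i + l_i`. In a suitable lexicographic order the leading
variable of an edge is `l_i` if it lies inside the `i`-th pair, and `r_j` if `j` is the later of its
two pairs; the leading coefficient is a sign. By the Plücker relations, loopless graphs with the
same valences and the same leading monomial agree up to sign modulo shorter graphs
(`LeadEquiv.of_lead_eq`). Hence each degree piece embeds in the polynomial ring, and its leading
exponents are those of regular graphs (`exists_degree_eq`). Halving the number of edges that cross
in front of each pair, and the number that leave each pair, identifies these exponents with the
weightings of a caterpillar tree (`exists_weighting`, `exists_matching`).

The combinatorial core, `IsMoveRelation.of_sum_eq`, describes the relations between sums of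
weightings of degree one. Two families with the same sum are connected by two kinds of moves:
replacing two members by two others of the same sum, and replacing three members whose weights at
one node are (0,1,1), (1,1,0), (1,0,1) by three with weights (0,0,0), (1,1,1), (1,1,1). Indeed, in a
family of least energy the multiset of weights at each node is forced by its sums
(`IsMoveRelation.isReduced`, `IsReduced.eq`), and families with the same multisets of nodes differ
by swaps of tails (`IsMoveRelation.of_node_eq`).

Both moves lift to `Sym(V_L)`. Weightings of degree two decompose (`exists_balanced_add`), so
elements of degree one and two can be rewritten in products of matchings without raising the leading
exponent (`exists_mem_belowSpan`). An exchange then comes from a quadratic relation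
(`FamilyRel.of_pair`). The cubic move comes from a small generalized Segre relation whose three
parts are the vertices left of a pair, those right of it, and the pair itself
(`FamilyRel.of_segre`). Modulo the ideal generated by these relations, a product of matchings
therefore depends only on its leading exponent, up to smaller products. So `Sym(V_L)` is this ideal
plus the span of one product for each exponent, and those products have independent images; nothing
else can lie in the kernel (`relationIdeal_le`). -/

/-- A weighting of degree `d` of the caterpillar tree with `m` legs: the spine edge in front of the
`i`-th leg has weight `t i`, the leg has weight `s i`, and the three weights around a node of the
spine satisfy the triangle inequalities. -/
@[ext]
structure Weighting (m d : ℕ) where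
  /-- the weights of the spine -/
  t : ℕ → ℕ
  /-- the weights of the legs -/
  s : ℕ → ℕ
  t_zero : t 0 = 0
  t_end : ∀ i, m ≤ i → t i = 0
  s_le : ∀ i, s i ≤ d
  s_le_add : ∀ i, s i ≤ t i + t (i + 1)
  left_le : ∀ i, t i ≤ t (i + 1) + s i
  right_le : ∀ i, t (i + 1) ≤ t i + s i

namespace Weighting

variable {m d : ℕ}

lemma s_end (P : Weighting m d) {i : ℕ} (h : m ≤ i) : P.s i = 0 := by
  have h1 := P.s_le_add i
  have h2 := P.t_end i h
  have h3 := P.t_end (i + 1) (by omega)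
  omega

/-- The sum of two weightings. -/
def add {e : ℕ} (P : Weighting m d) (Q : Weighting m e) : Weighting m (d + e) where
  t i := P.t i + Q.t i
  s i := P.s i + Q.s i
  t_zero := by simp [P.t_zero, Q.t_zero]
  t_end i hi := by simp [P.t_end i hi, Q.t_end i hi]
  s_le i := by have := P.s_le i; have := Q.s_le i; omega
  s_le_add i := by have := P.s_le_add i; have := Q.s_le_add i; omega
  left_le i := by have := P.left_le i; have := Q.left_le i; omega
  right_le i := by have := P.right_le i; have := Q.right_le i; omega

/-- `R` follows `P` up to the `i`-th node, where it has leg weight `σ`, and follows `Q` afterwards. -/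
structure IsSplice (i σ : ℕ) (P Q R : Weighting m d) : Prop where
  t_le : ∀ k, k ≤ i → R.t k = P.t k
  t_gt : ∀ k, i < k → R.t k = Q.t k
  s_lt : ∀ k, k < i → R.s k = P.s k
  s_eq : R.s i = σ
  s_gt : ∀ k, i < k → R.s k = Q.s k

/-- The conditions on a weighting are local at the nodes, so a head of `P` and a tail of `Q` fit
together as soon as the triangle inequalities hold at the single new node. -/
lemma exists_isSplice (i σ : ℕ) (P Q : Weighting m d) (h : σ ≤ d) (h1 : σ ≤ P.t i + Q.t (i + 1))
    (h2 : P.t i ≤ Q.t (i + 1) + σ) (h3 : Q.t (i + 1) ≤ P.t i + σ) :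
    ∃ R, IsSplice i σ P Q R := by
  have key : ∀ k : ℕ, k < i ∨ k = i ∨ i < k := fun k => lt_trichotomy k i
  refine ⟨⟨fun k => if k ≤ i then P.t k else Q.t k,
    fun k => if k < i then P.s k else if k = i then σ else Q.s k, ?_, ?_, ?_, ?_, ?_, ?_⟩,
    ?_, ?_, ?_, by simp, ?_⟩
  · simp [P.t_zero]
  · intro k hk
    by_cases hki : k ≤ i
    · simp [hki, P.t_end k hk]
    · simp [hki, Q.t_end k hk]
  all_goals intro k
  · rcases key k with hk | hk | hk
    · simpa [hk] using P.s_le k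
    · simpa [hk] using h
    · simpa [hk.not_gt, hk.ne'] using Q.s_le k
  · rcases key k with hk | hk | hk
    · simpa [hk, hk.le, Nat.succ_le_of_lt hk] using P.s_le_add k
    · simpa [hk] using h1
    · simpa [hk.not_gt, hk.ne', hk.not_ge, (Nat.lt_succ_of_lt hk).not_ge] using Q.s_le_add k
  · rcases key k with hk | hk | hk
    · simpa [hk, hk.le, Nat.succ_le_of_lt hk] using P.left_le k
    · simpa [hk] using h2
    · simpa [hk.not_gt, hk.ne', hk.not_ge, (Nat.lt_succ_of_lt hk).not_ge] using Q.left_le k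
  · rcases key k with hk | hk | hk
    · simpa [hk, hk.le, Nat.succ_le_of_lt hk] using P.right_le k
    · simpa [hk] using h3
    · simpa [hk.not_gt, hk.ne', hk.not_ge, (Nat.lt_succ_of_lt hk).not_ge] using Q.right_le k
  · intro hk; simp [hk]
  · intro hk; simp [hk.not_ge]
  · intro hk; simp [hk]
  · intro hk; simp [hk.not_gt, hk.ne']

/-- The three weights around the `i`-th node of the spine. -/
def node (i : ℕ) (P : Weighting m d) : ℕ × ℕ × ℕ := (P.t i, P.s i, P.t (i + 1))

/-- A relation between families of weightings of degree one which is compatible with exchanging two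
members for two others of the same sum, and with the Segre move on three members. -/
structure IsMoveRelation
    (r : Multiset (Weighting m 1) → Multiset (Weighting m 1) → Prop) : Prop where
  refl : ∀ F, r F F
  symm : ∀ F G, r F G → r G F
  trans : ∀ F G H, r F G → r G H → r F H
  cons : ∀ P F G, r F G → r (P ::ₘ F) (P ::ₘ G)
  exchange : ∀ P Q P' Q' F, (∀ i, P.t i + Q.t i = P'.t i + Q'.t i) →
    (∀ i, P.s i + Q.s i = P'.s i + Q'.s i) → r (P ::ₘ Q ::ₘ F) (P' ::ₘ Q' ::ₘ F)
  segre : ∀ i P₁ P₂ P₃ A B C F, node i P₁ = (0, 1, 1) → node i P₂ = (1, 1, 0) →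
    node i P₃ = (1, 0, 1) → IsSplice i 0 P₁ P₂ A → IsSplice i 1 P₂ P₁ B → IsSplice i 1 P₃ P₃ C →
    r (P₁ ::ₘ P₂ ::ₘ P₃ ::ₘ F) (A ::ₘ B ::ₘ C ::ₘ F)

lemma IsSplice.t_add {i σ τ : ℕ} {P Q A B : Weighting m d} (hA : IsSplice i σ P Q A)
    (hB : IsSplice i τ Q P B) (k : ℕ) : A.t k + B.t k = P.t k + Q.t k := by
  rcases le_or_gt k i with h | h
  · rw [hA.t_le k h, hB.t_le k h]
  · rw [hA.t_gt k h, hB.t_gt k h, add_comm]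

lemma IsSplice.s_add {i σ τ : ℕ} {P Q A B : Weighting m d} (hA : IsSplice i σ P Q A)
    (hB : IsSplice i τ Q P B) (h : σ + τ = P.s i + Q.s i) (k : ℕ) :
    A.s k + B.s k = P.s k + Q.s k := by
  rcases lt_trichotomy k i with h | rfl | h
  · rw [hA.s_lt k h, hB.s_lt k h]
  · rw [hA.s_eq, hB.s_eq, h]
  · rw [hA.s_gt k h, hB.s_gt k h, add_comm]

lemma IsSplice.node_lt {i σ : ℕ} {P Q A : Weighting m d} (hA : IsSplice i σ P Q A) {k : ℕ}
    (h : k < i) : node k A = node k P := by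
  simp [node, hA.t_le k h.le, hA.s_lt k h, hA.t_le (k + 1) h]

lemma IsSplice.node_gt {i σ : ℕ} {P Q A : Weighting m d} (hA : IsSplice i σ P Q A) {k : ℕ}
    (h : i < k) : node k A = node k Q := by
  simp [node, hA.t_gt k h, hA.s_gt k h, hA.t_gt (k + 1) (by omega)]

lemma IsSplice.node_eq {i σ : ℕ} {P Q A : Weighting m d} (hA : IsSplice i σ P Q A) :
    node i A = (P.t i, σ, Q.t (i + 1)) := by
  simp [node, hA.t_le i le_rfl, hA.s_eq, hA.t_gt (i + 1) (by omega)]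

/-- Families with the same nodes are related by exchanging tails. -/
lemma IsMoveRelation.of_node_eq {r : Multiset (Weighting m 1) → Multiset (Weighting m 1) → Prop}
    (hr : IsMoveRelation r) (G : Multiset (Weighting m 1)) : ∀ F : Multiset (Weighting m 1),
    (∀ i, F.map (node i) = G.map (node i)) → r F G := by
  induction G using Multiset.induction with
  | empty =>
    intro F h
    have : F = 0 := by simpa using h 0
    rw [this]; exact hr.refl _
  | cons Q G ih =>
    intro F h
    -- The member `Q` is grown from left to right: after tail swaps some member of the family agrees
    -- with `Q` up to the `i`-th spine edge, and the multisets of nodes never change.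
    have key : ∀ i, ∃ P R, r F (P ::ₘ R) ∧ (∀ k, (P ::ₘ R).map (node k) = (Q ::ₘ G).map (node k)) ∧
        (∀ k, k ≤ i → P.t k = Q.t k) ∧ (∀ k, k < i → P.s k = Q.s k) := by
      intro i
      induction i with
      | zero =>
        have hF : F ≠ 0 := by
          rintro rfl
          simpa using h 0
        obtain ⟨P, hP⟩ := Multiset.exists_mem_of_ne_zero hF
        obtain ⟨R, rfl⟩ := Multiset.exists_cons_of_mem hP
        refine ⟨P, R, hr.refl _, h, ?_, by simp⟩
        intro k hk
        obtain rfl : k = 0 := by omega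
        rw [P.t_zero, Q.t_zero]
      | succ i ihi =>
        obtain ⟨P, R, hPR, hn, ht, hs⟩ := ihi
        by_cases hPQ : node i Q = node i P
        · simp only [node, Prod.mk.injEq] at hPQ
          refine ⟨P, R, hPR, hn, fun k hk => ?_, fun k hk => ?_⟩
          · rcases Nat.lt_or_ge i k with h' | h'
            · obtain rfl : k = i + 1 := by omega
              exact hPQ.2.2.symm
            · exact ht k h'
          · rcases Nat.lt_or_ge k i with h' | h'
            · exact hs k h'
            · obtain rfl : k = i := by omega
              exact hPQ.2.1.symm
        · have hmem : node i Q ∈ (P ::ₘ R).map (node i) := by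
            rw [hn i]; simp
          rw [Multiset.map_cons, Multiset.mem_cons, or_iff_right hPQ, Multiset.mem_map] at hmem
          obtain ⟨P₂, hP₂, hnode⟩ := hmem
          obtain ⟨R, rfl⟩ := Multiset.exists_cons_of_mem hP₂
          simp only [node, Prod.mk.injEq] at hnode
          have hti := ht i le_rfl
          have hPP : P.t i = P₂.t i := by rw [hti, hnode.1]
          -- `P` and `P₂` have the same weight in front of the node, so their tails, including the
          -- legs at `i`, can be interchanged.
          obtain ⟨A, hA⟩ := exists_isSplice i (P₂.s i) P P₂ (P₂.s_le i)
            (hPP ▸ P₂.s_le_add i) (hPP ▸ P₂.left_le i) (hPP ▸ P₂.right_le i)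
          obtain ⟨B, hB⟩ := exists_isSplice i (P.s i) P₂ P (P.s_le i)
            (hPP ▸ P.s_le_add i) (hPP ▸ P.left_le i) (hPP ▸ P.right_le i)
          refine ⟨A, B ::ₘ R, hr.trans _ _ _ hPR (hr.exchange _ _ _ _ _ ?_ ?_), ?_, ?_, ?_⟩
          · intro k; exact (hA.t_add hB k).symm
          · intro k; exact (hA.s_add hB (add_comm _ _) k).symm
          · intro k
            rw [← hn k]
            simp only [Multiset.map_cons]
            rcases lt_trichotomy k i with hk | rfl | hk
            · rw [hA.node_lt hk, hB.node_lt hk]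
            · rw [hA.node_eq, hB.node_eq, Multiset.cons_swap]
              simp [node, hPP]
            · rw [hA.node_gt hk, hB.node_gt hk, Multiset.cons_swap]
          · intro k hk
            rcases Nat.lt_or_ge i k with h' | h'
            · obtain rfl : k = i + 1 := by omega
              rw [hA.t_gt _ h', hnode.2.2]
            · rw [hA.t_le k h', ht k h']
          · intro k hk
            rcases Nat.lt_or_ge k i with h' | h'
            · rw [hA.s_lt k h', hs k h']
            · obtain rfl : k = i := by omega
              rw [hA.s_eq, hnode.2.1]
    -- All weights vanish beyond `m`, so agreement up to `m` is equality.
    obtain ⟨P, R, hPR, hn, ht, hs⟩ := key m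
    have hPQ : P = Q := by
      ext k
      · rcases le_or_gt k m with h' | h'
        · exact ht k h'
        · rw [P.t_end k h'.le, Q.t_end k h'.le]
      · rcases lt_or_ge k m with h' | h'
        · exact hs k h'
        · rw [P.s_end h', Q.s_end h']
    subst hPQ
    refine hr.trans _ _ _ hPR (hr.cons _ _ _ (ih R fun i => ?_))
    have := hn i
    simpa using this

/-- A weighting of degree two is the sum of two weightings of degree one which differ by at most one
along the spine. -/
lemma exists_balanced_add (W : Weighting m 2) : ∃ P Q : Weighting m 1,
    (∀ i, P.t i + Q.t i = W.t i) ∧ (∀ i, P.s i + Q.s i = W.s i) ∧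
    ∀ i, P.t i ≤ Q.t i + 1 ∧ Q.t i ≤ P.t i + 1 := by
  -- Where `W.t i` is odd, `b i` says which summand takes the larger half. It has to switch exactly
  -- at a node (1,2,1): without a switch one summand would be (0,1,0), which violates the triangle
  -- inequality.
  let b : ℕ → ℕ := fun i => Nat.rec 0
    (fun i b => if W.t i = 1 ∧ W.t (i + 1) = 1 ∧ W.s i = 2 then 1 - b else b) i
  have hb : ∀ i, b (i + 1) = if W.t i = 1 ∧ W.t (i + 1) = 1 ∧ W.s i = 2 then 1 - b i else b i :=
    fun i => rfl
  have hb1 : ∀ i, b i ≤ 1 := by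
    intro i
    induction i with
    | zero => exact Nat.zero_le _
    | succ i ih => rw [hb]; split_ifs <;> omega
  let p : ℕ → ℕ := fun i => (W.t i + b i) / 2
  let q : ℕ → ℕ := fun i => (W.t i + (1 - b i)) / 2
  -- A leg of weight one goes to the summand whose spine weight changes. If `W.t` does not change
  -- there, it goes to the summand favoured by `b`, whose spine weight is then positive.
  let u : ℕ → ℕ := fun i => if W.s i = 0 then 0 else if W.s i = 2 then 1 else
    if W.t i = W.t (i + 1) then b i else (p (i + 1) - p i) + (p i - p (i + 1))
  have hp : ∀ i, p i = (W.t i + b i) / 2 := fun _ => rfl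
  have hq : ∀ i, q i = (W.t i + (1 - b i)) / 2 := fun _ => rfl
  have hu : ∀ i, u i = if W.s i = 0 then 0 else if W.s i = 2 then 1 else
    if W.t i = W.t (i + 1) then b i else (p (i + 1) - p i) + (p i - p (i + 1)) := fun _ => rfl
  have hus : ∀ i, u i ≤ W.s i ∧ u i ≤ 1 ∧ W.s i ≤ u i + 1 ∧
      u i ≤ p i + p (i + 1) ∧ p i ≤ p (i + 1) + u i ∧ p (i + 1) ≤ p i + u i ∧
      W.s i ≤ q i + q (i + 1) + u i ∧ q i + u i ≤ q (i + 1) + W.s i ∧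
      q (i + 1) + u i ≤ q i + W.s i := by
    intro i
    have h1 := W.s_le i
    have h2 := W.s_le_add i
    have h3 := W.left_le i
    have h4 := W.right_le i
    have h5 := hb1 i
    have h6 := hb i
    rw [hu i, hp i, hp (i + 1), hq i, hq (i + 1)]
    generalize W.s i = s at *
    generalize W.t i = x at *
    generalize W.t (i + 1) = y at *
    generalize b (i + 1) = c at *
    generalize b i = a at *
    clear_value b p q u
    have ha : a = 0 ∨ a = 1 := by omega
    have hs : s = 0 ∨ s = 1 ∨ s = 2 := by omega
    rcases hs with rfl | rfl | rfl
    · simp at h6 ⊢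
      subst h6
      omega
    · simp at h6 ⊢
      subst h6
      split_ifs with hxy
      · subst hxy; omega
      · rcases ha with rfl | rfl <;> omega
    · simp at h6 ⊢
      split_ifs at h6 with h7
      · obtain ⟨rfl, rfl⟩ := h7
        subst h6
        rcases ha with rfl | rfl <;> simp
      · subst h6
        have hxy : x = y ∨ x = y + 1 ∨ y = x + 1 ∨ x = y + 2 ∨ y = x + 2 := by omega
        rcases ha with rfl | rfl <;> omega
  have hpq : ∀ i, p i + q i = W.t i := by
    intro i
    have h5 := hb1 i
    rw [hp i, hq i]
    omega
  clear_value p q u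
  refine ⟨⟨p, u, ?_, ?_, fun i => (hus i).2.1, fun i => (hus i).2.2.2.1,
    fun i => (hus i).2.2.2.2.1, fun i => (hus i).2.2.2.2.2.1⟩,
    ⟨q, fun i => W.s i - u i, ?_, ?_, ?_, ?_, ?_, ?_⟩, hpq, ?_, ?_⟩
  · have := hpq 0; have := W.t_zero; omega
  · intro i hi; have := hpq i; have := W.t_end i hi; omega
  · have := hpq 0; have := W.t_zero; omega
  · intro i hi; have := hpq i; have := W.t_end i hi; omega
  · intro i; have := hus i; omega
  · intro i; have := hus i; omega
  · intro i; have := hus i; omega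
  · intro i; have := hus i; omega
  · intro i; have := hus i; dsimp only; omega
  · intro i
    have h5 := hb1 i
    dsimp only
    rw [hp i, hq i]
    omega

end Weighting

end PointsOnLine

end

/-! ### Rigidity of reduced nodes, and the energy. -/

noncomputable section

namespace PointsOnLine

namespace Weighting

variable {m d : ℕ}

/-- When the entries differ by at most one, the minimum is the rounded-down average. It is therefore
determined by the sum and the cardinality alone. -/
lemma sum_div_card_of_balanced {S : Multiset ℕ} (h : ∀ x ∈ S, ∀ y ∈ S, x ≤ y + 1) (hS : S ≠ 0) :
    S.sum / S.card ∈ S ∧ ∀ x ∈ S, S.sum / S.card ≤ x ∧ x ≤ S.sum / S.card + 1 := by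
  obtain ⟨μ, hμ, hmin⟩ : ∃ μ ∈ S, ∀ x ∈ S, μ ≤ x := by
    obtain ⟨y, hy⟩ := Multiset.exists_mem_of_ne_zero hS
    have hne : ({x | x ∈ S} : Set ℕ).Nonempty := ⟨y, hy⟩
    exact ⟨sInf {x | x ∈ S}, Nat.sInf_mem hne, fun x hx => Nat.sInf_le hx⟩
  have hdiv : S.sum / S.card = μ := by
    obtain ⟨R, rfl⟩ := Multiset.exists_cons_of_mem hμ
    have h1 : R.card • μ ≤ R.sum := Multiset.card_nsmul_le_sum fun x hx => hmin x (by simp [hx])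
    have h2 : R.sum ≤ R.card • (μ + 1) :=
      Multiset.sum_le_card_nsmul _ _ fun x hx => h x (by simp [hx]) μ hμ
    simp only [smul_eq_mul] at h1 h2
    rw [Multiset.sum_cons, Multiset.card_cons]
    apply Nat.div_eq_of_lt_le <;> nlinarith
  rw [hdiv]
  exact ⟨hμ, fun x hx => ⟨hmin x hx, h x hx μ hμ⟩⟩

lemma sum_map_eq_sum_count {α : Type*} [DecidableEq α] {T : Multiset α} {S : Finset α}
    (h : ∀ x ∈ T, x ∈ S) (f : α → ℕ) : (T.map f).sum = ∑ x ∈ S, T.count x * f x := by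
  rw [Finset.sum_multiset_map_count]
  refine Finset.sum_subset (fun x hx => h x (Multiset.mem_toFinset.mp hx)) fun x _ hx => ?_
  rw [Multiset.mem_toFinset] at hx
  simp [Multiset.count_eq_zero_of_notMem hx]

lemma eq_of_count_eq {α : Type*} [DecidableEq α] {T T' : Multiset α} {S : Finset α}
    (h : ∀ x ∈ T, x ∈ S) (h' : ∀ x ∈ T', x ∈ S) (hc : ∀ x ∈ S, T.count x = T'.count x) :
    T = T' := by
  ext x
  by_cases hx : x ∈ S
  · exact hc x hx
  · rw [Multiset.count_eq_zero_of_notMem fun hT => hx (h x hT),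
      Multiset.count_eq_zero_of_notMem fun hT => hx (h' x hT)]

lemma sum_map_sub {α : Type*} {T : Multiset α} {f : α → ℕ} {q : ℕ} (h : ∀ x ∈ T, q ≤ f x) :
    (T.map f).sum = (T.map fun x => f x - q).sum + T.card * q := by
  have : T.map f = T.map fun x => (f x - q) + q :=
    Multiset.map_congr rfl fun x hx => (Nat.sub_add_cancel (h x hx)).symm
  rw [this, Multiset.sum_map_add]
  simp

/-- The conditions satisfied by the nodes at a given place of a family of weightings of degree one to
which no exchange and no Segre move can be applied profitably. -/
structure IsReduced (T : Multiset (ℕ × ℕ × ℕ)) : Prop where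
  s_le : ∀ x ∈ T, x.2.1 ≤ 1
  s_le_add : ∀ x ∈ T, x.2.1 ≤ x.1 + x.2.2
  left_le : ∀ x ∈ T, x.1 ≤ x.2.2 + x.2.1
  right_le : ∀ x ∈ T, x.2.2 ≤ x.1 + x.2.1
  left_balanced : ∀ x ∈ T, ∀ y ∈ T, x.1 ≤ y.1 + 1
  right_balanced : ∀ x ∈ T, ∀ y ∈ T, x.2.2 ≤ y.2.2 + 1
  not_up_down : ∀ q, 0 < q → (q, 1, q + 1) ∈ T → (q + 1, 1, q) ∉ T
  not_segre : (0, 1, 1) ∈ T → (1, 1, 0) ∈ T → (1, 0, 1) ∉ T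
  not_swap : ∀ q, 0 < q → (q, 0, q) ∈ T → (q + 1, 1, q + 1) ∉ T

/-- Balance confines the nodes to a short list that depends only on the sums. The multiplicities
satisfy four linear equations, given by the cardinality and the three sums. Every ambiguity left by
these equations is a move excluded by reducedness, so nonnegativity leaves one solution. -/
lemma IsReduced.eq {T T' : Multiset (ℕ × ℕ × ℕ)} (hT : IsReduced T) (hT' : IsReduced T')
    (hc : T.card = T'.card) (h1 : (T.map fun x => x.1).sum = (T'.map fun x => x.1).sum)
    (h2 : (T.map fun x => x.2.1).sum = (T'.map fun x => x.2.1).sum)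
    (h3 : (T.map fun x => x.2.2).sum = (T'.map fun x => x.2.2).sum) : T = T' := by
  by_cases h0 : T = 0
  · subst h0
    exact (Multiset.card_eq_zero.mp hc.symm).symm
  have h0' : T' ≠ 0 := by
    rintro rfl
    exact h0 (Multiset.card_eq_zero.mp hc)
  obtain ⟨q, p, hqT, hpT, hq, hq', hp, hp'⟩ : ∃ q p, (∃ x ∈ T, x.1 = q) ∧ (∃ x ∈ T, x.2.2 = p) ∧
      (∀ x ∈ T, q ≤ x.1 ∧ x.1 ≤ q + 1) ∧ (∀ x ∈ T', q ≤ x.1 ∧ x.1 ≤ q + 1) ∧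
      (∀ x ∈ T, p ≤ x.2.2 ∧ x.2.2 ≤ p + 1) ∧ (∀ x ∈ T', p ≤ x.2.2 ∧ x.2.2 ≤ p + 1) := by
    have key : ∀ (f : ℕ × ℕ × ℕ → ℕ) (U : Multiset (ℕ × ℕ × ℕ)), U ≠ 0 →
        (∀ x ∈ U, ∀ y ∈ U, f x ≤ f y + 1) → (∃ x ∈ U, f x = (U.map f).sum / U.card) ∧
        ∀ x ∈ U, (U.map f).sum / U.card ≤ f x ∧ f x ≤ (U.map f).sum / U.card + 1 := by
      intro f U hU hb
      obtain ⟨h1, h2⟩ := sum_div_card_of_balanced (S := U.map f)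
        (by simpa only [Multiset.forall_mem_map_iff] using hb) (by simpa using hU)
      rw [Multiset.card_map] at h1 h2
      exact ⟨Multiset.mem_map.mp h1, Multiset.forall_mem_map_iff.mp h2⟩
    obtain ⟨a1, a2⟩ := key (fun x => x.1) T h0 hT.left_balanced
    obtain ⟨b1, b2⟩ := key (fun x => x.2.2) T h0 hT.right_balanced
    obtain ⟨-, a3⟩ := key (fun x => x.1) T' h0' hT'.left_balanced
    obtain ⟨-, b3⟩ := key (fun x => x.2.2) T' h0' hT'.right_balanced
    rw [← h1, ← hc] at a3
    rw [← h3, ← hc] at b3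
    exact ⟨_, _, a1, b1, a2, a3, b2, b3⟩
  rw [sum_map_sub fun x hx => (hq x hx).1, sum_map_sub fun x hx => (hq' x hx).1, hc,
    Nat.add_right_cancel_iff] at h1
  rw [sum_map_sub fun x hx => (hp x hx).1, sum_map_sub fun x hx => (hp' x hx).1, hc,
    Nat.add_right_cancel_iff] at h3
  -- At a node where one of the two minima is attained, the leg weight is at most one, so the other
  -- minimum exceeds it by at most one.
  have hpq : p = q + 1 ∨ q = p + 1 ∨ (p = q ∧ q = 0) ∨ (p = q ∧ 0 < q) := by
    obtain ⟨x, hx, rfl⟩ := hqT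
    obtain ⟨y, hy, rfl⟩ := hpT
    have := hq y hy
    have := hp x hx
    have := hT.s_le x hx
    have := hT.s_le y hy
    have := hT.left_le x hx
    have := hT.left_le y hy
    have := hT.right_le x hx
    have := hT.right_le y hy
    omega
  have hcard : ∀ U : Multiset (ℕ × ℕ × ℕ), U.card = (U.map fun _ => 1).sum := by simp
  rw [hcard, hcard] at hc
  have mem_of : ∀ S : Finset (ℕ × ℕ × ℕ), (∀ a b c, (q ≤ a ∧ a ≤ q + 1) → b ≤ 1 →
      (p ≤ c ∧ c ≤ p + 1) → b ≤ a + c → a ≤ c + b → c ≤ a + b → (a, b, c) ∈ S) →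
      (∀ x ∈ T, x ∈ S) ∧ ∀ x ∈ T', x ∈ S := by
    intro S hS
    exact ⟨fun x hx => hS _ _ _ (hq x hx) (hT.s_le x hx) (hp x hx) (hT.s_le_add x hx)
      (hT.left_le x hx) (hT.right_le x hx), fun x hx => hS _ _ _ (hq' x hx) (hT'.s_le x hx)
      (hp' x hx) (hT'.s_le_add x hx) (hT'.left_le x hx) (hT'.right_le x hx)⟩
  have hor : ∀ (U : Multiset (ℕ × ℕ × ℕ)) x, U.count x = 0 ∨ x ∈ U := fun U x =>
    (em (x ∈ U)).symm.imp_left Multiset.count_eq_zero_of_notMem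
  -- If `p ≠ q`, four nodes are possible and the four equations determine their multiplicities. If
  -- `p = q = 0` there are five nodes, with the Segre move as the only ambiguity. If `p = q > 0`
  -- there are six nodes and two independent ambiguities, excluded by `not_up_down` and `not_swap`.
  rcases hpq with rfl | rfl | ⟨rfl, rfl⟩ | ⟨rfl, hpos⟩
  · obtain ⟨m1, m2⟩ := mem_of {(q, 1, q + 1), (q + 1, 0, q + 1), (q + 1, 1, q + 1),
      (q + 1, 1, q + 2)} (by
        intro a b c h1 h2 h3 h4 h5 h6
        simp only [Finset.mem_insert, Finset.mem_singleton, Prod.mk.injEq]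
        omega)
    rw [sum_map_eq_sum_count m1, sum_map_eq_sum_count m2] at hc h1 h2 h3
    simp at hc h1 h2 h3
    refine eq_of_count_eq m1 m2 ?_
    simp only [Finset.forall_mem_insert, Finset.mem_singleton, forall_eq]
    omega
  · obtain ⟨m1, m2⟩ := mem_of {(p + 1, 1, p), (p + 1, 0, p + 1), (p + 1, 1, p + 1),
      (p + 2, 1, p + 1)} (by
        intro a b c h1 h2 h3 h4 h5 h6
        simp only [Finset.mem_insert, Finset.mem_singleton, Prod.mk.injEq]
        omega)
    rw [sum_map_eq_sum_count m1, sum_map_eq_sum_count m2] at hc h1 h2 h3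
    simp at hc h1 h2 h3
    refine eq_of_count_eq m1 m2 ?_
    simp only [Finset.forall_mem_insert, Finset.mem_singleton, forall_eq]
    omega
  · obtain ⟨m1, m2⟩ := mem_of {(0, 0, 0), (0, 1, 1), (1, 1, 0), (1, 0, 1), (1, 1, 1)} (by
        intro a b c h1 h2 h3 h4 h5 h6
        simp only [Finset.mem_insert, Finset.mem_singleton, Prod.mk.injEq]
        omega)
    rw [sum_map_eq_sum_count m1, sum_map_eq_sum_count m2] at hc h1 h2 h3
    simp at hc h1 h2 h3
    refine eq_of_count_eq m1 m2 ?_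
    simp only [Finset.forall_mem_insert, Finset.mem_singleton, forall_eq]
    have z : ∀ {U : Multiset (ℕ × ℕ × ℕ)}, IsReduced U → U.count (0, 1, 1) = 0 ∨
        U.count (1, 1, 0) = 0 ∨ U.count (1, 0, 1) = 0 := by
      intro U hU
      rcases hor U (0, 1, 1) with h | h
      · exact Or.inl h
      rcases hor U (1, 1, 0) with h' | h'
      · exact Or.inr (Or.inl h')
      · exact Or.inr (Or.inr (Multiset.count_eq_zero_of_notMem (hU.not_segre h h')))
    have z1 := z hT
    have z2 := z hT'
    omega
  · obtain ⟨m1, m2⟩ := mem_of {(p, 0, p), (p, 1, p), (p, 1, p + 1), (p + 1, 1, p),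
      (p + 1, 0, p + 1), (p + 1, 1, p + 1)} (by
        intro a b c h1 h2 h3 h4 h5 h6
        simp only [Finset.mem_insert, Finset.mem_singleton, Prod.mk.injEq]
        omega)
    rw [sum_map_eq_sum_count m1, sum_map_eq_sum_count m2] at hc h1 h2 h3
    simp at hc h1 h2 h3
    refine eq_of_count_eq m1 m2 ?_
    simp only [Finset.forall_mem_insert, Finset.mem_singleton, forall_eq]
    have z : ∀ {U : Multiset (ℕ × ℕ × ℕ)}, IsReduced U → (U.count (p, 1, p + 1) = 0 ∨
        U.count (p + 1, 1, p) = 0) ∧ (U.count (p, 0, p) = 0 ∨ U.count (p + 1, 1, p + 1) = 0) := by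
      intro U hU
      constructor
      · rcases hor U (p, 1, p + 1) with h | h
        · exact Or.inl h
        · exact Or.inr (Multiset.count_eq_zero_of_notMem (hU.not_up_down p hpos h))
      · rcases hor U (p, 0, p) with h | h
        · exact Or.inl h
        · exact Or.inr (Multiset.count_eq_zero_of_notMem (hU.not_swap p hpos h))
    have z1 := z hT
    have z2 := z hT'
    omega

/-! ### Reduction -/

/-- The quantities to be minimized, in order of importance, within a class of related families. -/
def energy (F : Multiset (Weighting m 1)) : ℕ ×ₗ ℕ ×ₗ ℕ :=
  toLex ((F.map fun P => ∑ i ∈ Finset.range m, P.t i ^ 2).sum,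
    toLex ((F.map fun P => ∑ i ∈ Finset.range m, if P.t i = P.t (i + 1) then 0 else 1).sum,
      (F.map fun P => ∑ i ∈ Finset.range m, P.s i * P.t i).sum))

lemma energy_lt_iff {F G : Multiset (Weighting m 1)} : energy F < energy G ↔
    (F.map fun P => ∑ i ∈ Finset.range m, P.t i ^ 2).sum <
      (G.map fun P => ∑ i ∈ Finset.range m, P.t i ^ 2).sum ∨
    (F.map fun P => ∑ i ∈ Finset.range m, P.t i ^ 2).sum =
      (G.map fun P => ∑ i ∈ Finset.range m, P.t i ^ 2).sum ∧
    ((F.map fun P => ∑ i ∈ Finset.range m, if P.t i = P.t (i + 1) then 0 else 1).sum <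
      (G.map fun P => ∑ i ∈ Finset.range m, if P.t i = P.t (i + 1) then 0 else 1).sum ∨
    (F.map fun P => ∑ i ∈ Finset.range m, if P.t i = P.t (i + 1) then 0 else 1).sum =
      (G.map fun P => ∑ i ∈ Finset.range m, if P.t i = P.t (i + 1) then 0 else 1).sum ∧
    (F.map fun P => ∑ i ∈ Finset.range m, P.s i * P.t i).sum <
      (G.map fun P => ∑ i ∈ Finset.range m, P.s i * P.t i).sum) := by
  simp only [energy, Prod.Lex.toLex_lt_toLex]

lemma lt_of_t_pos (P : Weighting m d) {i : ℕ} (h : 0 < P.t i) : i < m := by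
  by_contra hi
  have := P.t_end i (by omega)
  omega

lemma lt_of_s_pos (P : Weighting m d) {i : ℕ} (h : 0 < P.s i) : i < m := by
  by_contra hi
  have := P.s_end (i := i) (by omega)
  omega

lemma exists_cons_cons {F : Multiset (Weighting m d)} {P Q : Weighting m d} (hP : P ∈ F)
    (hQ : Q ∈ F) (h : P ≠ Q) : ∃ R, F = P ::ₘ Q ::ₘ R := by
  obtain ⟨R, rfl⟩ := Multiset.exists_cons_of_mem hP
  rw [Multiset.mem_cons, or_iff_right h.symm] at hQ
  obtain ⟨R, rfl⟩ := Multiset.exists_cons_of_mem hQ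
  exact ⟨R, rfl⟩

variable {r : Multiset (Weighting m 1) → Multiset (Weighting m 1) → Prop}
  {F : Multiset (Weighting m 1)}

lemma sq_add_sq_le {a b c e : ℕ} (h : a + b = c + e) (h1 : a ≤ b + 1) (h2 : b ≤ a + 1) :
    a ^ 2 + b ^ 2 ≤ c ^ 2 + e ^ 2 := by
  zify at *
  obtain h3 | h3 | h3 : (a : ℤ) = b ∨ (a : ℤ) = b + 1 ∨ (b : ℤ) = a + 1 := by omega
  · nlinarith [sq_nonneg ((c : ℤ) - e)]
  all_goals
    have h4 : (c : ℤ) - e ≤ -1 ∨ 1 ≤ (c : ℤ) - e := by omega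
    have h5 : 1 ≤ ((c : ℤ) - e) ^ 2 := by rcases h4 with h4 | h4 <;> nlinarith
    have h6 : (a - b : ℤ) ^ 2 = 1 := by rw [h3]; ring
    have h7 : (a + b : ℤ) ^ 2 = (c + e) ^ 2 := by rw [h]
    linarith

lemma sq_add_sq_lt {a b c e : ℕ} (h : a + b = c + e) (h1 : a ≤ b + 1) (h2 : b ≤ a + 1)
    (h3 : e + 2 ≤ c) : a ^ 2 + b ^ 2 < c ^ 2 + e ^ 2 := by
  zify at *
  have h4 : (a - b : ℤ) ^ 2 ≤ 1 := by
    rw [sq_le_one_iff_abs_le_one, abs_le]; constructor <;> linarith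
  have h5 : 4 ≤ ((c : ℤ) - e) ^ 2 := by nlinarith
  have h7 : (a + b : ℤ) ^ 2 = (c + e) ^ 2 := by rw [h]
  linarith

/-- An unbalanced pair can be exchanged for the balanced decomposition of its sum. For a fixed sum
of two integers, balancing them minimizes the sum of their squares, so the first component of the
energy drops. -/
lemma IsMoveRelation.balanced (hr : IsMoveRelation r) (hF : ∀ G, r F G → ¬ energy G < energy F)
    {P Q : Weighting m 1} (hP : P ∈ F) (hQ : Q ∈ F) (i : ℕ) : P.t i ≤ Q.t i + 1 := by
  by_contra hi
  have hPQ : P ≠ Q := by rintro rfl; omega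
  obtain ⟨R, rfl⟩ := exists_cons_cons hP hQ hPQ
  obtain ⟨P', Q', ht, hs, hb⟩ := exists_balanced_add (P.add Q)
  dsimp only [add] at ht hs
  refine hF (P' ::ₘ Q' ::ₘ R) (hr.exchange _ _ _ _ _ (fun k => (ht k).symm)
    fun k => (hs k).symm) (energy_lt_iff.mpr (Or.inl ?_))
  simp only [Multiset.map_cons, Multiset.sum_cons, ← add_assoc, ← Finset.sum_add_distrib]
  refine Nat.add_lt_add_right (Finset.sum_lt_sum (fun k _ => ?_)
    ⟨i, Finset.mem_range.mpr (P.lt_of_t_pos (by omega)), ?_⟩) _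
  · exact sq_add_sq_le (ht k) (hb k).1 (hb k).2
  · exact sq_add_sq_lt (ht i) (hb i).1 (hb i).2 (by omega)

end Weighting

end PointsOnLine

end

/-! ### Descent by energy, connectedness of families with the same sum, and exponents of weightings.
-/

noncomputable section

namespace PointsOnLine

/-- The variable leading the edge inside the `i`-th pair of vertices. -/
def loopVar (i : ℕ) : ℕᵒᵈ := OrderDual.toDual (2 * i)

/-- The variable leading the edges from the `i`-th pair of vertices to the left. -/
def rightVar (i : ℕ) : ℕᵒᵈ := OrderDual.toDual (2 * i + 1)

lemma loopVar_inj {i j : ℕ} : loopVar i = loopVar j ↔ i = j := by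
  rw [loopVar, loopVar, OrderDual.toDual_inj]; omega

lemma rightVar_inj {i j : ℕ} : rightVar i = rightVar j ↔ i = j := by
  rw [rightVar, rightVar, OrderDual.toDual_inj]; omega

lemma loopVar_ne_rightVar (i j : ℕ) : loopVar i ≠ rightVar j := by
  rw [loopVar, rightVar, ne_eq, OrderDual.toDual_inj]; omega

namespace Weighting

variable {m d : ℕ}

lemma IsSplice.map_t_add {i σ τ : ℕ} {P Q A B : Weighting m d} (hA : IsSplice i σ P Q A)
    (hB : IsSplice i τ Q P B) (g : ℕ → ℕ) (k : ℕ) :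
    g (A.t k) + g (B.t k) = g (P.t k) + g (Q.t k) := by
  rcases le_or_gt k i with h | h
  · rw [hA.t_le k h, hB.t_le k h]
  · rw [hA.t_gt k h, hB.t_gt k h, add_comm]

lemma IsSplice.map_node_add {i σ τ : ℕ} {P Q A B : Weighting m d} (hA : IsSplice i σ P Q A)
    (hB : IsSplice i τ Q P B) (g : ℕ × ℕ × ℕ → ℕ) {k : ℕ} (hk : k ≠ i) :
    g (node k A) + g (node k B) = g (node k P) + g (node k Q) := by
  rcases lt_or_gt_of_ne hk with h | h
  · rw [hA.node_lt h, hB.node_lt h]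
  · rw [hA.node_gt h, hB.node_gt h, add_comm]

lemma IsSplice.t_self {i σ : ℕ} {P A : Weighting m d} (hA : IsSplice i σ P P A) (k : ℕ) :
    A.t k = P.t k := by
  rcases le_or_gt k i with h | h
  · rw [hA.t_le k h]
  · rw [hA.t_gt k h]

lemma IsSplice.s_self {i σ : ℕ} {P A : Weighting m d} (hA : IsSplice i σ P P A) {k : ℕ}
    (hk : k ≠ i) : A.s k = P.s k := by
  rcases lt_or_gt_of_ne hk with h | h
  · rw [hA.s_lt k h]
  · rw [hA.s_gt k h]

/-- Two families of the same energy in the first place and smaller energy at a single node. -/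
lemma energy_lt_of_splice {i σ τ : ℕ} {P Q A B : Weighting m 1} {G H : Multiset (Weighting m 1)}
    (hA : IsSplice i σ P Q A) (hB : IsSplice i τ Q P B) (hi : i < m)
    (h : (if P.t i = Q.t (i + 1) then 0 else 1) + (if Q.t i = P.t (i + 1) then 0 else 1) <
      (if P.t i = P.t (i + 1) then 0 else 1) + (if Q.t i = Q.t (i + 1) then 0 else 1))
    (hG : G.map t = H.map t) : energy (A ::ₘ B ::ₘ G) < energy (P ::ₘ Q ::ₘ H) := by
  have hGH : ∀ g : (ℕ → ℕ) → ℕ, (G.map fun P => g P.t).sum = (H.map fun P => g P.t).sum := by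
    intro g
    have := congrArg (fun M => (M.map g).sum) hG
    simpa only [Multiset.map_map, Function.comp_def] using this
  refine energy_lt_iff.mpr (Or.inr ⟨?_, Or.inl ?_⟩)
  · simp only [Multiset.map_cons, Multiset.sum_cons, ← add_assoc, ← Finset.sum_add_distrib]
    rw [hGH fun t => ∑ i ∈ Finset.range m, t i ^ 2]
    congr 1
    exact Finset.sum_congr rfl fun k _ => hA.map_t_add hB (fun x => x ^ 2) k
  · simp only [Multiset.map_cons, Multiset.sum_cons, ← add_assoc, ← Finset.sum_add_distrib]
    rw [hGH fun t => ∑ i ∈ Finset.range m, if t i = t (i + 1) then 0 else 1]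
    refine Nat.add_lt_add_right (Finset.sum_lt_sum (fun k _ => ?_)
      ⟨i, Finset.mem_range.mpr hi, ?_⟩) _
    · by_cases hk : k = i
      · subst hk
        rw [hA.t_le k le_rfl, hA.t_gt (k + 1) (by omega), hB.t_le k le_rfl,
          hB.t_gt (k + 1) (by omega)]
        exact h.le
      · exact (hA.map_node_add hB (fun x => if x.1 = x.2.2 then 0 else 1) hk).le
    · rw [hA.t_le i le_rfl, hA.t_gt (i + 1) (by omega), hB.t_le i le_rfl,
        hB.t_gt (i + 1) (by omega)]
      exact h

variable {r : Multiset (Weighting m 1) → Multiset (Weighting m 1) → Prop}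
  {F : Multiset (Weighting m 1)}

/-- A family of least energy in its class is reduced. -/
lemma IsMoveRelation.isReduced (hr : IsMoveRelation r)
    (hF : ∀ G, r F G → ¬ energy G < energy F) (i : ℕ) : IsReduced (F.map (node i)) where
  s_le := Multiset.forall_mem_map_iff.mpr fun P _ => P.s_le i
  s_le_add := Multiset.forall_mem_map_iff.mpr fun P _ => P.s_le_add i
  left_le := Multiset.forall_mem_map_iff.mpr fun P _ => P.left_le i
  right_le := Multiset.forall_mem_map_iff.mpr fun P _ => P.right_le i
  left_balanced := Multiset.forall_mem_map_iff.mpr fun _ hP =>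
    Multiset.forall_mem_map_iff.mpr fun _ hQ => hr.balanced hF hP hQ i
  right_balanced := Multiset.forall_mem_map_iff.mpr fun _ hP =>
    Multiset.forall_mem_map_iff.mpr fun _ hQ => hr.balanced hF hP hQ (i + 1)
  not_up_down := by
    rintro q hq h1 h2
    obtain ⟨P, hP, hPn⟩ := Multiset.mem_map.mp h1
    obtain ⟨Q, hQ, hQn⟩ := Multiset.mem_map.mp h2
    simp only [node, Prod.mk.injEq] at hPn hQn
    obtain ⟨R, rfl⟩ := exists_cons_cons hP hQ (by rintro rfl; omega)
    -- The tails are swapped to give nodes (q,1,q) and (q+1,1,q+1), which removes two changes along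
    -- the spine. For `q = 0` the first of them would not be allowed; this is why the Segre move is
    -- needed.
    obtain ⟨A, hA⟩ := exists_isSplice i 1 P Q le_rfl (by omega) (by omega) (by omega)
    obtain ⟨B, hB⟩ := exists_isSplice i 1 Q P le_rfl (by omega) (by omega) (by omega)
    refine hF (A ::ₘ B ::ₘ R) (hr.exchange _ _ _ _ _ (fun k => (hA.t_add hB k).symm)
      fun k => (hA.s_add hB (by omega) k).symm)
      (energy_lt_of_splice hA hB (P.lt_of_s_pos (by omega)) ?_ rfl)
    simp [hPn, hQn]
  not_segre := by
    intro h1 h2 h3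
    obtain ⟨P, hP, hPn⟩ := Multiset.mem_map.mp h1
    obtain ⟨Q, hQ, hQn⟩ := Multiset.mem_map.mp h2
    obtain ⟨W, hW, hWn⟩ := Multiset.mem_map.mp h3
    obtain ⟨R, rfl⟩ := exists_cons_cons hP hQ (by rintro rfl; rw [hPn] at hQn; simp at hQn)
    rw [Multiset.mem_cons, or_iff_right (by rintro rfl; rw [hPn] at hWn; simp at hWn),
      Multiset.mem_cons, or_iff_right (by rintro rfl; rw [hQn] at hWn; simp at hWn)] at hW
    obtain ⟨R, rfl⟩ := Multiset.exists_cons_of_mem hW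
    have hPn' := hPn
    have hQn' := hQn
    have hWn' := hWn
    simp only [node, Prod.mk.injEq] at hPn' hQn' hWn'
    -- The Segre move makes the spine constant at this node in `A` and `B`, and does not touch the
    -- spine of `W`. Again the second component of the energy drops.
    obtain ⟨A, hA⟩ := exists_isSplice i 0 P Q (by omega) (by omega) (by omega) (by omega)
    obtain ⟨B, hB⟩ := exists_isSplice i 1 Q P le_rfl (by omega) (by omega) (by omega)
    obtain ⟨C, hC⟩ := exists_isSplice i 1 W W le_rfl (by omega) (by omega) (by omega)
    refine hF (A ::ₘ B ::ₘ C ::ₘ R) (hr.segre i _ _ _ _ _ _ _ hPn hQn hWn hA hB hC)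
      (energy_lt_of_splice hA hB (P.lt_of_s_pos (by omega)) ?_ ?_)
    · simp [hPn', hQn']
    · rw [Multiset.map_cons, Multiset.map_cons, funext hC.t_self]
  not_swap := by
    rintro q hq h1 h2
    obtain ⟨P, hP, hPn⟩ := Multiset.mem_map.mp h1
    obtain ⟨Q, hQ, hQn⟩ := Multiset.mem_map.mp h2
    simp only [node, Prod.mk.injEq] at hPn hQn
    obtain ⟨R, rfl⟩ := exists_cons_cons hP hQ (by rintro rfl; omega)
    -- The spines stay as they are and only the leg moves, from the larger spine weight to the
    -- smaller; this lowers the third component of the energy.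
    obtain ⟨A, hA⟩ := exists_isSplice i 1 P P le_rfl (by omega) (by omega) (by omega)
    obtain ⟨B, hB⟩ := exists_isSplice i 0 Q Q (by omega) (by omega) (by omega) (by omega)
    refine hF (A ::ₘ B ::ₘ R) (hr.exchange _ _ _ _ _
      (fun k => by rw [hA.t_self, hB.t_self]) fun k => ?_) (energy_lt_iff.mpr (Or.inr ⟨?_, Or.inr ⟨?_, ?_⟩⟩))
    · by_cases hk : k = i
      · subst hk; rw [hA.s_eq, hB.s_eq]; omega
      · rw [hA.s_self hk, hB.s_self hk]
    · simp only [Multiset.map_cons, hA.t_self, hB.t_self]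
    · simp only [Multiset.map_cons, hA.t_self, hB.t_self]
    · simp only [Multiset.map_cons, Multiset.sum_cons, ← add_assoc, ← Finset.sum_add_distrib,
        hA.t_self, hB.t_self]
      refine Nat.add_lt_add_right (Finset.sum_lt_sum (fun k _ => ?_)
        ⟨i, Finset.mem_range.mpr (Q.lt_of_s_pos (by omega)), ?_⟩) _
      · by_cases hk : k = i
        · subst hk; rw [hA.s_eq, hB.s_eq, hPn.1, hPn.2.1, hQn.1, hQn.2.1]; omega
        · rw [hA.s_self hk, hB.s_self hk]
      · rw [hA.s_eq, hB.s_eq, hPn.1, hPn.2.1, hQn.1, hQn.2.1]; omega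

/-- Families of weightings of degree one with the same sum are related by exchanges and Segre
moves. -/
theorem IsMoveRelation.of_sum_eq (hr : IsMoveRelation r)
    (hinv : ∀ F G, r F G → F.card = G.card ∧
      (∀ i, (F.map fun P => P.t i).sum = (G.map fun P => P.t i).sum) ∧
      ∀ i, (F.map fun P => P.s i).sum = (G.map fun P => P.s i).sum)
    {F G : Multiset (Weighting m 1)} (hc : F.card = G.card)
    (ht : ∀ i, (F.map fun P => P.t i).sum = (G.map fun P => P.t i).sum)
    (hs : ∀ i, (F.map fun P => P.s i).sum = (G.map fun P => P.s i).sum) : r F G := by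
  -- The energy takes values in a well-order, so every class has a member of least energy.
  have key : ∀ F, ∃ F', r F F' ∧ ∀ G, r F' G → ¬ energy G < energy F' := by
    intro F
    have hwf : WellFounded fun G H : Multiset (Weighting m 1) => energy G < energy H :=
      InvImage.wf energy wellFounded_lt
    obtain ⟨F', h1, h2⟩ := hwf.has_min {F' | r F F'} ⟨F, hr.refl F⟩
    exact ⟨F', h1, fun G hG => h2 G (hr.trans _ _ _ h1 hG)⟩
  obtain ⟨F', hF, hF'⟩ := key F
  obtain ⟨G', hG, hG'⟩ := key G
  obtain ⟨hFc, hFt, hFs⟩ := hinv _ _ hF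
  obtain ⟨hGc, hGt, hGs⟩ := hinv _ _ hG
  refine hr.trans _ _ _ hF (hr.trans _ _ _ (hr.of_node_eq G' F' fun i => ?_) (hr.symm _ _ hG))
  refine (hr.isReduced hF' i).eq (hr.isReduced hG' i) ?_ ?_ ?_ ?_
  · rw [Multiset.card_map, Multiset.card_map, ← hFc, ← hGc, hc]
  · simp only [Multiset.map_map, Function.comp_def, node]
    rw [← hFt, ← hGt, ht]
  · simp only [Multiset.map_map, Function.comp_def, node]
    rw [← hFs, ← hGs, hs]
  · simp only [Multiset.map_map, Function.comp_def, node]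
    rw [← hFt, ← hGt, ht]

/-! ### Exponents -/

/-- The exponent of the leading monomial of a graph with a given weighting. -/
def exponent (W : Weighting m d) : ℕᵒᵈ →₀ ℕ :=
  ∑ i ∈ Finset.range m, (Finsupp.single (loopVar i) (d - W.s i) +
    Finsupp.single (rightVar i) (W.s i + W.t i - W.t (i + 1)))

lemma exponent_even (W : Weighting m d) {i : ℕ} (hi : i < m) :
    W.exponent (loopVar i) = d - W.s i := by
  rw [exponent, Finsupp.finsetSum_apply, Finset.sum_eq_single i]
  · simp [(loopVar_ne_rightVar i i).symm]
  · intro k _ hk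
    simp [loopVar_inj, (loopVar_ne_rightVar _ _).symm, hk]
  · intro h; exact absurd (Finset.mem_range.mpr hi) h

lemma exponent_odd (W : Weighting m d) {i : ℕ} (hi : i < m) :
    W.exponent (rightVar i) = W.s i + W.t i - W.t (i + 1) := by
  rw [exponent, Finsupp.finsetSum_apply, Finset.sum_eq_single i]
  · simp [loopVar_ne_rightVar]
  · intro k _ hk
    simp [rightVar_inj, loopVar_ne_rightVar, hk]
  · intro h; exact absurd (Finset.mem_range.mpr hi) h

lemma exponent_apply_eq_zero (W : Weighting m d) {v : ℕᵒᵈ}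
    (hv : ∀ i < m, v ≠ loopVar i ∧ v ≠ rightVar i) : W.exponent v = 0 := by
  rw [exponent, Finsupp.finsetSum_apply]
  refine Finset.sum_eq_zero fun k hk => ?_
  have := hv k (Finset.mem_range.mp hk)
  simp [this.1.symm, this.2.symm]

lemma exponent_add {e : ℕ} (P : Weighting m d) (Q : Weighting m e) :
    (P.add Q).exponent = P.exponent + Q.exponent := by
  rw [exponent, exponent, exponent, ← Finset.sum_add_distrib]
  refine Finset.sum_congr rfl fun i _ => ?_
  dsimp only [add]
  have h1 : P.s i + Q.s i + (P.t i + Q.t i) - (P.t (i + 1) + Q.t (i + 1)) =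
      (P.s i + P.t i - P.t (i + 1)) + (Q.s i + Q.t i - Q.t (i + 1)) := by
    have := P.right_le i
    have := Q.right_le i
    omega
  have h2 : d + e - (P.s i + Q.s i) = (d - P.s i) + (e - Q.s i) := by
    have := P.s_le i
    have := Q.s_le i
    omega
  rw [h1, h2, Finsupp.single_add, Finsupp.single_add]
  abel

/-- The total exponent of a family. -/
def totalExponent (F : Multiset (Weighting m 1)) : ℕᵒᵈ →₀ ℕ := (F.map exponent).sum

lemma totalExponent_cons (P : Weighting m 1) (F : Multiset (Weighting m 1)) :
    totalExponent (P ::ₘ F) = P.exponent + totalExponent F := by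
  simp [totalExponent]

lemma totalExponent_even (F : Multiset (Weighting m 1)) {i : ℕ} (hi : i < m) :
    totalExponent F (loopVar i) + (F.map fun P => P.s i).sum = F.card := by
  induction F using Multiset.induction with
  | empty => simp [totalExponent]
  | cons P F ih =>
    have := P.s_le i
    rw [totalExponent_cons, Finsupp.add_apply, P.exponent_even hi, Multiset.map_cons,
      Multiset.sum_cons, Multiset.card_cons]
    omega

lemma totalExponent_odd (F : Multiset (Weighting m 1)) {i : ℕ} (hi : i < m) :
    totalExponent F (rightVar i) + (F.map fun P => P.t (i + 1)).sum =
      (F.map fun P => P.s i).sum + (F.map fun P => P.t i).sum := by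
  induction F using Multiset.induction with
  | empty => simp [totalExponent]
  | cons P F ih =>
    have := P.right_le i
    rw [totalExponent_cons, Finsupp.add_apply, P.exponent_odd hi]
    simp only [Multiset.map_cons, Multiset.sum_cons]
    omega

/-- The exponent of a family determines its sum. -/
lemma sum_eq_of_totalExponent_eq (hm : 0 < m) {F G : Multiset (Weighting m 1)}
    (h : totalExponent F = totalExponent G) : F.card = G.card ∧
      (∀ i, (F.map fun P => P.t i).sum = (G.map fun P => P.t i).sum) ∧
      ∀ i, (F.map fun P => P.s i).sum = (G.map fun P => P.s i).sum := by
  -- The two exponents of a pair add up to the cardinality plus the drop of the total spine weight,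
  -- so the sum telescopes. At `i = m` the spine weight is zero and the cardinality is recovered;
  -- the other `i` then give the spine weights.
  have hsum : ∀ F : Multiset (Weighting m 1), ∀ i, i ≤ m → (∑ k ∈ Finset.range i,
      (totalExponent F (loopVar k) +
        totalExponent F (rightVar k))) + (F.map fun P => P.t i).sum =
      i * F.card := by
    intro F i
    induction i with
    | zero => simp [t_zero]
    | succ i ih =>
      intro hi
      have h1 := ih (by omega)
      have h2 := totalExponent_even F (i := i) (by omega)
      have h3 := totalExponent_odd F (i := i) (by omega)
      rw [Finset.sum_range_succ, add_mul, one_mul]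
      omega
  have hend : ∀ F : Multiset (Weighting m 1), ∀ i, m ≤ i → (F.map fun P => P.t i).sum = 0 ∧
      (F.map fun P => P.s i).sum = 0 := by
    intro F i hi
    simp [t_end _ i hi, s_end _ hi]
  have hcard : F.card = G.card := by
    have h1 := hsum F m le_rfl
    have h2 := hsum G m le_rfl
    rw [(hend F m le_rfl).1] at h1
    rw [(hend G m le_rfl).1, ← h, h1] at h2
    exact Nat.eq_of_mul_eq_mul_left hm h2
  refine ⟨hcard, fun i => ?_, fun i => ?_⟩
  · rcases le_or_gt i m with hi | hi
    · have h1 := hsum F i hi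
      have h2 := hsum G i hi
      rw [← h, ← hcard] at h2
      omega
    · rw [(hend F i hi.le).1, (hend G i hi.le).1]
  · rcases lt_or_ge i m with hi | hi
    · have h1 := totalExponent_even F hi
      have h2 := totalExponent_even G hi
      rw [← h, ← hcard] at h2
      omega
    · rw [(hend F i hi).2, (hend G i hi).2]

end Weighting

end PointsOnLine

end

/-! ### Straightening of graphs by the Plücker relations. -/

noncomputable section

namespace PointsOnLine

variable {L : Type*}

/-- The element of `S_L` given by a directed edge. -/
def edgeElt (e : L × L) : GraphRing L :=
  Ideal.Quotient.mk (Ideal.span (graphRelations L)) (MvPolynomial.X e)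

lemma graphElt_cons (e : L × L) (Γ : DirGraph L) : graphElt (e ::ₘ Γ) = edgeElt e * graphElt Γ := by
  simp [graphElt, edgeElt]

lemma edgeElt_self (a : L) : edgeElt (a, a) = 0 :=
  Ideal.Quotient.eq_zero_iff_mem.mpr (Ideal.subset_span (Or.inl (Or.inl ⟨a, rfl⟩)))

lemma edgeElt_swap (a b : L) : edgeElt (a, b) = -edgeElt (b, a) := by
  rw [eq_neg_iff_add_eq_zero, edgeElt, edgeElt, ← map_add]
  exact Ideal.Quotient.eq_zero_iff_mem.mpr (Ideal.subset_span (Or.inl (Or.inr ⟨a, b, rfl⟩)))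

lemma edgeElt_mul (a b c d : L) : edgeElt (a, b) * edgeElt (c, d) =
    edgeElt (a, d) * edgeElt (c, b) + edgeElt (a, c) * edgeElt (b, d) := by
  rw [← sub_eq_zero]
  simp only [edgeElt, ← map_mul, ← map_add, ← map_sub]
  exact Ideal.Quotient.eq_zero_iff_mem.mpr (Ideal.subset_span (Or.inr ⟨a, b, c, d, rfl⟩))

section Valence

variable [DecidableEq L]

lemma valence_cons (e : L × L) (Γ : DirGraph L) (v : L) : valence (underlying (e ::ₘ Γ)) v =
    (if e.1 = v then 1 else 0) + (if e.2 = v then 1 else 0) + valence (underlying Γ) v := by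
  have h : Sym2.toMultiset s(e.1, e.2) = {e.1, e.2} := rfl
  simp only [valence, underlying, Multiset.map_cons, Multiset.cons_bind, Multiset.count_add, h,
    Multiset.insert_eq_cons, Multiset.count_cons, Multiset.count_singleton, eq_comm]
  omega

lemma valence_underlying_zero (v : L) : valence (underlying (0 : DirGraph L)) v = 0 := by
  simp [valence, underlying]

lemma exists_adj_of_valence_ne_zero {Γ : DirGraph L} {v : L} (h : valence (underlying Γ) v ≠ 0) :
    ∃ w, (v, w) ∈ Γ ∨ (w, v) ∈ Γ := by
  by_contra hn
  push Not at hn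
  refine h (valence_eq_zero fun e he => ⟨?_, ?_⟩)
  · rintro rfl; exact (hn e.2).1 he
  · rintro rfl; exact (hn e.1).2 he

lemma valence_ne_zero_of_mem {Γ : DirGraph L} {e : L × L} (h : e ∈ Γ) :
    valence (underlying Γ) e.1 ≠ 0 ∧ valence (underlying Γ) e.2 ≠ 0 := by
  obtain ⟨Γ, rfl⟩ := Multiset.exists_cons_of_mem h
  rw [valence_cons, valence_cons]
  simp

end Valence

section Lead

variable (ρ : L → ℕ)

/-- The leading variable of an edge, for the vertices grouped into pairs by a numbering. -/
def leadVar (e : L × L) : ℕᵒᵈ :=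
  if ρ e.1 / 2 = ρ e.2 / 2 then loopVar (ρ e.1 / 2) else rightVar (max (ρ e.1 / 2) (ρ e.2 / 2))

/-- The length of an edge. -/
def edgeLength (e : L × L) : ℕ :=
  if ρ e.1 / 2 = ρ e.2 / 2 then 0
  else 1 + ((ρ e.1 / 2 - ρ e.2 / 2) + (ρ e.2 / 2 - ρ e.1 / 2))

/-- The length of a graph. -/
def graphLength (Γ : DirGraph L) : ℕ := (Γ.map (edgeLength ρ)).sum

lemma graphLength_cons (e : L × L) (Γ : DirGraph L) :
    graphLength ρ (e ::ₘ Γ) = edgeLength ρ e + graphLength ρ Γ := by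
  simp [graphLength]

lemma leadVar_swap (a b : L) : leadVar ρ (a, b) = leadVar ρ (b, a) := by
  by_cases h : ρ a / 2 = ρ b / 2
  · simp [leadVar, h]
  · simp [leadVar, h, Ne.symm h, max_comm]

lemma edgeLength_swap (a b : L) : edgeLength ρ (a, b) = edgeLength ρ (b, a) := by
  simp only [edgeLength, eq_comm (a := ρ a / 2), add_comm (ρ a / 2 - ρ b / 2)]

variable [DecidableEq L]

/-- The span of the graphs with given valences of length less than `N`. -/
def shorterSpan (ν : L → ℕ) (N : ℕ) : Submodule ℤ (GraphRing L) :=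
  Submodule.span ℤ {x | ∃ Γ : DirGraph L, valence (underlying Γ) = ν ∧ graphLength ρ Γ < N ∧
    x = graphElt Γ}

/-- The graphs have the same valences, leading monomial and length, and agree up to sign modulo
shorter graphs. -/
structure LeadEquiv (Γ Δ : DirGraph L) : Prop where
  valence_eq : valence (underlying Γ) = valence (underlying Δ)
  lead_eq : Γ.map (leadVar ρ) = Δ.map (leadVar ρ)
  length_eq : graphLength ρ Γ = graphLength ρ Δ
  congr : ∃ ε : ℤˣ, graphElt Γ - (ε : ℤ) • graphElt Δ ∈
    shorterSpan ρ (valence (underlying Γ)) (graphLength ρ Γ)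

variable {ρ}

lemma LeadEquiv.refl (Γ : DirGraph L) : LeadEquiv ρ Γ Γ :=
  ⟨rfl, rfl, rfl, 1, by simp⟩

lemma LeadEquiv.trans {Γ Δ Θ : DirGraph L} (h : LeadEquiv ρ Γ Δ) (h' : LeadEquiv ρ Δ Θ) :
    LeadEquiv ρ Γ Θ := by
  refine ⟨h.valence_eq.trans h'.valence_eq, h.lead_eq.trans h'.lead_eq,
    h.length_eq.trans h'.length_eq, ?_⟩
  obtain ⟨ε, hε⟩ := h.congr
  obtain ⟨δ, hδ⟩ := h'.congr
  rw [← h.valence_eq, ← h.length_eq] at hδ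
  refine ⟨ε * δ, ?_⟩
  have := Submodule.add_mem _ hε (Submodule.smul_mem _ (ε : ℤ) hδ)
  rwa [smul_sub, sub_add_sub_cancel, smul_smul] at this

lemma edgeElt_mul_mem_shorterSpan {ν : L → ℕ} {N : ℕ} (e : L × L) {x : GraphRing L}
    (hx : x ∈ shorterSpan ρ ν N) : edgeElt e * x ∈ shorterSpan ρ
      (fun v => (if e.1 = v then 1 else 0) + (if e.2 = v then 1 else 0) + ν v)
      (edgeLength ρ e + N) := by
  induction hx using Submodule.span_induction with
  | mem x hx =>
    obtain ⟨Γ, rfl, hΓ, rfl⟩ := hx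
    refine Submodule.subset_span ⟨e ::ₘ Γ, funext fun v => valence_cons e Γ v, ?_,
      (graphElt_cons e Γ).symm⟩
    rw [graphLength_cons]
    omega
  | zero => simp
  | add x y _ _ hx hy => rw [mul_add]; exact Submodule.add_mem _ hx hy
  | smul a x _ hx => rw [mul_smul_comm]; exact Submodule.smul_mem _ _ hx

lemma LeadEquiv.cons {Γ Δ : DirGraph L} (h : LeadEquiv ρ Γ Δ) (e : L × L) :
    LeadEquiv ρ (e ::ₘ Γ) (e ::ₘ Δ) := by
  refine ⟨?_, ?_, ?_, ?_⟩
  · ext v; rw [valence_cons, valence_cons, h.valence_eq]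
  · rw [Multiset.map_cons, Multiset.map_cons, h.lead_eq]
  · rw [graphLength_cons, graphLength_cons, h.length_eq]
  · obtain ⟨ε, hε⟩ := h.congr
    refine ⟨ε, ?_⟩
    have := edgeElt_mul_mem_shorterSpan e hε
    rw [mul_sub, mul_smul_comm, ← graphElt_cons, ← graphElt_cons, ← graphLength_cons] at this
    convert this using 2
    ext v
    rw [valence_cons]

lemma LeadEquiv.swap (a b : L) (Γ : DirGraph L) :
    LeadEquiv ρ ((a, b) ::ₘ Γ) ((b, a) ::ₘ Γ) := by
  refine ⟨?_, ?_, ?_, -1, ?_⟩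
  · ext v
    simp only [valence_cons]
    omega
  · rw [Multiset.map_cons, Multiset.map_cons, leadVar_swap]
  · rw [graphLength_cons, graphLength_cons, edgeLength_swap]
  · rw [graphElt_cons, graphElt_cons, edgeElt_swap a b]
    have : -edgeElt (b, a) * graphElt Γ - ((-1 : ℤˣ) : ℤ) • (edgeElt (b, a) * graphElt Γ) = 0 := by
      rw [Units.val_neg, Units.val_one, neg_smul, one_smul]
      ring
    rw [this]
    exact Submodule.zero_mem _

/-- This is one Plücker relation: the two longer products share their leading monomial, and the
third product is an error term of smaller length. -/
lemma LeadEquiv.exchange {a b c d : L} (Γ : DirGraph L)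
    (h1 : leadVar ρ (a, b) ::ₘ {leadVar ρ (c, d)} = leadVar ρ (a, d) ::ₘ {leadVar ρ (c, b)})
    (h2 : edgeLength ρ (a, b) + edgeLength ρ (c, d) = edgeLength ρ (a, d) + edgeLength ρ (c, b))
    (h3 : edgeLength ρ (a, c) + edgeLength ρ (b, d) <
      edgeLength ρ (a, b) + edgeLength ρ (c, d)) :
    LeadEquiv ρ ((a, b) ::ₘ (c, d) ::ₘ Γ) ((a, d) ::ₘ (c, b) ::ₘ Γ) := by
  refine ⟨?_, ?_, ?_, 1, ?_⟩
  · ext v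
    simp only [valence_cons]
    omega
  · simp only [Multiset.map_cons]
    have := congrArg (· + Γ.map (leadVar ρ)) h1
    simpa only [Multiset.cons_add, Multiset.singleton_add] using this
  · simp only [graphLength_cons]
    omega
  · refine Submodule.subset_span ⟨(a, c) ::ₘ (b, d) ::ₘ Γ, ?_, ?_, ?_⟩
    · ext v
      simp only [valence_cons]
      omega
    · simp only [graphLength_cons]
      omega
    · simp only [graphElt_cons, ← mul_assoc, edgeElt_mul a b c d, Units.val_one, one_smul]
      ring

lemma LeadEquiv.exists_cons {Γ : DirGraph L} {a b : L} (h : (a, b) ∈ Γ ∨ (b, a) ∈ Γ) :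
    ∃ Δ : DirGraph L, LeadEquiv ρ Γ ((a, b) ::ₘ Δ) ∧ (Γ = (a, b) ::ₘ Δ ∨ Γ = (b, a) ::ₘ Δ) := by
  rcases h with h | h
  · obtain ⟨Δ, rfl⟩ := Multiset.exists_cons_of_mem h
    exact ⟨Δ, .refl _, Or.inl rfl⟩
  · obtain ⟨Δ, rfl⟩ := Multiset.exists_cons_of_mem h
    exact ⟨Δ, .swap _ _ _, Or.inr rfl⟩

/-- If every edge of `Γ` has its right end in the `j`-th pair or further to the right, and some edge
ends in the `j`-th pair, then an edge from any given vertex on the left of it to any given vertex of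
it can be split off from `Γ`. -/
lemma LeadEquiv.exists_cons_of_min {Γ : DirGraph L} {j : ℕ} {u v : L} (hu : ρ u / 2 < j)
    (hv : ρ v / 2 = j) (hΓ : ∀ e ∈ Γ, ρ e.1 / 2 ≠ ρ e.2 / 2 ∧ j ≤ max (ρ e.1 / 2) (ρ e.2 / 2))
    (hj : ∃ e ∈ Γ, max (ρ e.1 / 2) (ρ e.2 / 2) = j) (hu' : valence (underlying Γ) u ≠ 0)
    (hv' : valence (underlying Γ) v ≠ 0) : ∃ Δ : DirGraph L, LeadEquiv ρ Γ ((u, v) ::ₘ Δ) ∧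
      ∀ e ∈ Δ, e.1 ≠ e.2 := by
  -- The edge at `u` has its other end `w` in the `j`-th pair or beyond. If it is beyond, an
  -- exchange with an edge that ends in the `j`-th pair brings the end of the edge at `u` into that
  -- pair.
  obtain ⟨y, Γ₁, hy, h₁, hΓ₁⟩ : ∃ y, ∃ Γ₁ : DirGraph L, ρ y / 2 = j ∧
      LeadEquiv ρ Γ ((u, y) ::ₘ Γ₁) ∧ ∀ e ∈ Γ₁, ρ e.1 / 2 ≠ ρ e.2 / 2 := by
    obtain ⟨w, hw⟩ := exists_adj_of_valence_ne_zero hu'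
    obtain ⟨Γ₁, h₁, hΓ₁⟩ := LeadEquiv.exists_cons (ρ := ρ) hw
    have hsub : ∀ e ∈ Γ₁, e ∈ Γ := by
      rcases hΓ₁ with rfl | rfl <;> intro e he <;> exact Multiset.mem_cons_of_mem he
    have hwj : j ≤ ρ w / 2 := by
      rcases hw with hw | hw <;> have := (hΓ _ hw).2 <;> dsimp only at this <;> omega
    rcases hwj.eq_or_lt with hwj | hwj
    · exact ⟨w, Γ₁, hwj.symm, h₁, fun e he => (hΓ e (hsub e he)).1⟩
    obtain ⟨x, y, hx, hy, hxy⟩ : ∃ x y, ρ x / 2 < j ∧ ρ y / 2 = j ∧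
        ((x, y) ∈ Γ₁ ∨ (y, x) ∈ Γ₁) := by
      obtain ⟨⟨a, b⟩, he, hej⟩ := hj
      have hab := (hΓ _ he).1
      dsimp only at hej hab
      have he' : (a, b) ∈ Γ₁ := by
        rcases hΓ₁ with rfl | rfl
        · rcases Multiset.mem_cons.mp he with h | h
          · rw [Prod.mk.injEq] at h
            obtain ⟨rfl, rfl⟩ := h
            omega
          · exact h
        · rcases Multiset.mem_cons.mp he with h | h
          · rw [Prod.mk.injEq] at h
            obtain ⟨rfl, rfl⟩ := h
            omega
          · exact h
      rcases lt_or_gt_of_ne hab with h | h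
      · exact ⟨a, b, by omega, by omega, Or.inl he'⟩
      · exact ⟨b, a, by omega, by omega, Or.inr he'⟩
    obtain ⟨Γ₂, h₂, hΓ₂⟩ := LeadEquiv.exists_cons (ρ := ρ) hxy
    refine ⟨y, (x, w) ::ₘ Γ₂, hy, h₁.trans ((h₂.cons _).trans (.exchange _ ?_ ?_ ?_)), ?_⟩
    · rw [Multiset.cons_eq_cons]
      right
      refine ⟨?_, 0, ?_, ?_⟩
      all_goals simp only [leadVar]
      · rw [if_neg (by omega), if_neg (by omega), ne_eq, rightVar_inj]; omega
      · rw [if_neg (by omega), if_neg (by omega), max_eq_right (by omega),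
          max_eq_right (by omega)]; rfl
      · rw [if_neg (by omega), if_neg (by omega), max_eq_right (by omega),
          max_eq_right (by omega)]; rfl
    · simp only [edgeLength]
      rw [if_neg (by omega), if_neg (by omega), if_neg (by omega), if_neg (by omega)]
      omega
    · simp only [edgeLength]
      rw [if_neg (by omega : ¬ ρ w / 2 = ρ y / 2), if_neg (by omega : ¬ ρ u / 2 = ρ w / 2),
        if_neg (by omega : ¬ ρ x / 2 = ρ y / 2)]
      split_ifs <;> omega
    · intro e he
      rcases Multiset.mem_cons.mp he with rfl | he
      · dsimp only; omega
      · refine (hΓ e (hsub e ?_)).1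
        rcases hΓ₂ with rfl | rfl <;> exact Multiset.mem_cons_of_mem he
  -- If the edge at `u` ends at the wrong vertex of the `j`-th pair, an exchange with an edge at `v`
  -- interchanges the two vertices of the pair.
  by_cases hyv : y = v
  · subst hyv
    exact ⟨Γ₁, h₁, fun e he h => hΓ₁ e he (by rw [h])⟩
  have huv : u ≠ v := by rintro rfl; omega
  simp only [h₁.valence_eq, valence_cons, huv, hyv, if_false, zero_add] at hv'
  obtain ⟨x, hx⟩ := exists_adj_of_valence_ne_zero hv'
  obtain ⟨Γ₂, h₂, hΓ₂⟩ := LeadEquiv.exists_cons (ρ := ρ) hx.symm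
  have hxv : ρ x / 2 ≠ ρ v / 2 := by
    rcases hx with hx | hx
    · exact (hΓ₁ _ hx).symm
    · exact hΓ₁ _ hx
  refine ⟨(x, y) ::ₘ Γ₂, h₁.trans ((h₂.cons _).trans (.exchange _ ?_ ?_ ?_)), ?_⟩
  · simp only [leadVar, hy, hv]
  · simp only [edgeLength, hy, hv]
  · simp only [edgeLength]
    -- Here `x` may lie to the right of the `j`-th pair. The distances then add up exactly, and the
    -- extra 1 in `edgeLength` for edges between different pairs makes the inequality strict.
    rw [if_pos (by omega : ρ y / 2 = ρ v / 2), if_neg (by omega : ¬ ρ u / 2 = ρ y / 2),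
      if_neg (by omega : ¬ ρ x / 2 = ρ v / 2)]
    split_ifs <;> omega
  · intro e he
    rcases Multiset.mem_cons.mp he with rfl | he
    · rintro h
      dsimp only at h
      subst h
      omega
    · intro h
      refine hΓ₁ e ?_ (by rw [h])
      rcases hΓ₂ with rfl | rfl <;> exact Multiset.mem_cons_of_mem he

/-- Graphs without loops with the same valences and the same leading monomial agree up to sign modulo
shorter graphs. -/
theorem LeadEquiv.of_lead_eq (hρ : Function.Injective ρ) (n : ℕ) : ∀ Δ Γ : DirGraph L,
    Δ.card = n → (∀ e ∈ Γ, e.1 ≠ e.2) → (∀ e ∈ Δ, e.1 ≠ e.2) →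
    valence (underlying Γ) = valence (underlying Δ) →
    Γ.map (leadVar ρ) = Δ.map (leadVar ρ) → LeadEquiv ρ Γ Δ := by
  induction n with
  | zero =>
    intro Δ Γ hc _ _ _ hl
    obtain rfl := Multiset.card_eq_zero.mp hc
    obtain rfl : Γ = 0 := by simpa using hl
    exact .refl _
  | succ n ih =>
    intro Δ Γ hc hΓ hΔ hv hl
    -- It is enough to split off from `Γ` one edge of `Δ`, since the remainders inherit all the
    -- hypotheses.
    suffices h : ∃ e Δ' Γ', Δ = e ::ₘ Δ' ∧ LeadEquiv ρ Γ (e ::ₘ Γ') ∧ ∀ e ∈ Γ', e.1 ≠ e.2 by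
      obtain ⟨e, Δ', Γ', rfl, h, hΓ'⟩ := h
      refine h.trans (LeadEquiv.cons (ih Δ' Γ' (by simpa using hc) hΓ'
        (fun e he => hΔ e (Multiset.mem_cons_of_mem he)) ?_ ?_) e)
      · ext v
        have := congrFun (h.valence_eq.symm.trans hv) v
        rw [valence_cons, valence_cons] at this
        omega
      · have := h.lead_eq.symm.trans hl
        simpa using this
    by_cases hloop : ∃ e ∈ Δ, ρ e.1 / 2 = ρ e.2 / 2
    · obtain ⟨⟨a, b⟩, he, hab⟩ := hloop
      obtain ⟨Δ', rfl⟩ := Multiset.exists_cons_of_mem he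
      dsimp only at hab
      have hmem : loopVar (ρ a / 2) ∈ Γ.map (leadVar ρ) := by
        rw [hl]
        simp [leadVar, hab]
      obtain ⟨⟨c, d⟩, he', hcd⟩ := Multiset.mem_map.mp hmem
      simp only [leadVar] at hcd
      split_ifs at hcd with hcd'
      swap
      · exact absurd hcd.symm (loopVar_ne_rightVar _ _)
      rw [loopVar_inj] at hcd
      have h1 := hΔ _ he
      have h2 := hΓ _ he'
      dsimp only at h1 h2
      have h3 : ρ a ≠ ρ b := fun h => h1 (hρ h)
      have h4 : ρ c ≠ ρ d := fun h => h2 (hρ h)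
      -- A pair has only two vertices and loops are excluded, so two edges inside the same pair
      -- agree up to direction.
      have h5 : (a = c ∧ b = d) ∨ (a = d ∧ b = c) := by
        rw [← hρ.eq_iff, ← hρ.eq_iff, ← hρ.eq_iff (a := a) (b := d), ← hρ.eq_iff (a := b) (b := c)]
        omega
      have h6 : (a, b) ∈ Γ ∨ (b, a) ∈ Γ := by
        rcases h5 with ⟨rfl, rfl⟩ | ⟨rfl, rfl⟩
        · exact Or.inl he'
        · exact Or.inr he'
      obtain ⟨Γ', h7, h8⟩ := LeadEquiv.exists_cons (ρ := ρ) h6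
      refine ⟨(a, b), Δ', Γ', rfl, h7, fun e he => hΓ e ?_⟩
      rcases h8 with rfl | rfl <;> exact Multiset.mem_cons_of_mem he
    · push Not at hloop
      have hex : ∃ j, rightVar j ∈ Δ.map (leadVar ρ) := by
        obtain ⟨e, he⟩ := Multiset.card_pos_iff_exists_mem.mp (by omega : 0 < Δ.card)
        exact ⟨_, Multiset.mem_map.mpr ⟨e, he, by rw [leadVar, if_neg (hloop e he)]⟩⟩
      classical
      -- The leftmost pair that occurs as a right end: by minimality, all edges of `Γ` end in it or
      -- further to the right.
      obtain ⟨j, hj, hjmin⟩ : ∃ j, rightVar j ∈ Δ.map (leadVar ρ) ∧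
          ∀ k, rightVar k ∈ Δ.map (leadVar ρ) → j ≤ k :=
        ⟨Nat.find hex, Nat.find_spec hex, fun k hk => Nat.find_min' hex hk⟩
      have hΓ' : ∀ e ∈ Γ, ρ e.1 / 2 ≠ ρ e.2 / 2 ∧ j ≤ max (ρ e.1 / 2) (ρ e.2 / 2) := by
        intro e he
        have hmem : leadVar ρ e ∈ Δ.map (leadVar ρ) := by
          rw [← hl]; exact Multiset.mem_map_of_mem _ he
        by_cases h : ρ e.1 / 2 = ρ e.2 / 2
        · obtain ⟨f, hf, hfe⟩ := Multiset.mem_map.mp hmem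
          rw [leadVar, leadVar, if_pos h, if_neg (hloop f hf)] at hfe
          exact absurd hfe.symm (loopVar_ne_rightVar _ _)
        · rw [leadVar, if_neg h] at hmem
          exact ⟨h, hjmin _ hmem⟩
      have hj' : ∃ e ∈ Γ, max (ρ e.1 / 2) (ρ e.2 / 2) = j := by
        rw [← hl] at hj
        obtain ⟨e, he, hej⟩ := Multiset.mem_map.mp hj
        rw [leadVar, if_neg (hΓ' e he).1, rightVar_inj] at hej
        exact ⟨e, he, hej⟩
      obtain ⟨⟨a, b⟩, he, hej⟩ := Multiset.mem_map.mp hj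
      have hab := hloop _ he
      rw [leadVar, if_neg hab, rightVar_inj] at hej
      have hval := valence_ne_zero_of_mem he
      rw [← hv] at hval
      obtain ⟨Δ', rfl⟩ := Multiset.exists_cons_of_mem he
      dsimp only at hej hab hval
      rcases lt_or_gt_of_ne hab with h | h
      · obtain ⟨Γ₁, h1, h2⟩ := LeadEquiv.exists_cons_of_min (u := a) (v := b) (by omega) (by omega)
          hΓ' hj' hval.1 hval.2
        exact ⟨_, _, Γ₁, rfl, h1, h2⟩
      · obtain ⟨Γ₁, h1, h2⟩ := LeadEquiv.exists_cons_of_min (u := b) (v := a) (by omega) (by omega)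
          hΓ' hj' hval.2 hval.1
        exact ⟨_, _, Γ₁, rfl, h1.trans (.swap _ _ _), h2⟩

end Lead

end PointsOnLine

end

/-! ### Leading monomials and the embedding of the degree pieces into a polynomial ring. -/

noncomputable section

namespace PointsOnLine

open MvPolynomial MonomialOrder

variable {L : Type*}

/-! ### Leading monomials -/

/-- The lexicographic order makes variables of smaller index larger. With indices in `ℕᵒᵈ`,
variables of larger number dominate: those of later pairs, and within a pair the right variable. -/
lemma lex_single_lt {v w : ℕᵒᵈ} (h : v < w) :
    (MonomialOrder.lex (σ := ℕᵒᵈ)).toSyn (Finsupp.single w 1) <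
      (MonomialOrder.lex (σ := ℕᵒᵈ)).toSyn (Finsupp.single v 1) := by
  rw [MonomialOrder.lex_lt_iff]
  exact Finsupp.Lex.single_lt_iff.mpr h

/-- The leading monomial of the polynomial has exponent `E` and coefficient one. -/
def HasLead (p : MvPolynomial ℕᵒᵈ ℤ) (E : ℕᵒᵈ →₀ ℕ) : Prop :=
  MonomialOrder.lex.Monic p ∧ MonomialOrder.lex.degree p = E

lemma HasLead.mul {p q : MvPolynomial ℕᵒᵈ ℤ} {E F : ℕᵒᵈ →₀ ℕ} (hp : HasLead p E)
    (hq : HasLead q F) : HasLead (p * q) (E + F) :=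
  ⟨hp.1.mul hq.1, by rw [degree_mul hp.1.ne_zero hq.1.ne_zero, hp.2, hq.2]⟩

lemma hasLead_one : HasLead 1 0 := ⟨monic_one, degree_one⟩

lemma hasLead_X_add {v : ℕᵒᵈ} {q : MvPolynomial ℕᵒᵈ ℤ}
    (hq : MonomialOrder.lex.toSyn (MonomialOrder.lex.degree q) <
      MonomialOrder.lex.toSyn (Finsupp.single v 1)) : HasLead (X v + q) (Finsupp.single v 1) := by
  have h : MonomialOrder.lex.degree (X v : MvPolynomial ℕᵒᵈ ℤ) = Finsupp.single v 1 := degree_X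
  exact ⟨monic_X.add_of_lt (by rwa [h]), by rw [degree_add_of_lt (by rwa [h]), h]⟩

/-- Polynomials with different leading monomials with coefficient one are independent, and the
leading exponent of a combination is one of the given ones. -/
lemma exists_degree_sum_eq {ι : Type*} {g : ι → MvPolynomial ℕᵒᵈ ℤ} {E : ι → ℕᵒᵈ →₀ ℕ}
    (hg : ∀ i, HasLead (g i) (E i)) (hE : Function.Injective E) {c : ι →₀ ℤ} (hc : c ≠ 0) :
    (c.sum fun i a => a • g i) ≠ 0 ∧
      ∃ i, MonomialOrder.lex.degree (c.sum fun i a => a • g i) = E i := by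
  obtain ⟨i, hi, hmax⟩ := Finset.exists_max_image c.support
    (fun i => MonomialOrder.lex.toSyn (E i)) (Finsupp.support_nonempty_iff.mpr hc)
  have hcoeff : coeff (E i) (c.sum fun i a => a • g i) = c i := by
    rw [Finsupp.sum, coeff_sum, Finset.sum_eq_single i]
    · rw [coeff_smul, ← (hg i).2, (hg i).1.coeff_degree, smul_eq_mul, mul_one]
    · intro j hj hji
      rw [coeff_smul, coeff_eq_zero_of_lt (m := MonomialOrder.lex), smul_zero]
      rw [(hg j).2]
      refine lt_of_le_of_ne (hmax j hj) fun h => hji (hE (MonomialOrder.lex.toSyn.injective h))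
    · intro h; exact absurd hi h
  have hne : coeff (E i) (c.sum fun i a => a • g i) ≠ 0 := by
    rw [hcoeff]; exact Finsupp.mem_support_iff.mp hi
  refine ⟨fun h => hne (by rw [h, coeff_zero]), i, ?_⟩
  refine MonomialOrder.lex.toSyn.injective (le_antisymm ?_
    (le_degree (mem_support_iff.mpr hne)))
  refine degree_sum_le.trans (Finset.sup_le fun j hj => ?_)
  refine (degree_smul_le).trans ?_
  rw [(hg j).2]
  exact hmax j hj

section Coordinates

variable (ρ : L → ℕ)

/-- The coordinate of a vertex: the vertices are grouped into pairs of neighbours. -/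
def coordinate (u : L) : MvPolynomial ℕᵒᵈ ℤ :=
  X (rightVar (ρ u / 2)) + if ρ u % 2 = 1 then X (loopVar (ρ u / 2)) else 0

/-- The ring homomorphism to a polynomial ring given by the differences of coordinates. -/
def toPoly : GraphRing L →+* MvPolynomial ℕᵒᵈ ℤ :=
  Ideal.Quotient.lift (Ideal.span (graphRelations L))
    (aeval (R := ℤ) fun e : L × L => coordinate ρ e.1 - coordinate ρ e.2).toRingHom (by
      intro p hp
      refine RingHom.mem_ker.mp ((Ideal.span_le (I := RingHom.ker _)).mpr ?_ hp)
      rintro _ ((⟨a, rfl⟩ | ⟨a, b, rfl⟩) | ⟨a, b, c, d, rfl⟩) <;>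
      · simp only [SetLike.mem_coe, RingHom.mem_ker, AlgHom.toRingHom_eq_coe, RingHom.coe_coe,
          map_add, map_sub, map_mul, aeval_X]
        ring)

lemma toPoly_edgeElt (a b : L) : toPoly ρ (edgeElt (a, b)) = coordinate ρ a - coordinate ρ b := by
  rw [toPoly, edgeElt, Ideal.Quotient.lift_mk]
  simp

/-- All edges are directed towards the vertex of smaller number. -/
def IsDescending (Γ : DirGraph L) : Prop := ∀ e ∈ Γ, ρ e.2 < ρ e.1

/-- The exponent of the leading monomial of a graph. -/
def graphExponent (Γ : DirGraph L) : ℕᵒᵈ →₀ ℕ :=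
  (Γ.map fun e => Finsupp.single (leadVar ρ e) 1).sum

variable {ρ}

lemma graphExponent_cons (e : L × L) (Γ : DirGraph L) :
    graphExponent ρ (e ::ₘ Γ) = Finsupp.single (leadVar ρ e) 1 + graphExponent ρ Γ := by
  simp [graphExponent]

lemma graphExponent_add (Γ Δ : DirGraph L) :
    graphExponent ρ (Γ + Δ) = graphExponent ρ Γ + graphExponent ρ Δ := by
  simp [graphExponent]

lemma graphExponent_eq_toFinsupp (Γ : DirGraph L) :
    graphExponent ρ Γ = Multiset.toFinsupp (Γ.map (leadVar ρ)) := by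
  induction Γ using Multiset.induction with
  | empty => simp [graphExponent]
  | cons e Γ ih =>
    rw [graphExponent_cons, ih, Multiset.map_cons, ← Multiset.singleton_add, map_add,
      Multiset.toFinsupp_singleton]

lemma map_leadVar_eq {Γ Δ : DirGraph L} (h : graphExponent ρ Γ = graphExponent ρ Δ) :
    Γ.map (leadVar ρ) = Δ.map (leadVar ρ) := by
  rw [graphExponent_eq_toFinsupp, graphExponent_eq_toFinsupp] at h
  exact Multiset.toFinsupp.injective h

lemma rightVar_lt_rightVar {i j : ℕ} (h : j < i) : rightVar i < rightVar j :=
  OrderDual.toDual_lt_toDual.mpr (by omega)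

lemma rightVar_lt_loopVar {i j : ℕ} (h : j ≤ i) : rightVar i < loopVar j :=
  OrderDual.toDual_lt_toDual.mpr (by omega)

/-- Inside a pair the common right variable cancels and only the loop variable is left. Otherwise
the right variable of the later pair dominates; descending directions give it coefficient `+1`. -/
lemma hasLead_edgeElt {a b : L} (h : ρ b < ρ a) :
    HasLead (toPoly ρ (edgeElt (a, b))) (Finsupp.single (leadVar ρ (a, b)) 1) := by
  rw [toPoly_edgeElt, coordinate, coordinate, leadVar]
  dsimp only
  by_cases hab : ρ a / 2 = ρ b / 2
  · rw [if_pos hab, if_pos (by omega), if_neg (by omega), hab, add_zero, add_sub_cancel_left]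
    exact ⟨monic_X, degree_X⟩
  · rw [if_neg hab, max_eq_left (by omega), add_sub_assoc]
    apply hasLead_X_add
    have hpos : ∀ v : ℕᵒᵈ, MonomialOrder.lex.toSyn 0 <
        MonomialOrder.lex.toSyn (Finsupp.single v 1) := by
      intro v
      rw [map_zero, toSyn_lt_iff_ne_zero, ne_eq, toSyn_eq_zero_iff]
      simp
    have hX : ∀ v w : ℕᵒᵈ, v < w → MonomialOrder.lex.toSyn
        (MonomialOrder.lex.degree (X w : MvPolynomial ℕᵒᵈ ℤ)) <
        MonomialOrder.lex.toSyn (Finsupp.single v 1) := by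
      intro v w hvw
      rw [degree_X]
      exact lex_single_lt hvw
    have h4 := rightVar_lt_loopVar (le_refl (ρ a / 2))
    have h5 : rightVar (ρ a / 2) < loopVar (ρ b / 2) := rightVar_lt_loopVar (by omega)
    have h6 : rightVar (ρ a / 2) < rightVar (ρ b / 2) := rightVar_lt_rightVar (by omega)
    refine degree_sub_le.trans_lt (max_lt ?_ (degree_add_le.trans_lt (max_lt (hX _ _ h6) ?_)))
    all_goals
      split_ifs
      · exact hX _ _ (by assumption)
      · rw [degree_zero]; exact hpos _

lemma hasLead_graphElt {Γ : DirGraph L} (h : IsDescending ρ Γ) :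
    HasLead (toPoly ρ (graphElt Γ)) (graphExponent ρ Γ) := by
  induction Γ using Multiset.induction with
  | empty => simpa [graphElt, graphExponent] using hasLead_one
  | cons e Γ ih =>
    rw [graphElt_cons, map_mul, graphExponent_cons]
    exact (hasLead_edgeElt (h e (by simp))).mul (ih fun f hf => h f (by simp [hf]))

variable [DecidableEq L]

/-- Every graph without loops can be directed towards the vertices of smaller number. -/
lemma exists_isDescending (hρ : Function.Injective ρ) (Γ : DirGraph L) : graphElt Γ = 0 ∨
    ∃ Δ : DirGraph L, IsDescending ρ Δ ∧ valence (underlying Δ) = valence (underlying Γ) ∧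
      graphLength ρ Δ = graphLength ρ Γ ∧ ∃ ε : ℤˣ, graphElt Γ = (ε : ℤ) • graphElt Δ := by
  induction Γ using Multiset.induction with
  | empty => exact Or.inr ⟨0, by simp [IsDescending], rfl, rfl, 1, by simp⟩
  | cons e Γ ih =>
    obtain ⟨a, b⟩ := e
    rcases ih with h | ⟨Δ, h1, h2, h3, ε, h4⟩
    · left
      rw [graphElt_cons, h, mul_zero]
    rcases lt_trichotomy (ρ a) (ρ b) with h | h | h
    · refine Or.inr ⟨(b, a) ::ₘ Δ, ?_, ?_, ?_, -ε, ?_⟩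
      · intro f hf
        rcases Multiset.mem_cons.mp hf with rfl | hf
        · exact h
        · exact h1 f hf
      · ext v
        simp only [valence_cons, h2]
        omega
      · rw [graphLength_cons, graphLength_cons, h3, edgeLength_swap]
      · rw [graphElt_cons, graphElt_cons, h4, edgeElt_swap, Units.val_neg, mul_smul_comm,
          show -edgeElt (b, a) * graphElt Δ = -(edgeElt (b, a) * graphElt Δ) by ring,
          neg_smul, smul_neg]
    · left
      rw [graphElt_cons, hρ h, edgeElt_self, zero_mul]
    · refine Or.inr ⟨(a, b) ::ₘ Δ, ?_, ?_, ?_, ε, ?_⟩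
      · intro f hf
        rcases Multiset.mem_cons.mp hf with rfl | hf
        · exact h
        · exact h1 f hf
      · ext v
        simp only [valence_cons, h2]
      · rw [graphLength_cons, graphLength_cons, h3]
      · rw [graphElt_cons, graphElt_cons, h4, mul_smul_comm]

/-- A non-zero element of degree `d` has a non-zero image, whose leading exponent is that of a
regular graph of degree `d`. -/
theorem exists_degree_eq (hρ : Function.Injective ρ) {d : ℕ} {f : GraphRing L}
    (hf : f ∈ degreePiece L d) (h0 : f ≠ 0) : toPoly ρ f ≠ 0 ∧ ∃ Γ : DirGraph L,
      IsDescending ρ Γ ∧ IsRegularOfDeg (underlying Γ) d ∧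
      MonomialOrder.lex.degree (toPoly ρ f) = graphExponent ρ Γ := by
  let B : Set (ℕᵒᵈ →₀ ℕ) := {E | ∃ Γ : DirGraph L, IsDescending ρ Γ ∧
    IsRegularOfDeg (underlying Γ) d ∧ graphExponent ρ Γ = E}
  have hB : ∀ E : B, ∃ Γ : DirGraph L, IsDescending ρ Γ ∧
    IsRegularOfDeg (underlying Γ) d ∧ graphExponent ρ Γ = E := fun E => E.2
  choose g hg1 hg2 hg3 using hB
  -- One chosen graph for each exponent suffices to span: a graph agrees up to sign with the chosen
  -- one of its exponent modulo shorter graphs, and induction on the length handles those.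
  have hspan : ∀ n, ∀ Γ : DirGraph L, graphLength ρ Γ = n → IsRegularOfDeg (underlying Γ) d →
      graphElt Γ ∈ Submodule.span ℤ (Set.range fun E : B => graphElt (g E)) := by
    intro n
    induction n using Nat.strong_induction_on with
    | _ n ih =>
      intro Γ hn hΓ
      rcases exists_isDescending hρ Γ with h | ⟨Δ, h1, h2, h3, ε, h4⟩
      · rw [h]; exact Submodule.zero_mem _
      rw [h4]
      refine Submodule.smul_mem _ _ ?_
      have hΔ : IsRegularOfDeg (underlying Δ) d := fun v => by rw [h2]; exact hΓ v
      let E : B := ⟨graphExponent ρ Δ, Δ, h1, hΔ, rfl⟩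
      obtain ⟨δ, hδ⟩ := (LeadEquiv.of_lead_eq hρ _ (g E) Δ rfl
        (fun e he h => (h1 e he).ne (by rw [h])) (fun e he h => (hg1 E e he).ne (by rw [h]))
        (funext fun v => (hΔ v).trans (hg2 E v).symm) (map_leadVar_eq (hg3 E).symm)).congr
      have hle : shorterSpan ρ (valence (underlying Δ)) (graphLength ρ Δ) ≤
          Submodule.span ℤ (Set.range fun E : B => graphElt (g E)) := by
        refine Submodule.span_le.mpr ?_
        rintro _ ⟨Θ, hΘ, hlt, rfl⟩
        exact ih _ (by omega) Θ rfl fun v => by rw [hΘ]; exact hΔ v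
      have := Submodule.add_mem _ (hle hδ)
        (Submodule.smul_mem _ (δ : ℤ) (Submodule.subset_span ⟨E, rfl⟩))
      rwa [sub_add_cancel] at this
  have hf' : f ∈ Submodule.span ℤ (Set.range fun E : B => graphElt (g E)) := by
    refine Submodule.span_le.mpr ?_ hf
    rintro _ ⟨Γ, hΓ, rfl⟩
    exact hspan _ Γ rfl hΓ
  obtain ⟨c, rfl⟩ := (Finsupp.mem_span_range_iff_exists_finsupp).mp hf'
  have hc : c ≠ 0 := by rintro rfl; simp at h0
  have hlead : ∀ E : B, HasLead (toPoly ρ (graphElt (g E))) E := fun E => by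
    rw [← hg3 E]; exact hasLead_graphElt (hg1 E)
  -- The chosen graphs have pairwise distinct monic leading monomials, so no cancellation at the top
  -- is possible.
  obtain ⟨h1, E, h2⟩ := exists_degree_sum_eq hlead Subtype.val_injective hc
  have hmap : toPoly ρ (c.sum fun E a => a • graphElt (g E)) =
      c.sum fun E a => a • toPoly ρ (graphElt (g E)) := by
    rw [Finsupp.sum, map_sum, Finsupp.sum]
    simp
  rw [hmap]
  exact ⟨h1, g E, hg1 E, hg2 E, by rw [h2, hg3]⟩

end Coordinates

end PointsOnLine

end

/-! ### Edge counts: exponents of regular graphs correspond to weightings. -/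

noncomputable section

namespace PointsOnLine

variable {L : Type*}

section Counting

variable (ρ : L → ℕ)

/-- The number of edges inside the `i`-th pair. -/
def insideCount (Γ : DirGraph L) (i : ℕ) : ℕ :=
  Γ.countP fun e => ρ e.1 / 2 = i ∧ ρ e.2 / 2 = i

/-- The number of edges from the `i`-th pair to the left. -/
def leftCount (Γ : DirGraph L) (i : ℕ) : ℕ :=
  Γ.countP fun e => (ρ e.1 / 2 < i ∧ ρ e.2 / 2 = i) ∨ (ρ e.2 / 2 < i ∧ ρ e.1 / 2 = i)

/-- The number of edges from the `i`-th pair to the right. -/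
def rightCount (Γ : DirGraph L) (i : ℕ) : ℕ :=
  Γ.countP fun e => (i < ρ e.1 / 2 ∧ ρ e.2 / 2 = i) ∨ (i < ρ e.2 / 2 ∧ ρ e.1 / 2 = i)

/-- The number of edges passing over the `i`-th pair. -/
def overCount (Γ : DirGraph L) (i : ℕ) : ℕ :=
  Γ.countP fun e => (ρ e.1 / 2 < i ∧ i < ρ e.2 / 2) ∨ (ρ e.2 / 2 < i ∧ i < ρ e.1 / 2)

/-- The number of edges crossing the spine in front of the `i`-th pair. -/
def crossCount (Γ : DirGraph L) (i : ℕ) : ℕ :=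
  Γ.countP fun e => (ρ e.1 / 2 < i ∧ i ≤ ρ e.2 / 2) ∨ (ρ e.2 / 2 < i ∧ i ≤ ρ e.1 / 2)

variable {ρ}

lemma crossCount_eq (Γ : DirGraph L) (i : ℕ) :
    crossCount ρ Γ i = leftCount ρ Γ i + overCount ρ Γ i := by
  induction Γ using Multiset.induction with
  | empty => rfl
  | cons e Γ ih =>
    simp only [crossCount, leftCount, overCount, Multiset.countP_cons] at ih ⊢
    split_ifs <;> omega

lemma crossCount_succ_eq (Γ : DirGraph L) (i : ℕ) :
    crossCount ρ Γ (i + 1) = rightCount ρ Γ i + overCount ρ Γ i := by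
  induction Γ using Multiset.induction with
  | empty => rfl
  | cons e Γ ih =>
    simp only [crossCount, rightCount, overCount, Multiset.countP_cons] at ih ⊢
    split_ifs <;> omega

lemma crossCount_zero (Γ : DirGraph L) : crossCount ρ Γ 0 = 0 := by
  simp [crossCount]

lemma graphExponent_loopVar (Γ : DirGraph L) (i : ℕ) :
    graphExponent ρ Γ (loopVar i) = insideCount ρ Γ i := by
  induction Γ using Multiset.induction with
  | empty => simp [graphExponent, insideCount]
  | cons e Γ ih =>
    rw [graphExponent_cons, Finsupp.add_apply, ih, insideCount, insideCount, Multiset.countP_cons, add_comm]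
    congr 1
    rw [Finsupp.single_apply]
    refine if_congr ?_ rfl rfl
    rw [leadVar]
    split_ifs with h
    · rw [loopVar_inj]; omega
    · simp only [(loopVar_ne_rightVar _ _).symm, false_iff]; omega

lemma graphExponent_rightVar (Γ : DirGraph L) (i : ℕ) :
    graphExponent ρ Γ (rightVar i) = leftCount ρ Γ i := by
  induction Γ using Multiset.induction with
  | empty => simp [graphExponent, leftCount]
  | cons e Γ ih =>
    rw [graphExponent_cons, Finsupp.add_apply, ih, leftCount, leftCount, Multiset.countP_cons, add_comm]
    congr 1
    rw [Finsupp.single_apply]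
    refine if_congr ?_ rfl rfl
    rw [leadVar]
    split_ifs with h
    · simp only [loopVar_ne_rightVar, false_iff]; omega
    · rw [rightVar_inj]; omega

end Counting

section Numbering

variable {m : ℕ} (φ : L ≃ Fin (2 * m))

/-- The numbering of the vertices given by an equivalence. -/
def number (u : L) : ℕ := φ u

lemma number_injective : Function.Injective (number φ) := fun _ _ h => φ.injective (Fin.ext h)

lemma number_lt (u : L) : number φ u < 2 * m := (φ u).2

lemma exists_number_eq {i : ℕ} (hi : i < 2 * m) : ∃ u, number φ u = i :=
  ⟨φ.symm ⟨i, hi⟩, by simp [number]⟩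

variable {φ}

lemma count_eq_zero_of_le (Γ : DirGraph L) {i : ℕ} (hi : m ≤ i) :
    insideCount (number φ) Γ i = 0 ∧ leftCount (number φ) Γ i = 0 ∧
    rightCount (number φ) Γ i = 0 ∧ crossCount (number φ) Γ i = 0 := by
  have h := number_lt φ
  refine ⟨?_, ?_, ?_, ?_⟩
  all_goals
    refine Multiset.countP_eq_zero.mpr fun e _ => ?_
    have := h e.1
    have := h e.2
    omega

variable [DecidableEq L]

lemma count_cons_eq (a v : L) (O : Multiset L) :
    (a ::ₘ O).count v = O.count v + if a = v then 1 else 0 := by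
  rw [Multiset.count_cons]
  simp only [eq_comm]

/-- The valences of the two vertices of the pair are added; an edge inside the pair is counted
twice. -/
lemma two_mul_insideCount_add {d : ℕ} {Γ : DirGraph L} (hΓ : IsRegularOfDeg (underlying Γ) d)
    {i : ℕ} (hi : i < m) : 2 * insideCount (number φ) Γ i + leftCount (number φ) Γ i +
      rightCount (number φ) Γ i = 2 * d := by
  obtain ⟨a, ha⟩ := exists_number_eq φ (i := 2 * i) (by omega)
  obtain ⟨b, hb⟩ := exists_number_eq φ (i := 2 * i + 1) (by omega)
  have hab : ∀ Γ : DirGraph L, valence (underlying Γ) a + valence (underlying Γ) b =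
      2 * insideCount (number φ) Γ i + leftCount (number φ) Γ i +
      rightCount (number φ) Γ i := by
    intro Γ
    induction Γ using Multiset.induction with
    | empty => simp [valence_underlying_zero, insideCount, leftCount, rightCount]
    | cons e Γ ih =>
      simp only [insideCount, leftCount, rightCount, Multiset.countP_cons, valence_cons] at ih ⊢
      simp only [← (number_injective φ).eq_iff, ha, hb]
      generalize number φ e.1 = x
      generalize number φ e.2 = y
      generalize valence (underlying Γ) a = p at *
      generalize valence (underlying Γ) b = q at *
      have hx : (if x = 2 * i then 1 else 0) + (if x = 2 * i + 1 then 1 else 0) =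
          if x / 2 = i then 1 else 0 := by split_ifs <;> omega
      have hy : (if y = 2 * i then 1 else 0) + (if y = 2 * i + 1 then 1 else 0) =
          if y / 2 = i then 1 else 0 := by split_ifs <;> omega
      have hz : (if x / 2 = i then 1 else 0) + (if y / 2 = i then 1 else 0) =
          2 * (if x / 2 = i ∧ y / 2 = i then 1 else 0) +
          (if x / 2 < i ∧ y / 2 = i ∨ y / 2 < i ∧ x / 2 = i then 1 else 0) +
          (if i < x / 2 ∧ y / 2 = i ∨ i < y / 2 ∧ x / 2 = i then 1 else 0) := by
        split_ifs <;> omega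
      omega
  rw [← hab Γ, hΓ a, hΓ b]
  omega

/-- The leading exponent of a regular graph determines the number of its edges crossing the edges of
the tree. -/
lemma crossCount_eq_of_exponent {d : ℕ} {Γ : DirGraph L} (hΓ : IsRegularOfDeg (underlying Γ) d)
    {W : Weighting m d} (hW : graphExponent (number φ) Γ = W.exponent) (i : ℕ) :
    crossCount (number φ) Γ i = 2 * W.t i ∧
      leftCount (number φ) Γ i + rightCount (number φ) Γ i = 2 * W.s i := by
  have key : ∀ i < m, leftCount (number φ) Γ i + W.t (i + 1) = W.s i + W.t i ∧
      leftCount (number φ) Γ i + rightCount (number φ) Γ i = 2 * W.s i := by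
    intro i hi
    have h1 := graphExponent_loopVar (ρ := number φ) Γ i
    have h2 := graphExponent_rightVar (ρ := number φ) Γ i
    rw [hW, W.exponent_even hi] at h1
    rw [hW, W.exponent_odd hi] at h2
    have h3 := two_mul_insideCount_add (φ := φ) hΓ hi
    have h4 := W.s_le i
    have h5 := W.right_le i
    omega
  have hcross : ∀ i ≤ m, crossCount (number φ) Γ i = 2 * W.t i := by
    intro i
    induction i with
    | zero => intro _; rw [crossCount_zero, W.t_zero]
    | succ i ih =>
      intro hi
      have h1 := ih (by omega)
      have h2 := key i (by omega)
      rw [crossCount_eq] at h1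
      rw [crossCount_succ_eq]
      omega
  rcases lt_or_ge i m with hi | hi
  · exact ⟨hcross i hi.le, (key i hi).2⟩
  · obtain ⟨-, h2, h3, h4⟩ := count_eq_zero_of_le (φ := φ) Γ hi
    rw [W.t_end i hi, W.s_end hi]
    omega

/-- A form without truncated subtraction, suited to linear arithmetic. -/
lemma Weighting.exponent_eq_iff {d : ℕ} (W : Weighting m d) (E : ℕᵒᵈ →₀ ℕ) :
    W.exponent = E ↔ (∀ i < m, E (loopVar i) + W.s i = d ∧
      E (rightVar i) + W.t (i + 1) = W.s i + W.t i) ∧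
      ∀ i, m ≤ i → E (loopVar i) = 0 ∧ E (rightVar i) = 0 := by
  constructor
  · rintro rfl
    refine ⟨fun i hi => ?_, fun i hi => ?_⟩
    · have := W.s_le i
      have := W.right_le i
      rw [W.exponent_even hi, W.exponent_odd hi]
      omega
    · constructor <;> refine W.exponent_apply_eq_zero fun k hk => ?_
      · rw [ne_eq, loopVar_inj]
        exact ⟨by omega, loopVar_ne_rightVar _ _⟩
      · rw [ne_eq, ne_eq, rightVar_inj]
        exact ⟨(loopVar_ne_rightVar _ _).symm, by omega⟩
  · rintro ⟨h1, h2⟩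
    ext v
    obtain ⟨i, rfl | rfl⟩ : ∃ i, v = loopVar i ∨ v = rightVar i := by
      refine ⟨OrderDual.ofDual v / 2, ?_⟩
      rcases Nat.even_or_odd' (OrderDual.ofDual v) with ⟨k, hk | hk⟩
      · left
        rw [loopVar, ← OrderDual.ofDual_inj, OrderDual.ofDual_toDual]
        omega
      · right
        rw [rightVar, ← OrderDual.ofDual_inj, OrderDual.ofDual_toDual]
        omega
    · rcases lt_or_ge i m with hi | hi
      · rw [W.exponent_even hi]
        have := h1 i hi
        omega
      · rw [(h2 i hi).1]
        refine W.exponent_apply_eq_zero fun k hk => ?_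
        rw [ne_eq, loopVar_inj]
        exact ⟨by omega, loopVar_ne_rightVar _ _⟩
    · rcases lt_or_ge i m with hi | hi
      · rw [W.exponent_odd hi]
        have := h1 i hi
        omega
      · rw [(h2 i hi).2]
        refine W.exponent_apply_eq_zero fun k hk => ?_
        rw [ne_eq, ne_eq, rightVar_inj]
        exact ⟨(loopVar_ne_rightVar _ _).symm, by omega⟩

/-- The leading exponent of a regular graph is given by a weighting. -/
lemma exists_weighting {d : ℕ} {Γ : DirGraph L} (hΓ : IsRegularOfDeg (underlying Γ) d) :
    ∃ W : Weighting m d, W.exponent = graphExponent (number φ) Γ := by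
  have hin : ∀ i, i < m → 2 * insideCount (number φ) Γ i + leftCount (number φ) Γ i +
      rightCount (number φ) Γ i = 2 * d := fun i hi => two_mul_insideCount_add hΓ hi
  have hout := fun i (hi : m ≤ i) => count_eq_zero_of_le (φ := φ) Γ hi
  have h1 : ∀ i, crossCount (number φ) Γ i =
      leftCount (number φ) Γ i + overCount (number φ) Γ i := crossCount_eq Γ
  have h2 : ∀ i, crossCount (number φ) Γ (i + 1) =
      rightCount (number φ) Γ i + overCount (number φ) Γ i := crossCount_succ_eq Γ
  -- Consecutive crossing numbers differ by the right count minus the left count. This has the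
  -- parity of their sum, which is even by regularity, so all crossing numbers are even and can be
  -- halved.
  have heven : ∀ i, crossCount (number φ) Γ i % 2 = 0 ∧
      (leftCount (number φ) Γ i + rightCount (number φ) Γ i) % 2 = 0 ∧
      leftCount (number φ) Γ i + rightCount (number φ) Γ i ≤ 2 * d := by
    have h3 : ∀ i, (leftCount (number φ) Γ i + rightCount (number φ) Γ i) % 2 = 0 ∧
        leftCount (number φ) Γ i + rightCount (number φ) Γ i ≤ 2 * d := by
      intro i
      rcases lt_or_ge i m with hi | hi
      · have := hin i hi; omega
      · have := hout i hi; omega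
    intro i
    refine ⟨?_, h3 i⟩
    induction i with
    | zero => rw [crossCount_zero]
    | succ i ih =>
      have := h1 i
      have := h2 i
      have := h3 i
      omega
  refine ⟨⟨fun i => crossCount (number φ) Γ i / 2,
    fun i => (leftCount (number φ) Γ i + rightCount (number φ) Γ i) / 2,
    by simp [crossCount_zero], fun i hi => by simp [(hout _ hi).2.2.2], ?_, ?_, ?_, ?_⟩, ?_⟩
  · intro i; have := heven i; omega
  · intro i
    have := heven i; have := heven (i + 1); have := h1 i; have := h2 i
    omega
  · intro i
    have := heven i; have := heven (i + 1); have := h1 i; have := h2 i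
    omega
  · intro i
    have := heven i; have := heven (i + 1); have := h1 i; have := h2 i
    omega
  · rw [Weighting.exponent_eq_iff]
    dsimp only
    refine ⟨fun i hi => ?_, fun i hi => ?_⟩ <;>
      rw [graphExponent_loopVar, graphExponent_rightVar]
    · have := heven i; have := heven (i + 1); have := h1 i; have := h2 i; have := hin i hi
      omega
    · have := hout i hi
      omega

variable (φ)

/-- Every weighting of degree one is that of a matching. -/
lemma exists_matching (P : Weighting m 1) : ∃ Γ : DirGraph L, IsDescending (number φ) Γ ∧
    IsRegularOfDeg (underlying Γ) 1 ∧ graphExponent (number φ) Γ = P.exponent := by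
  -- The matching is built pair by pair, with `O` the vertices still waiting for a partner on the
  -- right; there are twice as many as the spine weight. A pair is joined to itself if its leg
  -- weight is zero. Otherwise two, one or none of its vertices are joined to waiting ones,
  -- according to whether the spine weight falls, stays or rises.
  have key : ∀ i, i ≤ m → ∃ (Γ : DirGraph L) (O : Multiset L), IsDescending (number φ) Γ ∧
      (∀ v, valence (underlying Γ) v + O.count v = if number φ v < 2 * i then 1 else 0) ∧
      O.card = 2 * P.t i ∧ graphExponent (number φ) Γ = ∑ k ∈ Finset.range i,
        (Finsupp.single (loopVar k) (1 - P.s k) +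
          Finsupp.single (rightVar k) (P.s k + P.t k - P.t (k + 1))) := by
    intro i
    induction i with
    | zero =>
      intro _
      exact ⟨0, 0, by simp [IsDescending], by simp [valence_underlying_zero],
        by simp [P.t_zero], by simp [graphExponent]⟩
    | succ i ih =>
      intro hi
      obtain ⟨Γ, O, h1, h2, h3, h4⟩ := ih (by omega)
      obtain ⟨a, ha⟩ := exists_number_eq φ (i := 2 * i) (by omega)
      obtain ⟨b, hb⟩ := exists_number_eq φ (i := 2 * i + 1) (by omega)
      have hval : ∀ v, (if number φ v < 2 * (i + 1) then 1 else 0) =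
          (if number φ v < 2 * i then 1 else 0) + (if a = v then 1 else 0) +
          (if b = v then 1 else 0) := by
        intro v
        simp only [← (number_injective φ).eq_iff, ha, hb]
        split_ifs <;> omega
      have hO : ∀ v ∈ O, number φ v < 2 * i := by
        intro v hv
        have h5 := h2 v
        have h6 := Multiset.one_le_count_iff_mem.mpr hv
        by_contra h7
        rw [if_neg h7] at h5
        omega
      have hs := P.s_le i
      have hle := P.s_le_add i
      have hl := P.left_le i
      have hr := P.right_le i
      have hsa : ∀ x, number φ x < 2 * i → Finsupp.single (leadVar (number φ) (a, x)) 1 =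
          Finsupp.single (rightVar i) 1 := by
        intro x hx
        rw [leadVar, if_neg (by dsimp only; omega)]
        congr 2
        dsimp only
        omega
      have hsb : ∀ x, number φ x < 2 * i → Finsupp.single (leadVar (number φ) (b, x)) 1 =
          Finsupp.single (rightVar i) 1 := by
        intro x hx
        rw [leadVar, if_neg (by dsimp only; omega)]
        congr 2
        dsimp only
        omega
      rcases Nat.eq_zero_or_pos (P.s i) with hs0 | hs0
      · have ht : P.t (i + 1) = P.t i := by omega
        refine ⟨(b, a) ::ₘ Γ, O, ?_, fun v => ?_, by rw [h3, ht], ?_⟩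
        · intro e he
          rcases Multiset.mem_cons.mp he with rfl | he
          · dsimp only; omega
          · exact h1 e he
        · rw [valence_cons, hval, ← h2 v]
          dsimp only
          omega
        · have hlead : leadVar (number φ) (b, a) = loopVar i := by
            rw [leadVar, if_pos (by dsimp only; omega)]
            congr 1
            dsimp only
            omega
          rw [graphExponent_cons, h4, Finset.sum_range_succ, hs0, ht, hlead]
          simp [add_comm]
      have hs1 : P.s i = 1 := by omega
      obtain ht | ht | ht : P.t (i + 1) = P.t i + 1 ∨ P.t (i + 1) = P.t i ∨
        P.t i = P.t (i + 1) + 1 := by omega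
      · refine ⟨Γ, a ::ₘ b ::ₘ O, h1, fun v => ?_, ?_, ?_⟩
        · rw [count_cons_eq, count_cons_eq, hval, ← h2 v]
          omega
        · rw [Multiset.card_cons, Multiset.card_cons, h3, ht]
          omega
        · rw [Finset.sum_range_succ, ← h4, hs1, ht]
          simp [add_comm]
      · obtain ⟨x, hx⟩ := Multiset.card_pos_iff_exists_mem.mp (by omega : 0 < O.card)
        have hxi := hO x hx
        obtain ⟨O, rfl⟩ := Multiset.exists_cons_of_mem hx
        refine ⟨(a, x) ::ₘ Γ, b ::ₘ O, ?_, fun v => ?_, ?_, ?_⟩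
        · intro e he
          rcases Multiset.mem_cons.mp he with rfl | he
          · dsimp only; omega
          · exact h1 e he
        · have := h2 v
          rw [count_cons_eq] at this
          rw [valence_cons, count_cons_eq, hval, ← this]
          dsimp only
          omega
        · rw [Multiset.card_cons] at h3 ⊢
          omega
        · rw [graphExponent_cons, Finset.sum_range_succ, ← h4, hs1, ht, hsa x hxi]
          simp [add_comm]
      · obtain ⟨x, hx⟩ := Multiset.card_pos_iff_exists_mem.mp (by omega : 0 < O.card)
        have hxi := hO x hx
        obtain ⟨O, rfl⟩ := Multiset.exists_cons_of_mem hx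
        rw [Multiset.card_cons] at h3
        obtain ⟨y, hy⟩ := Multiset.card_pos_iff_exists_mem.mp (by omega : 0 < O.card)
        have hyi := hO y (Multiset.mem_cons_of_mem hy)
        obtain ⟨O, rfl⟩ := Multiset.exists_cons_of_mem hy
        rw [Multiset.card_cons] at h3
        refine ⟨(a, x) ::ₘ (b, y) ::ₘ Γ, O, ?_, fun v => ?_, ?_, ?_⟩
        · intro e he
          rcases Multiset.mem_cons.mp he with rfl | he
          · dsimp only; omega
          rcases Multiset.mem_cons.mp he with rfl | he
          · dsimp only; omega
          · exact h1 e he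
        · have := h2 v
          rw [count_cons_eq, count_cons_eq] at this
          rw [valence_cons, valence_cons, hval, ← this]
          dsimp only
          omega
        · omega
        · rw [graphExponent_cons, graphExponent_cons, Finset.sum_range_succ, ← h4, hs1, ht,
            hsa x hxi, hsb y hyi]
          have h5 : 1 + (P.t (i + 1) + 1) - P.t (i + 1) = 1 + 1 := by omega
          rw [h5, Finsupp.single_add]
          simp
          abel
  obtain ⟨Γ, O, h1, h2, h3, h4⟩ := key m le_rfl
  refine ⟨Γ, h1, fun v => ?_, h4⟩
  have hO : O = 0 := by
    rw [← Multiset.card_eq_zero, h3, P.t_end m le_rfl]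
  have := h2 v
  rw [if_pos (number_lt φ v), hO] at this
  simpa using this

end Numbering

end PointsOnLine

end

/-! ### Families of matchings in `Sym(V_L)` and their reduction by leading exponent. -/

noncomputable section

namespace PointsOnLine

open MvPolynomial MonomialOrder

section Sym

variable {L : Type*} [DecidableEq L]

lemma graphElt_mem_degreePiece {Γ : DirGraph L} {d : ℕ} (h : IsRegularOfDeg (underlying Γ) d) :
    graphElt Γ ∈ degreePiece L d := Submodule.subset_span ⟨Γ, h, rfl⟩

lemma symToRing_ι (v : degreeOne L) : symToRing L (SymmetricAlgebra.ι ℤ (degreeOne L) v) =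
    ⟨v, degreePiece_le L 1 v.2⟩ :=
  SymmetricAlgebra.lift_ι_apply (A := invariantRing L) _ v

/-- The evaluation of an element of `Sym(V_L)` in `S_L`. -/
def evalSym (L : Type*) [DecidableEq L] : SymV L →ₐ[ℤ] GraphRing L :=
  (invariantRing L).val.comp (symToRing L)

lemma evalSym_ι (v : degreeOne L) : evalSym L (SymmetricAlgebra.ι ℤ (degreeOne L) v) = v := by
  rw [evalSym, AlgHom.comp_apply, symToRing_ι]
  rfl

lemma evalSym_matchingElt (Γ : DirMatching L) : evalSym L (matchingElt Γ) = graphElt Γ.1 :=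
  evalSym_ι _

lemma mem_relationIdeal {f : SymV L} : f ∈ relationIdeal L ↔ evalSym L f = 0 := by
  rw [relationIdeal, RingHom.mem_ker, evalSym, AlgHom.comp_apply]
  exact (ZeroMemClass.coe_eq_zero (x := symToRing L f)).symm

lemma mul_mem_symPiece {a b : ℕ} {x y : SymV L} (hx : x ∈ symPiece L a) (hy : y ∈ symPiece L b) :
    x * y ∈ symPiece L (a + b) := by
  rw [symPiece, pow_add]
  exact Submodule.mul_mem_mul hx hy

lemma ι_mem_symPiece (v : degreeOne L) :
    SymmetricAlgebra.ι ℤ (degreeOne L) v ∈ symPiece L 1 := by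
  rw [symPiece, pow_one]
  exact ⟨v, rfl⟩

/-- There are no linear relations, because `V_L` is by definition a subgroup of `S_L`. -/
lemma eq_of_evalSym_eq {x y : SymV L} (hx : x ∈ symPiece L 1) (hy : y ∈ symPiece L 1)
    (h : evalSym L x = evalSym L y) : x = y := by
  rw [symPiece, pow_one] at hx hy
  obtain ⟨v, rfl⟩ := hx
  obtain ⟨w, rfl⟩ := hy
  rw [evalSym_ι, evalSym_ι] at h
  rw [Subtype.ext h]

end Sym

/-- Since `q` is monic, the leading term of `p` can be cancelled over `ℤ`, without division. -/
lemma HasLead.sub_smul {p q : MvPolynomial ℕᵒᵈ ℤ} {E : ℕᵒᵈ →₀ ℕ}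
    (hp : MonomialOrder.lex.degree p = E) (hq : HasLead q E) :
    p - MonomialOrder.lex.leadingCoeff p • q = 0 ∨ MonomialOrder.lex.toSyn
      (MonomialOrder.lex.degree (p - MonomialOrder.lex.leadingCoeff p • q)) <
      MonomialOrder.lex.toSyn E := by
  by_contra hn
  push Not at hn
  obtain ⟨h0, hle⟩ := hn
  have hle' : MonomialOrder.lex.toSyn
      (MonomialOrder.lex.degree (p - MonomialOrder.lex.leadingCoeff p • q)) ≤
      MonomialOrder.lex.toSyn E := by
    refine degree_sub_le.trans (max_le (le_of_eq (by rw [hp])) (degree_smul_le.trans ?_))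
    rw [hq.2]
  have heq := MonomialOrder.lex.toSyn.injective (le_antisymm hle' hle)
  have hc := MonomialOrder.lex.coeff_degree_ne_zero_iff.mpr h0
  apply hc
  rw [heq, coeff_sub, coeff_smul, ← hq.2, hq.1.coeff_degree, hq.2, ← hp]
  simp [MonomialOrder.leadingCoeff]

lemma HasLead.sub {p q : MvPolynomial ℕᵒᵈ ℤ} {E : ℕᵒᵈ →₀ ℕ} (hp : HasLead p E)
    (hq : HasLead q E) : p - q = 0 ∨ MonomialOrder.lex.toSyn
      (MonomialOrder.lex.degree (p - q)) < MonomialOrder.lex.toSyn E := by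
  have := HasLead.sub_smul hp.2 hq
  rwa [hp.1.leadingCoeff_eq_one, one_smul] at this

section Families

open Weighting

variable {L : Type*} [DecidableEq L] {m : ℕ} (φ : L ≃ Fin (2 * m))

/-- A matching with a given weighting. -/
def pathMatching (P : Weighting m 1) : DirMatching L :=
  ⟨(exists_matching φ P).choose, (exists_matching φ P).choose_spec.2.1⟩

lemma pathMatching_isDescending (P : Weighting m 1) :
    IsDescending (number φ) (pathMatching φ P).1 := (exists_matching φ P).choose_spec.1

lemma graphExponent_pathMatching (P : Weighting m 1) :
    graphExponent (number φ) (pathMatching φ P).1 = P.exponent :=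
  (exists_matching φ P).choose_spec.2.2

/-- The product in `Sym(V_L)` of the matchings given by a family of weightings. -/
def familyElt (F : Multiset (Weighting m 1)) : SymV L :=
  (F.map fun P => matchingElt (pathMatching φ P)).prod

lemma familyElt_cons (P : Weighting m 1) (F : Multiset (Weighting m 1)) :
    familyElt φ (P ::ₘ F) = matchingElt (pathMatching φ P) * familyElt φ F := by
  simp [familyElt]

lemma familyElt_zero : familyElt φ (0 : Multiset (Weighting m 1)) = 1 := by
  simp [familyElt]

lemma familyElt_add (F G : Multiset (Weighting m 1)) :
    familyElt φ (F + G) = familyElt φ F * familyElt φ G := by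
  simp [familyElt]

lemma totalExponent_add (F G : Multiset (Weighting m 1)) :
    totalExponent (F + G) = totalExponent F + totalExponent G := by
  simp [totalExponent]

lemma exists_graph_familyElt (F : Multiset (Weighting m 1)) : ∃ Γ : DirGraph L,
    evalSym L (familyElt φ F) = graphElt Γ ∧ IsRegularOfDeg (underlying Γ) F.card ∧
    IsDescending (number φ) Γ ∧ graphExponent (number φ) Γ = totalExponent F := by
  induction F using Multiset.induction with
  | empty =>
    exact ⟨0, by simp [familyElt, graphElt], valence_underlying_zero, by simp [IsDescending],
      by simp [graphExponent, totalExponent]⟩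
  | cons P F ih =>
    obtain ⟨Γ, h1, h2, h3, h4⟩ := ih
    refine ⟨(pathMatching φ P).1 + Γ, ?_, fun v => ?_, fun e he => ?_, ?_⟩
    · rw [familyElt_cons, map_mul, h1, evalSym_matchingElt, graphElt_add]
    · rw [underlying_add, valence_add, h2 v, (pathMatching φ P).2 v, Multiset.card_cons, add_comm]
    · rcases Multiset.mem_add.mp he with he | he
      · exact pathMatching_isDescending φ P e he
      · exact h3 e he
    · rw [graphExponent_add, graphExponent_pathMatching, h4, totalExponent_cons]

lemma hasLead_familyElt (F : Multiset (Weighting m 1)) :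
    HasLead (toPoly (number φ) (evalSym L (familyElt φ F))) (totalExponent F) := by
  obtain ⟨Γ, h1, -, h3, h4⟩ := exists_graph_familyElt φ F
  rw [h1, ← h4]
  exact hasLead_graphElt h3

lemma evalSym_familyElt_mem (F : Multiset (Weighting m 1)) :
    evalSym L (familyElt φ F) ∈ degreePiece L F.card := by
  obtain ⟨Γ, h1, h2, -, -⟩ := exists_graph_familyElt φ F
  rw [h1]
  exact graphElt_mem_degreePiece h2

lemma familyElt_mem_symPiece (F : Multiset (Weighting m 1)) :
    familyElt φ F ∈ symPiece L F.card := by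
  induction F using Multiset.induction with
  | empty => rw [familyElt_zero, Multiset.card_zero, symPiece, pow_zero]; exact Submodule.one_le.mp le_rfl
  | cons P F ih =>
    rw [familyElt_cons, Multiset.card_cons, add_comm]
    exact mul_mem_symPiece (ι_mem_symPiece _) ih

/-- The span of the families of `d` members with leading exponent less than `E`. -/
def belowSpan (d : ℕ) (E : ℕᵒᵈ →₀ ℕ) : Submodule ℤ (SymV L) :=
  Submodule.span ℤ {x | ∃ F : Multiset (Weighting m 1), F.card = d ∧
    MonomialOrder.lex.toSyn (totalExponent F) < MonomialOrder.lex.toSyn E ∧ x = familyElt φ F}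

lemma belowSpan_mono {d : ℕ} {E E' : ℕᵒᵈ →₀ ℕ}
    (h : MonomialOrder.lex.toSyn E ≤ MonomialOrder.lex.toSyn E') :
    belowSpan φ d E ≤ belowSpan φ d E' := by
  refine Submodule.span_mono ?_
  rintro _ ⟨F, h1, h2, rfl⟩
  exact ⟨F, h1, h2.trans_le h, rfl⟩

lemma belowSpan_le_symPiece (d : ℕ) (E : ℕᵒᵈ →₀ ℕ) : belowSpan φ d E ≤ symPiece L d := by
  refine Submodule.span_le.mpr ?_
  rintro _ ⟨F, rfl, -, rfl⟩
  exact familyElt_mem_symPiece φ F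

lemma familyElt_mul_mem_belowSpan {d : ℕ} {E : ℕᵒᵈ →₀ ℕ} (F : Multiset (Weighting m 1))
    {x : SymV L} (hx : x ∈ belowSpan φ d E) :
    familyElt φ F * x ∈ belowSpan φ (F.card + d) (totalExponent F + E) := by
  induction hx using Submodule.span_induction with
  | mem x hx =>
    obtain ⟨G, rfl, h, rfl⟩ := hx
    refine Submodule.subset_span ⟨F + G, Multiset.card_add _ _, ?_, (familyElt_add φ F G).symm⟩
    rw [totalExponent_add, map_add, map_add]
    exact add_lt_add_right h _
  | zero => rw [mul_zero]; exact Submodule.zero_mem _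
  | add x y _ _ hx hy => rw [mul_add]; exact Submodule.add_mem _ hx hy
  | smul a x _ hx => rw [mul_smul_comm]; exact Submodule.smul_mem _ _ hx

lemma mul_mem_belowSpan {d d' : ℕ} {E E' : ℕᵒᵈ →₀ ℕ} {x y : SymV L} (hx : x ∈ belowSpan φ d E)
    (hy : y ∈ belowSpan φ d' E') : x * y ∈ belowSpan φ (d + d') (E + E') := by
  induction hx using Submodule.span_induction with
  | mem x hx =>
    obtain ⟨G, rfl, h, rfl⟩ := hx
    refine belowSpan_mono φ ?_ (familyElt_mul_mem_belowSpan φ G hy)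
    rw [map_add, map_add]
    exact add_le_add_left h.le _
  | zero => rw [zero_mul]; exact Submodule.zero_mem _
  | add x y _ _ hx hy => rw [add_mul]; exact Submodule.add_mem _ hx hy
  | smul a x _ hx => rw [smul_mul_assoc]; exact Submodule.smul_mem _ _ hx

/-- If all weightings of degree `d` decompose, then the elements of degree `d` are combinations of
products of matchings whose leading exponents are not larger. -/
lemma exists_mem_belowSpan {d : ℕ} (hd : ∀ W : Weighting m d, ∃ F : Multiset (Weighting m 1),
    F.card = d ∧ totalExponent F = W.exponent) (E : ℕᵒᵈ →₀ ℕ) : ∀ f ∈ degreePiece L d,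
    (toPoly (number φ) f = 0 ∨ MonomialOrder.lex.toSyn (MonomialOrder.lex.degree
      (toPoly (number φ) f)) < MonomialOrder.lex.toSyn E) →
    ∃ p ∈ belowSpan φ d E, evalSym L p = f := by
  have hwf : WellFounded fun E E' : ℕᵒᵈ →₀ ℕ => MonomialOrder.lex.toSyn E <
    MonomialOrder.lex.toSyn E' := InvImage.wf _ wellFounded_lt
  induction E using hwf.induction with
  | _ E ih =>
    intro f hf hE
    by_cases h0 : f = 0
    · exact ⟨0, Submodule.zero_mem _, by rw [map_zero, h0]⟩
    obtain ⟨hne, Γ, h1, h2, h3⟩ := exists_degree_eq (number_injective φ) hf h0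
    have hlt := hE.resolve_left hne
    obtain ⟨W, hW⟩ := exists_weighting (φ := φ) h2
    obtain ⟨F, rfl, hFW⟩ := hd W
    rw [← hW, ← hFW] at h3
    rw [h3] at hlt
    -- The leading exponent of `f` is that of a weighting, hence of a family. Subtracting `c` times
    -- this family lowers the exponent, and the induction continues.
    set c := MonomialOrder.lex.leadingCoeff (toPoly (number φ) f)
    obtain ⟨p, hp, hpf⟩ := ih (totalExponent F) hlt (f - c • evalSym L (familyElt φ F))
      (Submodule.sub_mem _ hf (Submodule.smul_mem _ _ (evalSym_familyElt_mem φ F))) (by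
        rw [map_sub, map_zsmul]
        exact HasLead.sub_smul h3 (hasLead_familyElt φ F))
    refine ⟨p + c • familyElt φ F, Submodule.add_mem _ (belowSpan_mono φ hlt.le hp)
      (Submodule.smul_mem _ _ (Submodule.subset_span ⟨F, rfl, hlt, rfl⟩)), ?_⟩
    rw [map_add, hpf, map_zsmul, sub_add_cancel]

lemma exists_decomposition_one (W : Weighting m 1) : ∃ F : Multiset (Weighting m 1),
    F.card = 1 ∧ totalExponent F = W.exponent := ⟨{W}, by simp, by simp [totalExponent]⟩

lemma exists_decomposition_two (W : Weighting m 2) : ∃ F : Multiset (Weighting m 1),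
    F.card = 2 ∧ totalExponent F = W.exponent := by
  obtain ⟨P, Q, ht, hs, -⟩ := exists_balanced_add W
  refine ⟨{P, Q}, by simp, ?_⟩
  have hW : P.add Q = W := Weighting.ext (funext ht) (funext hs)
  rw [← hW, exponent_add]
  simp [totalExponent]

/-- Elements with the leading monomial of a family are expressed by this family and smaller ones. -/
lemma exists_evalSym_familyElt_add_eq {F : Multiset (Weighting m 1)}
    (hd : ∀ W : Weighting m F.card, ∃ G : Multiset (Weighting m 1),
      G.card = F.card ∧ totalExponent G = W.exponent) {f : GraphRing L}
    (hf : f ∈ degreePiece L F.card)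
    (hl : HasLead (toPoly (number φ) f) (totalExponent F)) :
    ∃ p ∈ belowSpan φ F.card (totalExponent F), evalSym L (familyElt φ F + p) = f := by
  obtain ⟨p, hp, hpf⟩ := exists_mem_belowSpan φ hd (totalExponent F)
    (f - evalSym L (familyElt φ F)) (Submodule.sub_mem _ hf (evalSym_familyElt_mem φ F)) (by
      rw [map_sub]
      exact hl.sub (hasLead_familyElt φ F))
  exact ⟨p, hp, by rw [map_add, hpf, add_sub_cancel]⟩

/-- The families have the same leading exponent and agree modulo an ideal and families of smaller
leading exponent. -/
def FamilyRel (J : Ideal (SymV L)) (F G : Multiset (Weighting m 1)) : Prop :=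
  F.card = G.card ∧ totalExponent F = totalExponent G ∧ familyElt φ F - familyElt φ G ∈
    J.restrictScalars ℤ ⊔ belowSpan φ F.card (totalExponent F)

variable {φ} {J : Ideal (SymV L)}

lemma FamilyRel.refl (F : Multiset (Weighting m 1)) : FamilyRel φ J F F :=
  ⟨rfl, rfl, by rw [sub_self]; exact Submodule.zero_mem _⟩

lemma FamilyRel.symm {F G : Multiset (Weighting m 1)} (h : FamilyRel φ J F G) :
    FamilyRel φ J G F :=
  ⟨h.1.symm, h.2.1.symm, by
    rw [← h.1, ← h.2.1, ← neg_sub]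
    exact Submodule.neg_mem _ h.2.2⟩

lemma FamilyRel.trans {F G H : Multiset (Weighting m 1)} (h : FamilyRel φ J F G)
    (h' : FamilyRel φ J G H) : FamilyRel φ J F H :=
  ⟨h.1.trans h'.1, h.2.1.trans h'.2.1, by
    have := h'.2.2
    rw [← h.1, ← h.2.1] at this
    rw [← sub_add_sub_cancel]
    exact Submodule.add_mem _ h.2.2 this⟩

lemma FamilyRel.cons {F G : Multiset (Weighting m 1)} (h : FamilyRel φ J F G)
    (P : Weighting m 1) : FamilyRel φ J (P ::ₘ F) (P ::ₘ G) := by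
  obtain ⟨h1, h2, h3⟩ := h
  refine ⟨by rw [Multiset.card_cons, Multiset.card_cons, h1],
    by rw [totalExponent_cons, totalExponent_cons, h2], ?_⟩
  obtain ⟨j, hj, x, hx, hjx⟩ := Submodule.mem_sup.mp h3
  have h4 : familyElt φ (P ::ₘ F) - familyElt φ (P ::ₘ G) =
      matchingElt (pathMatching φ P) * j + familyElt φ {P} * x := by
    rw [familyElt_cons, familyElt_cons, ← mul_sub, ← hjx, mul_add]
    simp [familyElt]
  rw [h4]
  refine Submodule.add_mem_sup (J.mul_mem_left _ hj) ?_
  have := familyElt_mul_mem_belowSpan φ {P} hx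
  rw [Multiset.card_singleton, add_comm 1] at this
  rw [Multiset.card_cons, totalExponent_cons]
  simpa [totalExponent] using this

lemma FamilyRel.add {F G : Multiset (Weighting m 1)} (h : FamilyRel φ J F G)
    (H : Multiset (Weighting m 1)) : FamilyRel φ J (F + H) (G + H) := by
  induction H using Multiset.induction with
  | empty => simpa using h
  | cons P H ih =>
    rw [Multiset.add_cons, Multiset.add_cons]
    exact ih.cons P

/-- Pairs with the same sum agree modulo the quadratic relations and smaller pairs. -/
lemma FamilyRel.of_pair (hJ : relationsOfDegree L 2 ⊆ J) {P Q P' Q' : Weighting m 1}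
    (h : P.add Q = P'.add Q') : FamilyRel φ J {P, Q} {P', Q'} := by
  have hE : totalExponent {P, Q} = totalExponent {P', Q'} := by
    have := congrArg Weighting.exponent h
    rw [exponent_add, exponent_add] at this
    simpa [totalExponent] using this
  obtain ⟨p, hp, hpf⟩ := exists_evalSym_familyElt_add_eq φ (F := {P', Q'})
    exists_decomposition_two (f := evalSym L (familyElt φ {P, Q})) (evalSym_familyElt_mem φ {P, Q})
    (by rw [← hE]; exact hasLead_familyElt φ {P, Q})
  refine ⟨rfl, hE, ?_⟩
  rw [hE]
  have h1 : familyElt φ {P, Q} - familyElt φ {P', Q'} =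
      (familyElt φ {P, Q} - (familyElt φ {P', Q'} + p)) + p := by ring
  rw [h1]
  -- The first summand evaluates to zero and has degree two, so it is a quadratic relation; the
  -- correction `p` consists of smaller pairs.
  refine Submodule.add_mem_sup (hJ ⟨?_, ?_⟩) hp
  · rw [mem_relationIdeal, map_sub, hpf, sub_self]
  · exact Submodule.sub_mem _ (familyElt_mem_symPiece φ {P, Q}) (Submodule.add_mem _
      (familyElt_mem_symPiece φ {P', Q'}) (belowSpan_le_symPiece φ _ _ hp))

end Families

end PointsOnLine

end

/-! ### The Segre datum attached to a node of the spine. -/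

noncomputable section

namespace PointsOnLine

open MvPolynomial MonomialOrder Weighting

variable {L : Type*}

lemma joins_mk {A B : Finset L} (e : L × L) :
    Joins A B s(e.1, e.2) ↔ (e.1 ∈ A ∧ e.2 ∈ B) ∨ (e.2 ∈ A ∧ e.1 ∈ B) := by
  constructor
  · rintro ⟨a, ha, b, hb, h⟩
    rcases Sym2.eq_iff.mp h with ⟨h1, h2⟩ | ⟨h1, h2⟩
    · exact Or.inl ⟨h1 ▸ ha, h2 ▸ hb⟩
    · exact Or.inr ⟨h2 ▸ ha, h1 ▸ hb⟩
  · rintro (⟨h1, h2⟩ | ⟨h1, h2⟩)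
    · exact ⟨_, h1, _, h2, rfl⟩
    · exact ⟨_, h1, _, h2, Sym2.eq_swap⟩

lemma countP_joins_underlying [DecidableEq L] (Γ : DirGraph L) (A B : Finset L) :
    (underlying Γ).countP (Joins A B) =
      Γ.countP fun e => (e.1 ∈ A ∧ e.2 ∈ B) ∨ (e.2 ∈ A ∧ e.1 ∈ B) := by
  rw [underlying, Multiset.countP_map, ← Multiset.countP_eq_card_filter]
  exact Multiset.countP_congr rfl fun e _ => propext (joins_mk e)

variable {m : ℕ} (φ : L ≃ Fin (2 * m)) [Fintype L]

/-- The three parts into which a node of the spine divides the vertices. -/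
def nodePart (i : ℕ) : Color → Finset L
  | .red => Finset.univ.filter fun u => number φ u / 2 < i
  | .green => Finset.univ.filter fun u => i < number φ u / 2
  | .blue => Finset.univ.filter fun u => number φ u / 2 = i

lemma mem_nodePart_red {i : ℕ} {u : L} : u ∈ nodePart φ i .red ↔ number φ u / 2 < i := by
  simp [nodePart]

lemma mem_nodePart_green {i : ℕ} {u : L} : u ∈ nodePart φ i .green ↔ i < number φ u / 2 := by
  simp [nodePart]

lemma mem_nodePart_blue {i : ℕ} {u : L} : u ∈ nodePart φ i .blue ↔ number φ u / 2 = i := by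
  simp [nodePart]

variable [DecidableEq L]

lemma card_nodePart_blue {i : ℕ} (hi : i < m) : (nodePart φ i .blue).card = 2 := by
  obtain ⟨a, ha⟩ := exists_number_eq φ (i := 2 * i) (by omega)
  obtain ⟨b, hb⟩ := exists_number_eq φ (i := 2 * i + 1) (by omega)
  have hab : a ≠ b := by rintro rfl; omega
  have : nodePart φ i .blue = {a, b} := by
    ext u
    rw [mem_nodePart_blue, Finset.mem_insert, Finset.mem_singleton,
      ← (number_injective φ).eq_iff, ← (number_injective φ).eq_iff, ha, hb]
    omega
  rw [this, Finset.card_pair hab]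

/-- A set defined by the index of the pair is a union of whole pairs. -/
lemma even_card_filter (p : ℕ → Prop) [DecidablePred p] :
    Even (Finset.univ.filter fun u => p (number φ u / 2)).card := by
  rw [Finset.card_eq_sum_card_fiberwise (f := fun u => number φ u / 2) (t := Finset.range m)]
  · refine Finset.even_sum _ fun i hi => ?_
    rw [Finset.mem_range] at hi
    by_cases h : p i
    · have : (Finset.univ.filter fun u => p (number φ u / 2)).filter
          (fun u => number φ u / 2 = i) = nodePart φ i .blue := by
        ext u
        simp only [Finset.mem_filter, Finset.mem_univ, true_and, mem_nodePart_blue]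
        exact ⟨fun h => h.2, fun h' => ⟨h'.symm ▸ h, h'⟩⟩
      rw [this, card_nodePart_blue φ hi]
      exact even_two
    · have : (Finset.univ.filter fun u => p (number φ u / 2)).filter
          (fun u => number φ u / 2 = i) = ∅ := by
        ext u
        simp only [Finset.mem_filter, Finset.mem_univ, true_and, Finset.notMem_empty, iff_false]
        rintro ⟨h1, rfl⟩
        exact h h1
      rw [this, Finset.card_empty]
      exact Even.zero
  · intro u _
    have := number_lt φ u
    simp only [Finset.coe_range, Set.mem_Iio]
    omega

/-- The number of edges between the parts is given by the counts at the node. -/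
lemma countP_joins_nodePart (Γ : DirGraph L) (i : ℕ) :
    (∀ c c', (c = .red ∧ c' = .blue ∨ c = .blue ∧ c' = .red) →
      (underlying Γ).countP (Joins (nodePart φ i c) (nodePart φ i c')) =
        leftCount (number φ) Γ i) ∧
    (∀ c c', (c = .green ∧ c' = .blue ∨ c = .blue ∧ c' = .green) →
      (underlying Γ).countP (Joins (nodePart φ i c) (nodePart φ i c')) =
        rightCount (number φ) Γ i) ∧
    ∀ c c', (c = .red ∧ c' = .green ∨ c = .green ∧ c' = .red) →
      (underlying Γ).countP (Joins (nodePart φ i c) (nodePart φ i c')) =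
        overCount (number φ) Γ i := by
  refine ⟨?_, ?_, ?_⟩ <;>
  · rintro c c' (⟨rfl, rfl⟩ | ⟨rfl, rfl⟩) <;>
    · rw [countP_joins_underlying]
      refine Multiset.countP_congr rfl fun e _ => propext ?_
      simp only [mem_nodePart_red, mem_nodePart_green, mem_nodePart_blue] <;> omega

/-- The counts at a node which has the weights of the given color of a Segre move. -/
def HasNode (Γ : DirGraph L) (i : ℕ) (d : Color) : Prop :=
  ∀ c c', c ≠ c' → ((d = c ∨ d = c') →
    (underlying Γ).countP (Joins (nodePart φ i c) (nodePart φ i c')) = 0) ∧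
    (d ≠ c → d ≠ c' →
      (underlying Γ).countP (Joins (nodePart φ i c) (nodePart φ i c')) = 2)

lemma hasNode_of_counts {Γ : DirGraph L} {i : ℕ} (d : Color)
    (h1 : leftCount (number φ) Γ i = match d with | .green => 2 | _ => 0)
    (h2 : rightCount (number φ) Γ i = match d with | .red => 2 | _ => 0)
    (h3 : overCount (number φ) Γ i = match d with | .blue => 2 | _ => 0) :
    HasNode φ Γ i d := by
  obtain ⟨k1, k2, k3⟩ := countP_joins_nodePart φ Γ i
  intro c c' hne
  rw [h1] at k1
  rw [h2] at k2
  rw [h3] at k3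
  cases c <;> cases c' <;> cases d <;> simp_all

/-- The Segre datum given by three matchings with the weights of a Segre move at a node. -/
def nodeDatum (i : ℕ) (hi : 0 < i) (him : i + 1 < m) (M : Color → DirMatching L)
    (hM : ∀ d, HasNode φ (M d).1 i d) : SegreDatum L where
  graph c := underlying (M c).1
  part := nodePart φ i
  part_nonempty c := by
    cases c
    · obtain ⟨u, hu⟩ := exists_number_eq φ (i := 0) (by omega)
      exact ⟨u, (mem_nodePart_red φ).mpr (by omega)⟩
    · obtain ⟨u, hu⟩ := exists_number_eq φ (i := 2 * (i + 1)) (by omega)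
      exact ⟨u, (mem_nodePart_green φ).mpr (by omega)⟩
    · obtain ⟨u, hu⟩ := exists_number_eq φ (i := 2 * i) (by omega)
      exact ⟨u, (mem_nodePart_blue φ).mpr (by omega)⟩
  part_even c := by
    cases c
    · exact even_card_filter φ fun k => k < i
    · exact even_card_filter φ fun k => i < k
    · exact even_card_filter φ fun k => k = i
  part_disjoint c c' h := by
    rw [Finset.disjoint_left]
    intro u h1 h2
    cases c <;> cases c' <;> simp only [mem_nodePart_red, mem_nodePart_green,
      mem_nodePart_blue, ne_eq, not_true_eq_false] at h h1 h2 <;> omega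
  part_cover v := by
    rcases lt_trichotomy (number φ v / 2) i with h | h | h
    · exact ⟨.red, (mem_nodePart_red φ).mpr h⟩
    · exact ⟨.blue, (mem_nodePart_blue φ).mpr h⟩
    · exact ⟨.green, (mem_nodePart_green φ).mpr h⟩
  regular c := (M c).2
  special_count c c' h := by
    -- Any two parts are joined by exactly two edges, all coming from the matching colored by the
    -- remaining part.
    right
    rw [Multiset.countP_add, Multiset.countP_add]
    have h1 := hM .red c c' h
    have h2 := hM .green c c' h
    have h3 := hM .blue c c' h
    cases c <;> cases c' <;> simp_all
  special_color c c' h d e he hJ := by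
    by_contra hd
    have h1 := (hM d c c' h).1 (by tauto)
    exact Multiset.countP_eq_zero.mp h1 e he hJ

/-- The directed graph defining the datum. -/
def nodeDirecting (i : ℕ) (hi : 0 < i) (him : i + 1 < m) (M : Color → DirMatching L)
    (hM : ∀ d, HasNode φ (M d).1 i d) : Directing (nodeDatum φ i hi him M hM) where
  edges c := (M c).1
  underlying_edges _ := rfl

lemma Directing.black_add_purple {S : SegreDatum L} (D : Directing S) :
    D.black + D.purple = D.edges .red + D.edges .green + D.edges .blue := by
  have h : ∀ c, D.inside c + D.outside c = D.edges c := fun c => Multiset.filter_add_not _ _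
  rw [← h .red, ← h .green, ← h .blue, Directing.black, Directing.purple]
  abel

lemma Directing.purple_regular {S : SegreDatum L} (D : Directing S) :
    IsRegularOfDeg (underlying D.purple) 2 := by
  intro v
  have h1 : ∀ c, valence (underlying (D.edges c)) v = 1 := fun c => by
    rw [D.underlying_edges]; exact S.regular c v
  have h2 := congrArg (fun Γ => valence (underlying Γ) v) D.black_add_purple
  simp only [underlying_add, valence_add, h1] at h2
  have h3 : valence (underlying D.black) v = 1 := D.blackMatching.2 v
  omega

end PointsOnLine

end

/-! ### Segre moves from small Segre relations, and the conclusion. -/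

noncomputable section

namespace PointsOnLine

open MvPolynomial MonomialOrder Weighting

variable {L : Type*}

section Black

variable {m : ℕ} (φ : L ≃ Fin (2 * m))

lemma insideCount_add (ρ : L → ℕ) (Γ Δ : DirGraph L) (k : ℕ) :
    insideCount ρ (Γ + Δ) k = insideCount ρ Γ k + insideCount ρ Δ k :=
  Multiset.countP_add _ _ _

lemma leftCount_add (ρ : L → ℕ) (Γ Δ : DirGraph L) (k : ℕ) :
    leftCount ρ (Γ + Δ) k = leftCount ρ Γ k + leftCount ρ Δ k :=
  Multiset.countP_add _ _ _

variable [Fintype L] [DecidableEq L]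

/-- The edges of a graph inside one of the parts of a node. -/
def insidePart (Γ : DirGraph L) (i : ℕ) (c : Color) : DirGraph L :=
  Γ.filter fun e => e.1 ∈ nodePart φ i c ∧ e.2 ∈ nodePart φ i c

lemma insideCount_insidePart (Γ : DirGraph L) (i k : ℕ) :
    insideCount (number φ) (insidePart φ Γ i .red) k =
      (if k < i then insideCount (number φ) Γ k else 0) ∧
    insideCount (number φ) (insidePart φ Γ i .green) k =
      (if i < k then insideCount (number φ) Γ k else 0) ∧
    insideCount (number φ) (insidePart φ Γ i .blue) k =
      if k = i then insideCount (number φ) Γ k else 0 := by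
  simp only [insideCount, insidePart, Multiset.countP_filter, mem_nodePart_red,
    mem_nodePart_green, mem_nodePart_blue]
  refine ⟨?_, ?_, ?_⟩ <;>
  · split_ifs
    · exact Multiset.countP_congr rfl fun e _ => propext (by omega)
    · exact Multiset.countP_eq_zero.mpr fun e _ => by omega

/-- Restriction to the left part loses no edges whose right end lies there. For the right part this
needs the hypothesis that no edge crosses the spine behind the `i`-th pair; the matching of `P₂`
satisfies it. -/
lemma leftCount_insidePart (Γ : DirGraph L) (i k : ℕ) :
    leftCount (number φ) (insidePart φ Γ i .red) k =
      (if k < i then leftCount (number φ) Γ k else 0) ∧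
    (crossCount (number φ) Γ (i + 1) = 0 →
      leftCount (number φ) (insidePart φ Γ i .green) k =
      (if i < k then leftCount (number φ) Γ k else 0)) ∧
    leftCount (number φ) (insidePart φ Γ i .blue) k = 0 := by
  simp only [leftCount, insidePart, crossCount, Multiset.countP_filter, mem_nodePart_red,
    mem_nodePart_green, mem_nodePart_blue]
  refine ⟨?_, fun h => ?_, ?_⟩
  · split_ifs
    · exact Multiset.countP_congr rfl fun e _ => propext (by omega)
    · exact Multiset.countP_eq_zero.mpr fun e _ => by omega
  · split_ifs
    · refine Multiset.countP_congr rfl fun e he => propext ?_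
      have := Multiset.countP_eq_zero.mp h e he
      omega
    · exact Multiset.countP_eq_zero.mpr fun e _ => by omega
  · exact Multiset.countP_eq_zero.mpr fun e _ => by omega

/-- The leading exponent of the black graph of a Segre move. -/
lemma graphExponent_black {i : ℕ} {P₁ P₂ P₃ A : Weighting m 1} (h₁ : node i P₁ = (0, 1, 1))
    (h₂ : node i P₂ = (1, 1, 0)) (h₃ : node i P₃ = (1, 0, 1)) (hA : IsSplice i 0 P₁ P₂ A) :
    graphExponent (number φ) (insidePart φ (pathMatching φ P₁).1 i .red +
      insidePart φ (pathMatching φ P₂).1 i .green +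
      insidePart φ (pathMatching φ P₃).1 i .blue) = A.exponent := by
  simp only [node, Prod.mk.injEq] at h₁ h₂ h₃
  have hcross : crossCount (number φ) (pathMatching φ P₂).1 (i + 1) = 0 := by
    rw [(crossCount_eq_of_exponent (pathMatching φ P₂).2 (graphExponent_pathMatching φ P₂)
      (i + 1)).1, h₂.2.2]
  have hP : ∀ (P : Weighting m 1) k, k < m →
      insideCount (number φ) (pathMatching φ P).1 k + P.s k = 1 ∧
      leftCount (number φ) (pathMatching φ P).1 k + P.t (k + 1) = P.s k + P.t k := by
    intro P k hk
    rw [← graphExponent_loopVar, ← graphExponent_rightVar]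
    exact ((P.exponent_eq_iff _).mp (graphExponent_pathMatching φ P).symm).1 k hk
  refine ((A.exponent_eq_iff _).mpr ⟨fun k hk => ?_, fun k hk => ?_⟩).symm
  · rw [graphExponent_loopVar, graphExponent_rightVar, insideCount_add, insideCount_add,
      leftCount_add, leftCount_add]
    simp only [(insideCount_insidePart φ _ i k).1, (insideCount_insidePart φ _ i k).2.1,
      (insideCount_insidePart φ _ i k).2.2, (leftCount_insidePart φ _ i k).1,
      (leftCount_insidePart φ _ i k).2.1 hcross, (leftCount_insidePart φ _ i k).2.2]
    have k1 := hP P₁ k hk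
    have k2 := hP P₂ k hk
    have k3 := hP P₃ k hk
    rcases lt_trichotomy k i with h | rfl | h
    · rw [if_pos h, if_neg (by omega), if_neg (by omega), if_pos h, if_neg (by omega),
        hA.s_lt k h, hA.t_le k h.le, hA.t_le (k + 1) h]
      omega
    · rw [if_neg (by omega), if_neg (by omega), if_pos rfl, if_neg (by omega), if_neg (by omega),
        hA.s_eq, hA.t_le k le_rfl, hA.t_gt (k + 1) (by omega)]
      omega
    · rw [if_neg (by omega), if_pos h, if_neg (by omega), if_neg (by omega), if_pos h,
        hA.s_gt k h, hA.t_gt k h, hA.t_gt (k + 1) (by omega)]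
      omega
  · rw [graphExponent_loopVar, graphExponent_rightVar]
    have := count_eq_zero_of_le (φ := φ) (insidePart φ (pathMatching φ P₁).1 i .red +
      insidePart φ (pathMatching φ P₂).1 i .green +
      insidePart φ (pathMatching φ P₃).1 i .blue) hk
    exact ⟨this.1, this.2.1⟩

end Black

section Segre

variable [DecidableEq L] {m : ℕ} (φ : L ≃ Fin (2 * m))

lemma totalExponent_triple (P Q R : Weighting m 1) :
    totalExponent {P, Q, R} = ((P.add Q).add R).exponent := by
  rw [exponent_add, exponent_add]
  simp [totalExponent, add_assoc]

lemma familyElt_triple (P Q R : Weighting m 1) : familyElt φ {P, Q, R} =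
    matchingElt (pathMatching φ P) * matchingElt (pathMatching φ Q) *
      matchingElt (pathMatching φ R) := by
  simp [familyElt, mul_assoc]

/-- The chosen matchings already span `V_L`, by the reduction in degree one, and their products
therefore span the symmetric algebra. -/
lemma mem_span_familyElt (x : SymV L) :
    x ∈ Submodule.span ℤ (Set.range (familyElt φ)) := by
  induction x using SymmetricAlgebra.induction with
  | algebraMap r =>
    rw [Algebra.algebraMap_eq_smul_one, ← familyElt_zero φ]
    exact Submodule.smul_mem _ _ (Submodule.subset_span ⟨0, rfl⟩)
  | ι v =>
    by_cases h0 : (v : GraphRing L) = 0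
    · rw [Subtype.ext h0 (a2 := (0 : degreeOne L)), map_zero]
      exact Submodule.zero_mem _
    · obtain ⟨-, Γ, h1, h2, h3⟩ := exists_degree_eq (number_injective φ) v.2 h0
      obtain ⟨E, hE⟩ : ∃ E : ℕᵒᵈ →₀ ℕ, MonomialOrder.lex.toSyn (MonomialOrder.lex.degree
          (toPoly (number φ) (v : GraphRing L))) < MonomialOrder.lex.toSyn E := by
        refine ⟨MonomialOrder.lex.degree (toPoly (number φ) (v : GraphRing L)) +
          Finsupp.single (loopVar 0) 1, ?_⟩
        rw [map_add]
        refine lt_add_of_pos_right _ ?_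
        rw [toSyn_lt_iff_ne_zero, ne_eq, toSyn_eq_zero_iff]
        simp
      obtain ⟨p, hp, hpv⟩ := exists_mem_belowSpan φ exists_decomposition_one E _ v.2 (Or.inr hE)
      have : SymmetricAlgebra.ι ℤ (degreeOne L) v = p :=
        eq_of_evalSym_eq (ι_mem_symPiece v) (belowSpan_le_symPiece φ _ _ hp)
          ((evalSym_ι v).trans hpv.symm)
      rw [this]
      refine Submodule.span_mono ?_ hp
      rintro _ ⟨F, -, -, rfl⟩
      exact ⟨F, rfl⟩
  | add a b ha hb => exact Submodule.add_mem _ ha hb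
  | mul a b ha hb =>
    have h := Submodule.mul_mem_mul ha hb
    rw [Submodule.span_mul_span] at h
    refine Submodule.span_mono ?_ h
    rintro _ ⟨_, ⟨F, rfl⟩, _, ⟨G, rfl⟩, rfl⟩
    exact ⟨F + G, familyElt_add φ F G⟩

variable [Fintype L]

/-- The total exponent is preserved by a Segre move. -/
lemma totalExponent_segre {i : ℕ} {P₁ P₂ P₃ A B C : Weighting m 1} (h₁ : node i P₁ = (0, 1, 1))
    (h₂ : node i P₂ = (1, 1, 0)) (h₃ : node i P₃ = (1, 0, 1)) (hA : IsSplice i 0 P₁ P₂ A)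
    (hB : IsSplice i 1 P₂ P₁ B) (hC : IsSplice i 1 P₃ P₃ C) :
    totalExponent {P₁, P₂, P₃} = totalExponent {A, B, C} := by
  simp only [node, Prod.mk.injEq] at h₁ h₂ h₃
  rw [totalExponent_triple, totalExponent_triple]
  congr 1
  refine Weighting.ext (funext fun k => ?_) (funext fun k => ?_)
  · dsimp only [Weighting.add]
    rw [hA.t_add hB k, hC.t_self k]
  · dsimp only [Weighting.add]
    rcases lt_trichotomy k i with h | rfl | h
    · rw [hA.s_lt k h, hB.s_lt k h, hC.s_lt k h]
    · rw [hA.s_eq, hB.s_eq, hC.s_eq]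
      omega
    · rw [hA.s_gt k h, hB.s_gt k h, hC.s_gt k h]
      omega

/-- The numbers of edges between the three parts are determined by their pairwise sums, which are
twice the weights at the node. -/
lemma hasNode_pathMatching {i : ℕ} {P₁ P₂ P₃ : Weighting m 1} (h₁ : node i P₁ = (0, 1, 1))
    (h₂ : node i P₂ = (1, 1, 0)) (h₃ : node i P₃ = (1, 0, 1)) :
    HasNode φ (pathMatching φ P₁).1 i .red ∧ HasNode φ (pathMatching φ P₂).1 i .green ∧
      HasNode φ (pathMatching φ P₃).1 i .blue := by
  simp only [node, Prod.mk.injEq] at h₁ h₂ h₃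
  have hcount : ∀ P : Weighting m 1, leftCount (number φ) (pathMatching φ P).1 i +
      overCount (number φ) (pathMatching φ P).1 i = 2 * P.t i ∧
      rightCount (number φ) (pathMatching φ P).1 i +
      overCount (number φ) (pathMatching φ P).1 i = 2 * P.t (i + 1) ∧
      leftCount (number φ) (pathMatching φ P).1 i +
      rightCount (number φ) (pathMatching φ P).1 i = 2 * P.s i := by
    intro P
    have h := crossCount_eq_of_exponent (pathMatching φ P).2 (graphExponent_pathMatching φ P)
    rw [← crossCount_eq, ← crossCount_succ_eq]
    exact ⟨(h i).1, (h (i + 1)).1, (h i).2⟩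
  have c1 := hcount P₁
  have c2 := hcount P₂
  have c3 := hcount P₃
  refine ⟨?_, ?_, ?_⟩ <;> refine hasNode_of_counts φ _ ?_ ?_ ?_ <;> dsimp only <;> omega

/-- The small generalized Segre relation of a directed datum, without its sign. -/
lemma sub_mem_of_smallSegreRelations {ε : Orientation L} {J : Ideal (SymV L)}
    (hJ : smallSegreRelations ε ⊆ J) {S : SegreDatum L} (hS : S.IsSmall) (D : Directing S)
    {q : SymV L} (hq : q ∈ symPiece L 2) (hqe : evalSym L q = graphElt D.purple) :
    matchingElt (D.matching .red) * matchingElt (D.matching .green) *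
      matchingElt (D.matching .blue) - matchingElt D.blackMatching * q ∈ J := by
  have h3 : matchingElt (D.matching .red) * matchingElt (D.matching .green) *
      matchingElt (D.matching .blue) ∈ symPiece L 3 :=
    mul_mem_symPiece (mul_mem_symPiece (ι_mem_symPiece _) (ι_mem_symPiece _)) (ι_mem_symPiece _)
  have h4 : matchingElt D.blackMatching * q ∈ symPiece L 3 :=
    mul_mem_symPiece (ι_mem_symPiece _) hq
  generalize hx : matchingElt (D.matching .red) * matchingElt (D.matching .green) *
      matchingElt (D.matching .blue) = x at *
  generalize hy : matchingElt D.blackMatching * q = y at *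
  have h5 : ((D.sign ε : ℤˣ) : ℤ) • x - ((D.sign ε : ℤˣ) : ℤ) • y ∈ J := by
    refine hJ ⟨S, hS, Submodule.sub_mem _ (Submodule.smul_mem _ _ h3) (Submodule.smul_mem _ _ h4),
      D, q, hq, hqe, ?_⟩
    rw [hx, hy, sub_self]
    exact Ideal.zero_mem _
  -- The orientation sign squares to one, so it can be removed inside an ideal.
  have h6 : x - y = ((D.sign ε : ℤˣ) : ℤ) •
      (((D.sign ε : ℤˣ) : ℤ) • x - ((D.sign ε : ℤˣ) : ℤ) • y) := by
    rw [← smul_sub, smul_smul, ← Units.val_mul, Int.units_mul_self, Units.val_one, one_smul]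
  rw [h6]
  exact zsmul_mem h5 _

/-- A datum whose matchings and whose black graph have given exponents yields a relation between
families. -/
lemma FamilyRel.of_directing {ε : Orientation L} {J : Ideal (SymV L)}
    (hJ : smallSegreRelations ε ⊆ J) {S : SegreDatum L} (hS : S.IsSmall) (D : Directing S)
    {P₁ P₂ P₃ A B C : Weighting m 1} (h₁ : D.matching .red = pathMatching φ P₁)
    (h₂ : D.matching .green = pathMatching φ P₂) (h₃ : D.matching .blue = pathMatching φ P₃)
    (hA : graphExponent (number φ) D.black = A.exponent)
    (hE : totalExponent {P₁, P₂, P₃} = totalExponent {A, B, C}) :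
    FamilyRel φ J {P₁, P₂, P₃} {A, B, C} := by
  have hall : D.black + D.purple = (pathMatching φ P₁).1 + (pathMatching φ P₂).1 +
      (pathMatching φ P₃).1 := by
    rw [← h₁, ← h₂, ← h₃]
    exact D.black_add_purple
  have hdesc : IsDescending (number φ) (D.black + D.purple) := by
    rw [hall]
    intro e he
    rcases Multiset.mem_add.mp he with he | he
    · rcases Multiset.mem_add.mp he with he | he
      · exact pathMatching_isDescending φ _ e he
      · exact pathMatching_isDescending φ _ e he
    · exact pathMatching_isDescending φ _ e he
  have hEblack : graphExponent (number φ) D.black = totalExponent {A} := by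
    rw [hA]
    simp [totalExponent]
  have hsum : totalExponent {A, B, C} = totalExponent {A} + totalExponent {B, C} :=
    by simp [totalExponent]
  -- Black and purple edges together are the edges of the three matchings, so the purple exponent is
  -- found by cancelling the black one.
  have hEpurple : graphExponent (number φ) D.purple = totalExponent {B, C} := by
    have h4 := congrArg (graphExponent (number φ)) hall
    rw [graphExponent_add, graphExponent_add, graphExponent_add, graphExponent_pathMatching,
      graphExponent_pathMatching, graphExponent_pathMatching, hEblack] at h4
    have h5 : totalExponent {P₁, P₂, P₃} = P₁.exponent + P₂.exponent + P₃.exponent := by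
      simp [totalExponent, add_assoc]
    rw [← h5, hE, hsum] at h4
    exact add_left_cancel h4
  obtain ⟨p, hp, hpe⟩ := exists_evalSym_familyElt_add_eq φ (F := {A}) exists_decomposition_one
    (f := graphElt D.black) (graphElt_mem_degreePiece D.blackMatching.2) (by
      rw [← hEblack]
      exact hasLead_graphElt fun e he => hdesc e (Multiset.mem_add.mpr (Or.inl he)))
  obtain ⟨q, hq, hqe⟩ := exists_evalSym_familyElt_add_eq φ (F := {B, C}) exists_decomposition_two
    (f := graphElt D.purple) (graphElt_mem_degreePiece D.purple_regular) (by
      rw [← hEpurple]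
      exact hasLead_graphElt fun e he => hdesc e (Multiset.mem_add.mpr (Or.inr he)))
  -- In degree one, equality after evaluation is equality in `Sym(V_L)`.
  have hblackElt : matchingElt D.blackMatching = familyElt φ {A} + p := by
    refine eq_of_evalSym_eq (ι_mem_symPiece _) (Submodule.add_mem _
      (familyElt_mem_symPiece φ {A}) (belowSpan_le_symPiece φ _ _ hp)) ?_
    rw [evalSym_matchingElt, hpe]
    rfl
  have hrel := sub_mem_of_smallSegreRelations hJ hS D (q := familyElt φ {B, C} + q)
    (Submodule.add_mem _ (familyElt_mem_symPiece φ {B, C}) (belowSpan_le_symPiece φ _ _ hq)) hqe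
  rw [h₁, h₂, h₃, ← familyElt_triple, hblackElt] at hrel
  refine ⟨by simp, hE, ?_⟩
  -- The product of the expansions of the black and purple elements has top term the family of `A`,
  -- `B`, `C`. Each remaining product contains `p` or `q` and so is smaller.
  have hexp : familyElt φ {P₁, P₂, P₃} - familyElt φ {A, B, C} =
      (familyElt φ {P₁, P₂, P₃} - (familyElt φ {A} + p) * (familyElt φ {B, C} + q)) +
      (familyElt φ {A} * q + (familyElt φ {B, C} * p + p * q)) := by
    have : familyElt φ {A, B, C} = familyElt φ {A} * familyElt φ {B, C} := by simp [familyElt]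
    rw [this]
    ring
  have hcard : Multiset.card {P₁, P₂, P₃} = 1 + 2 := by simp
  have hcard₁ : Multiset.card {A} = 1 := Multiset.card_singleton A
  have hcard₂ : Multiset.card {B, C} = 2 := Multiset.card_pair B C
  have k₁ := familyElt_mul_mem_belowSpan φ {A} hq
  have k₂ := familyElt_mul_mem_belowSpan φ {B, C} hp
  have k₃ := mul_mem_belowSpan φ hp hq
  rw [hcard₁, hcard₂] at k₁ k₃
  rw [hcard₁, hcard₂, add_comm 2, add_comm (totalExponent {B, C})] at k₂
  rw [hexp, hE, hsum, hcard]
  exact Submodule.add_mem_sup hrel (Submodule.add_mem _ k₁ (Submodule.add_mem _ k₂ k₃))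

/-- A Segre move is realized by a small generalized Segre relation. -/
lemma FamilyRel.of_segre {ε : Orientation L} {J : Ideal (SymV L)}
    (hJ : smallSegreRelations ε ⊆ J) {i : ℕ}
    {P₁ P₂ P₃ A B C : Weighting m 1} (h₁ : node i P₁ = (0, 1, 1))
    (h₂ : node i P₂ = (1, 1, 0)) (h₃ : node i P₃ = (1, 0, 1)) (hA : IsSplice i 0 P₁ P₂ A)
    (hB : IsSplice i 1 P₂ P₁ B) (hC : IsSplice i 1 P₃ P₃ C) :
    FamilyRel φ J {P₁, P₂, P₃} {A, B, C} := by
  have hn₁ := h₁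
  have hn₂ := h₂
  simp only [node, Prod.mk.injEq] at hn₁ hn₂
  -- The weight 1 of `P₂` in front of the node and of `P₁` behind it show that the node is not at an
  -- end of the spine, so all three parts are non-empty.
  have hi : 0 < i := by
    by_contra h
    obtain rfl : i = 0 := by omega
    have := P₂.t_zero
    omega
  have him : i + 1 < m := P₁.lt_of_t_pos (by omega)
  let M : Color → DirMatching L
    | .red => pathMatching φ P₁
    | .green => pathMatching φ P₂
    | .blue => pathMatching φ P₃
  have hM : ∀ d, HasNode φ (M d).1 i d := by
    have h := hasNode_pathMatching φ h₁ h₂ h₃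
    intro d
    cases d
    · exact h.1
    · exact h.2.1
    · exact h.2.2
  exact FamilyRel.of_directing φ hJ ⟨.blue, card_nodePart_blue φ (by omega)⟩
    (nodeDirecting φ i hi him M hM) rfl rfl rfl (graphExponent_black φ h₁ h₂ h₃ hA)
    (totalExponent_segre h₁ h₂ h₃ hA hB hC)

/-- Modulo the quadratic relations and the small generalized Segre relations, a product of matchings
is determined by its leading exponent up to smaller products. -/
lemma familyRel_of_totalExponent_eq {ε : Orientation L} {J : Ideal (SymV L)}
    (hJ : relationsOfDegree L 2 ∪ smallSegreRelations ε ⊆ J) (hm : 0 < m)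
    {F G : Multiset (Weighting m 1)} (h : totalExponent F = totalExponent G) :
    FamilyRel φ J F G := by
  have hr : IsMoveRelation (FamilyRel φ J) :=
    { refl := .refl
      symm := fun _ _ => .symm
      trans := fun _ _ _ => .trans
      cons := fun P _ _ h => h.cons P
      exchange := fun P Q P' Q' F ht hs => by
        have h := (FamilyRel.of_pair (φ := φ) (Set.subset_union_left.trans hJ)
          (Weighting.ext (funext ht) (funext hs))).add F
        simpa only [Multiset.insert_eq_cons, Multiset.cons_add, Multiset.singleton_add] using h
      segre := fun i P₁ P₂ P₃ A B C F h₁ h₂ h₃ hA hB hC => by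
        have h := (FamilyRel.of_segre φ (Set.subset_union_right.trans hJ) h₁ h₂ h₃ hA hB hC).add F
        simpa only [Multiset.insert_eq_cons, Multiset.cons_add, Multiset.singleton_add] using h }
  obtain ⟨hc, ht, hs⟩ := sum_eq_of_totalExponent_eq hm h
  exact hr.of_sum_eq (fun F G hFG => sum_eq_of_totalExponent_eq hm hFG.2.1) hc ht hs

end Segre

section Main

variable [Fintype L] [DecidableEq L]

/-- Both terms of the relation evaluate to the product over all edges of the colored graph, the
second merely grouping them as black and purple. -/
lemma smallSegreRelations_subset (ε : Orientation L) :
    smallSegreRelations ε ⊆ relationIdeal L := by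
  rintro f ⟨S, -, -, D, q, -, hq, hf⟩
  have hquad : quadraticIdeal L ≤ relationIdeal L := Ideal.span_le.mpr fun _ h => h.1
  have h := hquad hf
  have hq' : evalSym L q = graphElt D.purple := hq
  rw [SetLike.mem_coe, mem_relationIdeal]
  rw [mem_relationIdeal, map_sub, map_sub, map_zsmul, map_zsmul, map_mul, map_mul, map_mul,
    evalSym_matchingElt, evalSym_matchingElt, evalSym_matchingElt, evalSym_matchingElt, hq'] at h
  have h1 : graphElt (D.matching .red).1 * graphElt (D.matching .green).1 *
      graphElt (D.matching .blue).1 = graphElt D.blackMatching.1 * graphElt D.purple := by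
    rw [← graphElt_add, ← graphElt_add, ← graphElt_add]
    exact congrArg graphElt D.black_add_purple.symm
  rwa [h1, sub_self, sub_zero] at h

/-- Modulo `J`, one family for each total exponent spans `Sym(V_L)`. Their images have distinct
monic leading monomials, so a combination of them that evaluates to zero is trivial. -/
lemma relationIdeal_le {m : ℕ} (φ : L ≃ Fin (2 * m)) (hm : 0 < m) {ε : Orientation L}
    {J : Ideal (SymV L)} (hJ : relationsOfDegree L 2 ∪ smallSegreRelations ε ⊆ J)
    (hJI : J ≤ relationIdeal L) : relationIdeal L ≤ J := by
  let B : Set (ℕᵒᵈ →₀ ℕ) := Set.range (totalExponent (m := m))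
  have hB : ∀ E : B, ∃ F : Multiset (Weighting m 1), totalExponent F = E := fun E => E.2
  choose g hg using hB
  let N : Submodule ℤ (SymV L) := J.restrictScalars ℤ ⊔
    Submodule.span ℤ (Set.range fun E : B => familyElt φ (g E))
  have hwf : WellFounded fun E E' : ℕᵒᵈ →₀ ℕ => MonomialOrder.lex.toSyn E <
    MonomialOrder.lex.toSyn E' := InvImage.wf _ wellFounded_lt
  -- Induction along the monomial order: a family equals the chosen one of its exponent modulo `J`
  -- and families of smaller exponent.
  have hfam : ∀ E : ℕᵒᵈ →₀ ℕ, ∀ F : Multiset (Weighting m 1), totalExponent F = E →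
      familyElt φ F ∈ N := by
    intro E
    induction E using hwf.induction with
    | _ E ih =>
      rintro F rfl
      let E' : B := ⟨totalExponent F, F, rfl⟩
      have h1 := (familyRel_of_totalExponent_eq φ hJ hm (hg E').symm).2.2
      have hle : J.restrictScalars ℤ ⊔ belowSpan φ F.card (totalExponent F) ≤ N := by
        refine sup_le le_sup_left (Submodule.span_le.mpr ?_)
        rintro _ ⟨G, -, h2, rfl⟩
        exact ih _ h2 G rfl
      have h2 : familyElt φ (g E') ∈ N :=
        Submodule.mem_sup_right (Submodule.subset_span ⟨E', rfl⟩)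
      have := Submodule.add_mem _ (hle h1) h2
      rwa [sub_add_cancel] at this
  intro f hf
  have hfN : f ∈ N := by
    refine Submodule.span_le.mpr ?_ (mem_span_familyElt φ f)
    rintro _ ⟨F, rfl⟩
    exact hfam _ F rfl
  obtain ⟨j, hj, x, hx, rfl⟩ := Submodule.mem_sup.mp hfN
  obtain ⟨c, rfl⟩ := (Finsupp.mem_span_range_iff_exists_finsupp).mp hx
  have hj' : j ∈ J := hj
  have hx0 : evalSym L (c.sum fun E a => a • familyElt φ (g E)) = 0 := by
    have h1 := mem_relationIdeal.mp hf
    rw [map_add, mem_relationIdeal.mp (hJI hj'), zero_add] at h1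
    exact h1
  have hc : c = 0 := by
    by_contra hc
    refine (exists_degree_sum_eq (g := fun E : B => toPoly (number φ)
      (evalSym L (familyElt φ (g E)))) (fun E => hg E ▸ hasLead_familyElt φ (g E))
      Subtype.val_injective hc).1 ?_
    have h2 := congrArg (toPoly (number φ)) hx0
    rw [map_zero, Finsupp.sum, map_sum, map_sum] at h2
    rw [Finsupp.sum, ← h2]
    exact Finset.sum_congr rfl fun E _ => by rw [map_zsmul, map_zsmul]
  rw [hc, Finsupp.sum_zero_index, add_zero]
  exact hj'

end Main

end PointsOnLine

end

theorem theorem4p1 {L : Type*} [Fintype L] [DecidableEq L] [Nonempty L]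
    (hL : Even (Fintype.card L)) (ε : PointsOnLine.Orientation L) :
    PointsOnLine.relationIdeal L =
      Ideal.span (PointsOnLine.relationsOfDegree L 2 ∪ PointsOnLine.smallSegreRelations ε) := by
  obtain ⟨m, hm⟩ := hL
  have hpos : 0 < Fintype.card L := Fintype.card_pos
  have hle : Ideal.span (PointsOnLine.relationsOfDegree L 2 ∪
      PointsOnLine.smallSegreRelations ε) ≤ PointsOnLine.relationIdeal L :=
    Ideal.span_le.mpr (Set.union_subset (fun _ h => h.1)
      (PointsOnLine.smallSegreRelations_subset ε))
  exact le_antisymm (PointsOnLine.relationIdeal_le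
    (Fintype.equivFinOfCardEq (n := 2 * m) (by omega)) (by omega) Ideal.subset_span hle) hle
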